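/- \textbf{Definitions.} A \emph{negotiation diagram} $\mathcal N$ consists of finite sets $\mathit{Proc}$ of processes and $N$ of nodes, a non-empty domain $\mathit{dom}(n)\subseteq\mathit{Proc}$ and a finite set $\mathit{out}(n)$ of outcomes for every node $n$, sets $\delta(n,a,p)\subseteq N$ for $a\in\mathit{out}(n)$, $p\in\mathit{dom}(n)$ (with $p\in\mathit{dom}(n')$ for all $n'\in\delta(n,a,p)$), and two distinct nodes $n_{init},n_{fin}$ with domain $\mathit{Proc}$; $n_{fin}$ has no outcome, every other node has at least one. A \emph{location} is a pair $\ell=(n,a)$ with $a\in\mathit{out}(n)$; its domain is $\mathit{dom}(n)$. A \emph{configuration} is a map $C:\mathit{Proc}\to\mathcal P(N)$; $n$ is \emph{enabled} in $C$ if $n\in C(p)$ for all $p\in\mathit{dom}(n)$; then any location $(n,a)$ can be executed, which replaces $C(p)$ by $\delta(n,a,p)$ for all $p\in\mathit{dom}(n)$. A \emph{run} is a sequence of executed locations; it is \emph{successful} if it leads from $C_{init}\equiv\{n_{init}\}$ to $C_{fin}\equiv\{n_{fin}\}$. $\mathcal N$ is \emph{sound} if every finite run from $C_{init}$ can be extended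 to a successful run, and \emph{deterministic} if every $\delta(n,a,p)$ has at most one element. A node is \emph{reachable} if it is enabled in some configuration reachable from $C_{init}$. The \emph{size} $|\mathcal N|=\sum_n|\mathit{dom}(n)|\,(1+|\mathit{out}(n)|)$ counts the pairs (node, participating process) and the transitions. An \emph{analysis framework} is a complete lattice $D$ with a map $[\![\ell]\!]:D\to D$ for each location $\ell$ that is monotone and commutes with joins of non-empty sets. It is \emph{Mazurkiewicz-invariant} if $[\![\ell_1]\!]\circ[\![\ell_2]\!]=[\![\ell_2]\!]\circ[\![\ell_1]\!]$ whenever $\ell_1,\ell_2$ have disjoint domains. For $w=\ell_1\cdots\ell_k$ let $[\![w]\!]=[\![\ell_k]\!]\circ\cdots\circ[\![\ell_1]\!]$. A \emph{scheduler} $S$ assigns to each finite run from $C_{init}$ a node enabled at its end, if there is one; $\ell_1\cdots\ell_k$ is \emph{compatible} with $S$ if $S(\ell_1\cdots\ell_i)$ is the node of $\ell_{i+1}$ for $1\le i<k$. Let $[\![\mathcal N,S]\!]$ be the pointwise join of all $[\![w]\!]$, $w$ a successful run compatible with $S$; the \emph{abstract semantics} $[\![\mathcal N]\!]$ is $\bigsqcap_S[\![\mathcal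 N,S]\!]$, or alternatively $\bigsqcup_S[\![\mathcal N,S]\!]$. Let $\mathrm{MOP}(\mathcal N)$ be the join of $[\![w]\!]$ over all successful runs $w$. For a reachable node $n\ne n_{fin}$ let $I(n)$ be the reachable configuration that enables $n$ and no other node. $F(n)$ is the configuration reached from $I(n)$ by locations with domains $\subseteq\mathit{dom}(n)$ that enables no node other than $n_{fin}$ with domain $\subseteq\mathit{dom}(n)$. For $\ell=(n,a)$, $F(\ell)$ is the configuration reached from $I(n)$ by $\ell$ followed by locations with domains $\subsetneq\mathit{dom}(n)$ that enables no node with domain $\subsetneq\mathit{dom}(n)$. $\mathcal N|_n$ (resp. $\mathcal N|_\ell$) has the processes $\mathit{dom}(n)$, the nodes and locations occurring in such executions from $I(n)$ to $F(n)$ (resp. $F(\ell)$), the initial node $n$, and a new final node, which replaces $\delta(m,b,p)$ whenever $\delta(m,b,p)=F(n)(p)$ (resp. $F(\ell)(p)$). $\mathit{Red}_\ell(\mathcal N)$ replaces the outcome $a$ of $n$ by a new one $a_\ell$ with $\delta(n,a_\ell,p)=F(\ell)(p)$; $\mathit{Red}_n(\mathcal N)$ replaces all outcomes of $n$ by a single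 one $a_n$ with $\delta(n,a_n,p)=F(n)(p)$. A reachable node $n\neq n_{fin}$ is \emph{reduced} if it has a single outcome $a$, and $\delta(n,a,p)=F(n)(p)$ for all $p\in\mathit{dom}(n)$. A diagram is \emph{one-trace} if its graph is acyclic and every non-final node has exactly one outcome; it is a \emph{replication} if for every reachable node $n$ and $a\in\mathit{out}(n)$ there is a node $m$ with $\delta(n,a,p)=\{m\}$ for all processes $p$. \textbf{Algorithm 1.} While there is a reachable non-final non-reduced node: choose such a node $m$ with $\subseteq$-minimal domain and let $X=\mathit{dom}(m)$. (i) For every location $\ell=(n,a)$ of a reachable non-final node with $\mathit{dom}(n)=X$: put $[\![(n,a_\ell)]\!]:=\mathrm{MOP}(\mathcal N|_\ell)$ and $\mathcal N:=\mathit{Red}_\ell(\mathcal N)$. (ii) For every reachable non-final node $n$ with $\mathit{dom}(n)=X$: compute $[\![(n,a_n)]\!]:=\mathrm{MOP}(\mathcal N|_n)$ and $F(n)$. (iii) For the same nodes $n$: $\mathcal N:=\mathit{Red}_n(\mathcal N)$. At the end return $[\![\ell]\!]$ for the unique location $\ell$ of $n_{init}$. \textbf{Theorem.} Let $\mathcal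 N$ be a sound deterministic negotiation diagram with a Mazurkiewicz-invariant analysis framework. Whatever choices are made (of $m$, of the order in the loops, of the names of new outcomes), Algorithm 1 never gets stuck, terminates, and outputs $[\![\mathcal N]\!]$ (in either of the two definitions). Each $\mathcal N|_\ell$ evaluated in (i) is a one-trace negotiation, and each $\mathcal N|_n$ evaluated in (ii) is a replication. Moreover, Algorithm 1 runs in time $O(|\mathcal N|(C+|\mathcal N|))$, with an absolute constant, where $C$ bounds the cost of the same analysis on flow-graphs with at most $|\mathcal N|$ vertices and edges in total. Precisely: the explicit implementation of Algorithm 1 given with the formal statement, which works on the tables of $\mathcal N$ and counts its elementary steps, and which uses any procedure that computes the merge over all paths of every flow-graph of size at most $|\mathcal N|$ in at most $C$ steps, performs a terminating execution of Algorithm 1 within that number of steps. Here the edges of the flow-graphs are labelled by the transformers $[\![\ell]\!]$ of $\mathcal N$ and by merges over all paths of flow-graphs that are so labelled. -/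

import Mathlib

/-! ## Negotiation diagrams -/

/-- The data of a negotiation diagram: finitely many processes `procs` and nodes `nodes`, the domain
`dom n` and the finite set of outcomes `out n` of a node, the transition function `δ n a p`
(meaningful for `a ∈ out n` and `p ∈ dom n` only), and the initial and final node.
The conditions on these data are collected in `Negotiation.WellFormed`. -/
structure Negotiation (Proc Node R : Type*) where
  procs : Finset Proc
  nodes : Finset Node
  dom : Node → Finset Proc
  out : Node → Finset R
  δ : Node → R → Proc → Set Node
  init : Node
  fin : Node

/-- A configuration maps every process to the set of nodes in which it is ready to engage. -/
abbrev Config (Proc Node : Type*) := Proc → Set Node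

namespace Negotiation

variable {Proc Node R D : Type*}

/-- The defining conditions of a negotiation diagram. -/
structure WellFormed (N : Negotiation Proc Node R) : Prop where
  dom_subset : ∀ n ∈ N.nodes, N.dom n ⊆ N.procs
  dom_nonempty : ∀ n ∈ N.nodes, (N.dom n).Nonempty
  δ_mem : ∀ n ∈ N.nodes, ∀ a ∈ N.out n, ∀ p ∈ N.dom n, ∀ n' ∈ N.δ n a p,
    n' ∈ N.nodes ∧ p ∈ N.dom n'
  init_mem : N.init ∈ N.nodes
  fin_mem : N.fin ∈ N.nodes
  init_ne_fin : N.init ≠ N.fin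
  dom_init : N.dom N.init = N.procs
  dom_fin : N.dom N.fin = N.procs
  out_nonempty : ∀ n ∈ N.nodes, n ≠ N.fin → (N.out n).Nonempty
  out_fin : N.out N.fin = ∅

/-- Every process is deterministic. -/
def Deterministic (N : Negotiation Proc Node R) : Prop :=
  ∀ n ∈ N.nodes, ∀ a ∈ N.out n, ∀ p ∈ N.dom n, (N.δ n a p).Subsingleton

/-- `(n, a)` is a location. -/
def IsLoc (N : Negotiation Proc Node R) (l : Node × R) : Prop :=
  l.1 ∈ N.nodes ∧ l.2 ∈ N.out l.1

/-- Node `n` is enabled in configuration `C`. -/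
def Enabled (N : Negotiation Proc Node R) (C : Config Proc Node) (n : Node) : Prop :=
  n ∈ N.nodes ∧ ∀ p ∈ N.dom n, n ∈ C p

open Classical in
/-- The configuration produced from `C` by executing the location `(n, a)`. -/
noncomputable def after (N : Negotiation Proc Node R) (C : Config Proc Node) (n : Node) (a : R) :
    Config Proc Node :=
  fun p => if p ∈ N.dom n then N.δ n a p else C p

/-- `N.Run C w C'`: the finite sequence of locations `w` is a run from `C` to `C'`. -/
inductive Run (N : Negotiation Proc Node R) :
    Config Proc Node → List (Node × R) → Config Proc Node → Prop
  | nil (C) : Run N C [] C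
  | cons {C C' : Config Proc Node} {n : Node} {a : R} {w : List (Node × R)} :
      N.Enabled C n → a ∈ N.out n → Run N (N.after C n a) w C' → Run N C ((n, a) :: w) C'

/-- The initial configuration. -/
def cInit (N : Negotiation Proc Node R) : Config Proc Node :=
  fun p => {n | p ∈ N.procs ∧ n = N.init}

/-- The final configuration. -/
def cFin (N : Negotiation Proc Node R) : Config Proc Node :=
  fun p => {n | p ∈ N.procs ∧ n = N.fin}

/-- `w` is a successful run. -/
def Successful (N : Negotiation Proc Node R) (w : List (Node × R)) : Prop :=
  N.Run N.cInit w N.cFin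

/-- `C` is reachable from the initial configuration. -/
def Reachable (N : Negotiation Proc Node R) (C : Config Proc Node) : Prop :=
  ∃ w, N.Run N.cInit w C

/-- A node is reachable if some reachable configuration enables it. -/
def ReachableNode (N : Negotiation Proc Node R) (n : Node) : Prop :=
  ∃ C, N.Reachable C ∧ N.Enabled C n

/-- Every run from the initial configuration can be completed to a successful run. -/
def Sound (N : Negotiation Proc Node R) : Prop :=
  ∀ w C, N.Run N.cInit w C → ∃ w', N.Run C w' N.cFin

/-- The edges of the graph of a negotiation diagram. -/
def Edge (N : Negotiation Proc Node R) (n n' : Node) : Prop :=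
  n ∈ N.nodes ∧ ∃ a ∈ N.out n, ∃ p ∈ N.dom n, n' ∈ N.δ n a p

/-- The graph has no cycles. -/
def Acyclic (N : Negotiation Proc Node R) : Prop :=
  ∀ n, ¬ Relation.TransGen N.Edge n n

/-- The size of a diagram: the number of pairs (node, participating process) plus the number of
transitions (node, outcome, participating process). -/
def size (N : Negotiation Proc Node R) : ℕ :=
  ∑ n ∈ N.nodes, ((N.dom n).card + (N.out n).card * (N.dom n).card)

/-! ## Analysis frameworks, schedulers, abstract semantics -/

/-- `sem` assigns to every location a monotone function that is distributive, i.e. commutes with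
the join of every non-empty set. -/
def IsFramework [CompleteLattice D] (N : Negotiation Proc Node R) (sem : Node × R → D → D) : Prop :=
  ∀ l, N.IsLoc l → Monotone (sem l) ∧
    ∀ S : Set D, S.Nonempty → sem l (sSup S) = sSup (sem l '' S)

/-- Transformers of independent locations (locations with disjoint domains) commute. -/
def MazurkiewiczInvariant (N : Negotiation Proc Node R) (sem : Node × R → D → D) : Prop :=
  ∀ l₁ l₂, N.IsLoc l₁ → N.IsLoc l₂ → Disjoint (N.dom l₁.1) (N.dom l₂.1) →
    sem l₁ ∘ sem l₂ = sem l₂ ∘ sem l₁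

/-- The abstract semantics of `ℓ₁ ⋯ ℓₖ` is `sem ℓₖ ∘ ⋯ ∘ sem ℓ₁`. -/
def semRun (sem : Node × R → D → D) : List (Node × R) → D → D
  | [] => id
  | l :: w => semRun sem w ∘ sem l

/-- A scheduler assigns to every finite run from the initial configuration a node enabled at its
end, if there is one. (The value on sequences that are not runs is irrelevant.) -/
def IsScheduler (N : Negotiation Proc Node R) (S : List (Node × R) → Option Node) : Prop :=
  ∀ w C, N.Run N.cInit w C →
    (∀ n, S w = some n → N.Enabled C n) ∧ ((∃ n, N.Enabled C n) → ∃ n, S w = some n)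

/-- `w = ℓ₁ ⋯ ℓₖ` is compatible with `S`: `S (ℓ₁ ⋯ ℓᵢ)` is the node of `ℓᵢ₊₁` for `1 ≤ i < k`. -/
def Compatible (S : List (Node × R) → Option Node) (w : List (Node × R)) : Prop :=
  ∀ (i : ℕ) (hi : i < w.length), 1 ≤ i → S (w.take i) = some (w[i].1)

/-- The abstract semantics of `N` with respect to the scheduler `S`. -/
def semScheduler [CompleteLattice D] (N : Negotiation Proc Node R) (sem : Node × R → D → D)
    (S : List (Node × R) → Option Node) : D → D :=
  sSup {f | ∃ w, N.Successful w ∧ Compatible S w ∧ f = semRun sem w}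

/-- The abstract semantics of `N`, as an infimum over all schedulers. -/
def semInf [CompleteLattice D] (N : Negotiation Proc Node R) (sem : Node × R → D → D) : D → D :=
  sInf {f | ∃ S, N.IsScheduler S ∧ f = N.semScheduler sem S}

/-- The abstract semantics of `N`, as a supremum over all schedulers. -/
def semSup [CompleteLattice D] (N : Negotiation Proc Node R) (sem : Node × R → D → D) : D → D :=
  sSup {f | ∃ S, N.IsScheduler S ∧ f = N.semScheduler sem S}

/-- The merge over all paths: the join over all successful runs. -/
def mop [CompleteLattice D] (N : Negotiation Proc Node R) (sem : Node × R → D → D) : D → D :=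
  sSup {f | ∃ w, N.Successful w ∧ f = semRun sem w}

/-! ## The configurations `I(n)`, `F(n)`, `F(ℓ)` and the subnegotiations -/

/-- `C` is the configuration `I(n)`: it is reachable and enables `n` and no other node. -/
def IsFirst (N : Negotiation Proc Node R) (n : Node) (C : Config Proc Node) : Prop :=
  N.Reachable C ∧ ∀ k, N.Enabled C k ↔ k = n

/-- All locations of `w` have a domain included in `dom n`. -/
def IsSeq (N : Negotiation Proc Node R) (n : Node) (w : List (Node × R)) : Prop :=
  ∀ l ∈ w, N.dom l.1 ⊆ N.dom n

/-- All locations of `w` have a domain strictly included in `dom n`. -/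
def IsStrictSeq (N : Negotiation Proc Node R) (n : Node) (w : List (Node × R)) : Prop :=
  ∀ l ∈ w, N.dom l.1 ⊂ N.dom n

/-- Given `C₀ = I(n)`, `C` is the configuration `F(n)`: it is reached from `C₀` by an `n`-sequence,
and enables no node with domain included in `dom n` (the final node, which cannot be executed,
is disregarded). -/
def IsLastNode (N : Negotiation Proc Node R) (n : Node) (C₀ C : Config Proc Node) : Prop :=
  (∃ u, N.IsSeq n u ∧ N.Run C₀ u C) ∧
    ∀ k, N.Enabled C k → k ≠ N.fin → ¬ N.dom k ⊆ N.dom n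

/-- Given `C₀ = I(n)`, `C` is the configuration `F(ℓ)` for `ℓ = (n, a)`: it is reached from `C₀` by
a strict `n`-sequence starting with `ℓ`, and enables no node with domain strictly included in
`dom n`. -/
def IsLastLoc (N : Negotiation Proc Node R) (n : Node) (a : R) (C₀ C : Config Proc Node) : Prop :=
  (∃ u, N.IsStrictSeq n u ∧ N.Run C₀ ((n, a) :: u) C) ∧
    ∀ k, N.Enabled C k → ¬ N.dom k ⊂ N.dom n

open Classical in
/-- The transition function of a subnegotiation with last configuration `C`; the node `none` is the
new final node, and replaces the targets in `C`. -/
noncomputable def subδ (N : Negotiation Proc Node R) (C : Config Proc Node) :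
    Option Node → R → Proc → Set (Option Node)
  | none, _, _ => ∅
  | some m, b, p => if N.δ m b p = C p then {none} else some '' N.δ m b p

open Classical in
/-- The subnegotiation `N|ₙ`, for `C₀ = I(n)` and `C = F(n)`: the nodes and locations that appear
in the `n`-sequences from `C₀` to `C`, with the new final node `none`. -/
noncomputable def subNode (N : Negotiation Proc Node R) (n : Node) (C₀ C : Config Proc Node) :
    Negotiation Proc (Option Node) R where
  procs := N.dom n
  nodes := Finset.insertNone
    (N.nodes.filter fun m => ∃ u b, N.IsSeq n u ∧ N.Run C₀ u C ∧ (m, b) ∈ u)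
  dom := fun m => m.elim (N.dom n) N.dom
  out := fun m => m.elim ∅ fun m =>
    (N.out m).filter fun b => ∃ u, N.IsSeq n u ∧ N.Run C₀ u C ∧ (m, b) ∈ u
  δ := N.subδ C
  init := some n
  fin := none

open Classical in
/-- The subnegotiation `N|_ℓ` of `ℓ = (n, a)`, for `C₀ = I(n)` and `C = F(ℓ)`: the nodes and
locations that appear in the strict `n`-sequences `ℓ u` from `C₀` to `C`, with the new final node
`none`. -/
noncomputable def subLoc (N : Negotiation Proc Node R) (n : Node) (a : R) (C₀ C : Config Proc Node) :
    Negotiation Proc (Option Node) R where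
  procs := N.dom n
  nodes := Finset.insertNone (N.nodes.filter fun m => ∃ u b, N.IsStrictSeq n u ∧
    N.Run C₀ ((n, a) :: u) C ∧ (m, b) ∈ (n, a) :: u)
  dom := fun m => m.elim (N.dom n) N.dom
  out := fun m => m.elim ∅ fun m => (N.out m).filter fun b => ∃ u, N.IsStrictSeq n u ∧
    N.Run C₀ ((n, a) :: u) C ∧ (m, b) ∈ (n, a) :: u
  δ := N.subδ C
  init := some n
  fin := none

/-- The transformers of a subnegotiation are inherited (the new final node has no locations). -/
def subSem (sem : Node × R → D → D) : Option Node × R → D → D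
  | (none, _) => id
  | (some m, b) => sem (m, b)

/-- One-trace negotiations: acyclic, and every node (other than the final one) has exactly one
outcome. -/
def OneTrace (N : Negotiation Proc Node R) : Prop :=
  N.WellFormed ∧ N.Acyclic ∧ ∀ n ∈ N.nodes, n ≠ N.fin → (N.out n).card = 1

/-- Replications: for every reachable node `n` and outcome `a` of `n`, all processes move to one
and the same node. -/
def Replication (N : Negotiation Proc Node R) : Prop :=
  N.WellFormed ∧ ∀ n, N.ReachableNode n → ∀ a ∈ N.out n,
    ∃ m, ∀ p ∈ N.procs, p ∈ N.dom n ∧ N.δ n a p = {m}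

/-! ## Reductions -/

/-- Node `n` is reduced: it has a single outcome, which leads to `F(n)`. -/
def ReducedNode (N : Negotiation Proc Node R) (n : Node) : Prop :=
  ∃ a, N.out n = {a} ∧ ∃ C₀ C, N.IsFirst n C₀ ∧ N.IsLastNode n C₀ C ∧
    ∀ p ∈ N.dom n, N.δ n a p = C p

/-- The reachable nodes, other than the final node, that are not reduced. -/
def NonReduced (N : Negotiation Proc Node R) (n : Node) : Prop :=
  N.ReachableNode n ∧ n ≠ N.fin ∧ ¬ N.ReducedNode n

/-- The reachable nodes, other than the final node, with domain `X`. -/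
def nodesOn (N : Negotiation Proc Node R) (X : Finset Proc) : Set Node :=
  {n | N.ReachableNode n ∧ n ≠ N.fin ∧ N.dom n = X}

/-- The locations of the nodes in `N.nodesOn X`. -/
def locsOn (N : Negotiation Proc Node R) (X : Finset Proc) : Set (Node × R) :=
  {l | l.1 ∈ N.nodesOn X ∧ l.2 ∈ N.out l.1}

variable [DecidableEq Node] [DecidableEq R]

/-- `Red_ℓ` for `ℓ = (n, a)`, where `C = F(ℓ)` and `b` is the name of the new outcome `a_ℓ`. -/
def redLoc (N : Negotiation Proc Node R) (n : Node) (a b : R) (C : Config Proc Node) :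
    Negotiation Proc Node R :=
  { N with
    out := Function.update N.out n (insert b ((N.out n).erase a))
    δ := Function.update N.δ n (Function.update (N.δ n) b C) }

/-- `Red_n`, where `C = F(n)` and `b` is the name of the new outcome `a_n`. -/
def redNode (N : Negotiation Proc Node R) (n : Node) (b : R) (C : Config Proc Node) :
    Negotiation Proc Node R :=
  { N with
    out := Function.update N.out n {b}
    δ := Function.update N.δ n (Function.update (N.δ n) b C) }

end Negotiation

/-! ## The reduction algorithm -/

/-- The states of the reduction algorithm: at the head of the while loop, in one of its three
successive for-loops (with the set of locations or nodes that are still to be treated), or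
stopped with a result. All states but the last hold the current diagram and its transformers;
`tab` holds the pairs `(⟦(n, a_n)⟧, F(n))` computed in the second for-loop. -/
inductive AlgState (Proc Node R D : Type*)
  | head (N : Negotiation Proc Node R) (sem : Node × R → D → D)
  | forLoc (N : Negotiation Proc Node R) (sem : Node × R → D → D) (X : Finset Proc)
      (todo : Set (Node × R))
  | forVal (N : Negotiation Proc Node R) (sem : Node × R → D → D) (X : Finset Proc)
      (todo : Set Node) (tab : Node → (D → D) × Config Proc Node)
  | forRed (N : Negotiation Proc Node R) (sem : Node × R → D → D)
      (todo : Set Node) (tab : Node → (D → D) × Config Proc Node)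
  | done (f : D → D)

section

variable {Proc Node R D : Type*} [DecidableEq Node] [DecidableEq R] [CompleteLattice D]

open Negotiation

/-- The steps of the reduction algorithm. The choice of the minimal non-reduced node, the order in
which the for-loops treat their locations or nodes, and the names of the new outcomes are
arbitrary. -/
inductive AlgStep : AlgState Proc Node R D → AlgState Proc Node R D → Prop
  /-- there are non-reduced nodes, and `m` is a minimal one -/
  | enter {N : Negotiation Proc Node R} {sem} (m : Node) :
      N.NonReduced m → (∀ m', N.NonReduced m' → ¬ N.dom m' ⊂ N.dom m) →
      AlgStep (.head N sem) (.forLoc N sem (N.dom m) (N.locsOn (N.dom m)))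
  /-- `⟦(n, a_ℓ)⟧ := MOP(N|_ℓ)` and `N := Red_ℓ(N)`, for `ℓ = (n, a)` -/
  | reduceLoc {N : Negotiation Proc Node R} {sem X todo} (n : Node) (a b : R)
      (C₀ C : Config Proc Node) :
      (n, a) ∈ todo → N.IsFirst n C₀ → N.IsLastLoc n a C₀ C → b ∉ (N.out n).erase a →
      AlgStep (.forLoc N sem X todo)
        (.forLoc (N.redLoc n a b C)
          (Function.update sem (n, b) ((N.subLoc n a C₀ C).mop (subSem sem))) X (todo \ {(n, a)}))
  | locsDone {N : Negotiation Proc Node R} {sem X} :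
      AlgStep (.forLoc N sem X ∅) (.forVal N sem X (N.nodesOn X) fun _ => (id, fun _ => ∅))
  /-- `⟦(n, a_n)⟧ := MOP(N|_n)` -/
  | value {N : Negotiation Proc Node R} {sem X todo tab} (n : Node) (C₀ C : Config Proc Node) :
      n ∈ todo → N.IsFirst n C₀ → N.IsLastNode n C₀ C →
      AlgStep (.forVal N sem X todo tab)
        (.forVal N sem X (todo \ {n})
          (Function.update tab n ((N.subNode n C₀ C).mop (subSem sem), C)))
  | valuesDone {N : Negotiation Proc Node R} {sem X tab} :
      AlgStep (.forVal N sem X ∅ tab) (.forRed N sem (N.nodesOn X) tab)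
  /-- `N := Red_n(N)` -/
  | reduceNode {N : Negotiation Proc Node R} {sem todo tab} (n : Node) (b : R) :
      n ∈ todo →
      AlgStep (.forRed N sem todo tab)
        (.forRed (N.redNode n b (tab n).2) (Function.update sem (n, b) (tab n).1) (todo \ {n}) tab)
  | nodesDone {N : Negotiation Proc Node R} {sem tab} :
      AlgStep (.forRed N sem ∅ tab) (.head N sem)
  /-- return `⟦ℓ⟧`, where `ℓ` is the unique outcome of the initial node -/
  | output {N : Negotiation Proc Node R} {sem} (a : R) :
      (∀ n, ¬ N.NonReduced n) → N.out N.init = {a} →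
      AlgStep (.head N sem) (.done (sem (N.init, a)))

end

/-! ## Flow-graphs -/

/-- A flow-graph: its edges are triples (source, transformer, target). -/
structure FlowGraph (V D : Type*) where
  verts : List V
  edges : List (V × (D → D) × V)
  init : V
  fin : V

namespace FlowGraph

variable {V D : Type*}

/-- The number of vertices and edges. -/
def size (G : FlowGraph V D) : ℕ := G.verts.length + G.edges.length

/-- `w` is a path from `u` to `v`. -/
def IsPath (G : FlowGraph V D) : V → List (V × (D → D) × V) → V → Prop
  | u, [], v => u = v
  | u, e :: w, v => e ∈ G.edges ∧ e.1 = u ∧ G.IsPath e.2.2 w v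

/-- The composition of the transformers along a path, the first edge being applied first. -/
def semPath : List (V × (D → D) × V) → D → D
  | [] => id
  | e :: w => semPath w ∘ e.2.1

/-- The merge over all paths from the initial to the final vertex. -/
def mop [CompleteLattice D] (G : FlowGraph V D) : D → D :=
  sSup {f | ∃ w, G.IsPath G.init w G.fin ∧ f = semPath w}

end FlowGraph

/-- The transformers of the analysis: those of the locations of `N`, and the values of the analysis
on flow-graphs labelled with transformers of the analysis. -/
inductive Transformer {Proc Node R D : Type*} [CompleteLattice D] (N : Negotiation Proc Node R)
    (sem : Node × R → D → D) : (D → D) → Prop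
  | loc (l : Node × R) : N.IsLoc l → Transformer N sem (sem l)
  | mop (G : FlowGraph (Option Node) D) :
      (∀ e ∈ G.edges, Transformer N sem e.2.1) → Transformer N sem G.mop

/-! ## Step counting -/

/-- The result of a computation together with the number of elementary steps it takes. -/
structure Timed (α : Type*) where
  val : α
  time : ℕ

namespace Timed

variable {α β σ : Type*}

/-- A constant number of elementary operations (comparing or copying a process, node, outcome or
number, reading or writing one entry of a table, one operation at the front of a list). -/
def step (x : α) : Timed α := ⟨x, 1⟩

/-- Add `k` steps. -/
def charge (k : ℕ) (x : Timed α) : Timed α := ⟨x.val, k + x.time⟩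

/-- Sequential composition. -/
def bind (x : Timed α) (f : α → Timed β) : Timed β := ⟨(f x.val).val, x.time + (f x.val).time⟩

/-- A loop over a list with loop body `f`; every round costs one step in addition to its body. -/
def forIn (f : σ → α → Timed σ) : List α → σ → Timed σ
  | [], s => step s
  | x :: l, s => charge 1 ((f s x).bind fun s' => forIn f l s')

end Timed

/-! ## Implementation of the reduction algorithm with step counts

A deterministic diagram is stored in tables: the list of its nodes, for every node the lists of its
processes and of its outcomes (stored with their lengths), for every location and process the
successor node, and for every location its transformer. Tables are modelled as functions, lists are
traversed from the front. The new outcome of a reduced location keeps the old name, and the new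
outcome of a reduced node gets the name of one of its former outcomes. -/

/-- The tables that represent a deterministic diagram with transformers. -/
structure Tables (Proc Node R D : Type*) where
  nodes : List Node
  init : Node
  fin : Node
  dom : Node → List Proc
  out : Node → List R
  next : Node → R → Proc → Option Node
  val : Node → R → D → D

namespace Tables

variable {Proc Node R D : Type*} [DecidableEq Proc] [DecidableEq Node] [DecidableEq R]

/-- The tables represent the diagram `N` with the transformers `sem`. -/
structure Represents (T : Tables Proc Node R D) (N : Negotiation Proc Node R)
    (sem : Node × R → D → D) : Prop where
  nodes_nodup : T.nodes.Nodup
  mem_nodes : ∀ n, n ∈ T.nodes ↔ n ∈ N.nodes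
  init_eq : T.init = N.init
  fin_eq : T.fin = N.fin
  dom_nodup : ∀ n ∈ N.nodes, (T.dom n).Nodup
  mem_dom : ∀ n ∈ N.nodes, ∀ p, p ∈ T.dom n ↔ p ∈ N.dom n
  out_nodup : ∀ n ∈ N.nodes, (T.out n).Nodup
  mem_out : ∀ n ∈ N.nodes, ∀ a, a ∈ T.out n ↔ a ∈ N.out n
  next_eq : ∀ n ∈ N.nodes, ∀ a ∈ N.out n, ∀ p ∈ N.dom n, N.δ n a p = {m | T.next n a p = some m}
  val_eq : ∀ n ∈ N.nodes, ∀ a ∈ N.out n, T.val n a = sem (n, a)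

/-- Overwrite one successor. -/
def setNext (T : Tables Proc Node R D) (n : Node) (a : R) (p : Proc) (k : Option Node) :
    Tables Proc Node R D :=
  { T with
    next := Function.update T.next n
      (Function.update (T.next n) a (Function.update (T.next n a) p k)) }

/-- Overwrite one transformer. -/
def setVal (T : Tables Proc Node R D) (n : Node) (a : R) (f : D → D) : Tables Proc Node R D :=
  { T with val := Function.update T.val n (Function.update (T.val n) a f) }

/-- Overwrite all successors of a location by those in `pos`. -/
def setTargets (T : Tables Proc Node R D) (n : Node) (a : R) (pos : Proc → Option Node) :
    Timed (Tables Proc Node R D) :=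
  Timed.forIn (fun T p => Timed.step (T.setNext n a p (pos p))) (T.dom n) T

/-! ### Executing a trace -/

/-- The state of the execution of a trace: the current node of every process involved, the number
of these processes waiting at every node, the nodes found to be enabled, and the locations
executed so far, the last one first. -/
structure Play (Proc Node R : Type*) where
  pos : Proc → Option Node
  cnt : Node → ℕ
  ready : List Node
  trace : List (Node × R)

/-- The state before the execution. -/
def blank : Play Proc Node R := ⟨fun _ => none, fun _ => 0, [], []⟩

/-- The cost of setting up the tables of a `Play`. -/
def blankCost (T : Tables Proc Node R D) : ℕ := T.nodes.length + (T.dom T.init).length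

/-- Process `p` moves to node `k`. If this completes the processes of `k`, and `k` has fewer than
`bound` processes, then `k` is recorded as enabled. -/
def arrive (T : Tables Proc Node R D) (bound : ℕ) (s : Play Proc Node R) (p : Proc) :
    Option Node → Play Proc Node R
  | none => { s with pos := Function.update s.pos p none }
  | some k =>
    { s with
      pos := Function.update s.pos p (some k),
      cnt := Function.update s.cnt k (s.cnt k + 1),
      ready := if s.cnt k + 1 = (T.dom k).length ∧ s.cnt k + 1 < bound ∧ k ≠ T.fin
        then k :: s.ready else s.ready }

/-- Execute the location `(k, a)`. -/
def fire (T : Tables Proc Node R D) (bound : ℕ) (s : Play Proc Node R) (k : Node) (a : R) :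
    Timed (Play Proc Node R) :=
  Timed.forIn (fun s p => Timed.step (arrive T bound s p (T.next k a p))) (T.dom k)
    { s with cnt := Function.update s.cnt k 0, trace := (k, a) :: s.trace }

/-- Execute nodes that were found to be enabled, each with its first outcome, until none is left
or the given number of rounds is exhausted. -/
def play (T : Tables Proc Node R D) (bound : ℕ) : ℕ → Play Proc Node R → Timed (Play Proc Node R)
  | 0, s => Timed.step s
  | fuel + 1, s =>
    match s.ready with
    | [] => Timed.step s
    | k :: rest =>
      match T.out k with
      | [] => Timed.step s
      | a :: _ => Timed.charge 1
          ((fire T bound { s with ready := rest } k a).bind (play T bound fuel))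

/-- Execute the location `(n, a)` and then nodes with domains strictly included in that of `n`. -/
def runTrace (T : Tables Proc Node R D) (n : Node) (a : R) : Timed (Play Proc Node R) :=
  Timed.charge T.blankCost
    ((fire T (T.dom n).length blank n a).bind (play T (T.dom n).length T.nodes.length))

/-- The edges of the flow-graph of a trace (given in reverse order) that leads to vertex `v`. -/
def pathEdges (T : Tables Proc Node R D) :
    List (Node × R) → Option Node → List (Option Node × (D → D) × Option Node)
  | [], _ => []
  | (k, a) :: w, v => (some k, T.val k a, v) :: pathEdges T w (some k)

/-- The flow-graph of a trace (given in reverse order) that starts in `n`: a sequence of edges. -/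
def traceGraph (T : Tables Proc Node R D) (n : Node) (w : List (Node × R)) :
    FlowGraph (Option Node) D where
  verts := none :: w.map fun l => some l.1
  edges := T.pathEdges w none
  init := some n
  fin := none

/-- Body of the first for-loop, for the location `(n, a)`. -/
def reduceLoc (solve : FlowGraph (Option Node) D → Timed (D → D)) (T : Tables Proc Node R D)
    (n : Node) (a : R) : Timed (Tables Proc Node R D) :=
  (T.runTrace n a).bind fun s =>
  (Timed.charge (T.traceGraph n s.trace).size (solve (T.traceGraph n s.trace))).bind fun f =>
  (T.setTargets n a s.pos).bind fun T' =>
  Timed.step (T'.setVal n a f)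

/-! ### Exploring a replication -/

/-- The state of the exploration of a replication: the nodes seen, the nodes seen whose outcomes
have not been explored yet, the flow-graph (its vertices and edges) built so far, and a location
that leaves the replication. -/
structure Explore (Node R D : Type*) where
  seen : Node → Bool
  stack : List Node
  verts : List (Option Node)
  edges : List (Option Node × (D → D) × Option Node)
  exit : Option (Node × R)

/-- If the location `(k, a)` leads all its processes to one and the same node, which is not final
and has the same domain as `k`, then return that node. -/
def uniform (T : Tables Proc Node R D) (k : Node) (a : R) : Timed (Option Node) :=
  match T.dom k with
  | [] => Timed.step none
  | p :: ps =>
    match T.next k a p with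
    | none => Timed.step none
    | some k' =>
      if k' ≠ T.fin ∧ (T.dom k').length = (T.dom k).length then
        Timed.forIn
          (fun r q => Timed.step (if T.next k a q = some k' then r else none)) ps (some k')
      else Timed.step none

/-- Explore the location `(k, a)`. -/
def exploreLoc (T : Tables Proc Node R D) (k : Node) (s : Explore Node R D) (a : R) :
    Timed (Explore Node R D) :=
  (T.uniform k a).bind fun r =>
    match r with
    | none => Timed.step
        { s with edges := (some k, T.val k a, none) :: s.edges, exit := some (k, a) }
    | some k' => Timed.step
        (if s.seen k' then { s with edges := (some k, T.val k a, some k') :: s.edges }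
        else
          { s with
            seen := Function.update s.seen k' true
            stack := k' :: s.stack
            verts := some k' :: s.verts
            edges := (some k, T.val k a, some k') :: s.edges })

/-- Explore nodes until none is left or the given number of rounds is exhausted. -/
def explore (T : Tables Proc Node R D) : ℕ → Explore Node R D → Timed (Explore Node R D)
  | 0, s => Timed.step s
  | fuel + 1, s =>
    match s.stack with
    | [] => Timed.step s
    | k :: rest => Timed.charge 1
        ((Timed.forIn (T.exploreLoc k) (T.out k) { s with stack := rest }).bind (explore T fuel))

/-- Body of the second for-loop, for the node `n`: compute the value of the replication that
starts in `n`, and the nodes its processes move to when they leave it. -/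
def summarize (solve : FlowGraph (Option Node) D → Timed (D → D)) (T : Tables Proc Node R D)
    (n : Node) : Timed ((D → D) × (Proc → Option Node)) :=
  (Timed.charge T.blankCost (T.explore T.nodes.length
    ⟨Function.update (fun _ => false) n true, [n], [some n, none], [], none⟩)).bind fun s =>
  (solve ⟨s.verts, s.edges, some n, none⟩).bind fun f =>
    match s.exit with
    | none => Timed.step (f, fun _ => none)
    | some (k, a) =>
      (Timed.forIn (fun (pos : Proc → Option Node) p =>
        Timed.step (Function.update pos p (T.next k a p))) (T.dom n) fun _ => none).bind fun pos =>
      Timed.step (f, pos)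

/-- Body of the third for-loop: give the node `n` a single outcome, with the given transformer and
successors. -/
def installNode (T : Tables Proc Node R D) (x : Node × (D → D) × (Proc → Option Node)) :
    Timed (Tables Proc Node R D) :=
  match T.out x.1 with
  | [] => Timed.step T
  | a :: _ =>
    (T.setTargets x.1 a x.2.2).bind fun T' =>
    Timed.step { (T'.setVal x.1 a x.2.1) with out := Function.update T'.out x.1 [a] }

/-! ### The while loop -/

/-- Graph search: visit nodes until none is left or the given number of rounds is exhausted. -/
def search (T : Tables Proc Node R D) : ℕ → (Node → Bool) × List Node →
    Timed ((Node → Bool) × List Node)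
  | 0, s => Timed.step s
  | fuel + 1, (seen, stack) =>
    match stack with
    | [] => Timed.step (seen, [])
    | k :: rest => Timed.charge 1
        ((Timed.forIn (fun s a => Timed.forIn (fun (s : (Node → Bool) × List Node) p =>
          match T.next k a p with
          | none => Timed.step s
          | some k' => Timed.step
              (if s.1 k' then s else (Function.update s.1 k' true, k' :: s.2)))
            (T.dom k) s) (T.out k) (seen, rest)).bind (search T fuel))

/-- The table of the nodes that can be reached from the initial node in the graph. -/
def reach (T : Tables Proc Node R D) : Timed (Node → Bool) :=
  (Timed.charge T.nodes.length (T.search T.nodes.length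
    (Function.update (fun _ => false) T.init true, [T.init]))).bind fun s => Timed.step s.1

/-- Test whether the node `m` is reduced: it has a single outcome, after which no node with domain
included in that of `m` is enabled. -/
def testReduced (T : Tables Proc Node R D) (m : Node) : Timed Bool :=
  match T.out m with
  | [a] => Timed.charge T.blankCost
      ((fire T ((T.dom m).length + 1) blank m a).bind fun s => Timed.step s.ready.isEmpty)
  | _ => Timed.step false

/-- The list of the reached nodes, other than the final node, with the same domain as `m`. -/
def sameDom (T : Tables Proc Node R D) (reached : Node → Bool) (m : Node) : Timed (List Node) :=
  (Timed.charge (T.dom T.init).length (Timed.forIn (fun (mark : Proc → Bool) p =>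
    Timed.step (Function.update mark p true)) (T.dom m) fun _ => false)).bind fun mark =>
  Timed.forIn (fun ns n =>
    if reached n ∧ n ≠ T.fin ∧ (T.dom n).length = (T.dom m).length then
      (Timed.forIn (fun (b : Bool) p => Timed.step (b && mark p)) (T.dom n) true).bind fun b =>
      Timed.step (if b then n :: ns else ns)
    else Timed.step ns) T.nodes []

/-- Body of the while loop for the minimal non-reduced node `m`. -/
def whileBody (solve : FlowGraph (Option Node) D → Timed (D → D)) (reached : Node → Bool)
    (T : Tables Proc Node R D) (m : Node) : Timed (Tables Proc Node R D) :=
  (T.sameDom reached m).bind fun ns =>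
  (Timed.forIn (fun T n =>
    Timed.forIn (fun T a => reduceLoc solve T n a) (T.out n) T) ns T).bind fun T₁ =>
  (Timed.forIn (fun l n => (summarize solve T₁ n).bind fun x => Timed.step ((n, x) :: l))
    ns []).bind fun l =>
  Timed.forIn (fun T x => installNode T x) l T₁

/-- Perform the body of the while loop for `m` if `m` is reachable, not final and not reduced. -/
def visit (solve : FlowGraph (Option Node) D → Timed (D → D)) (T : Tables Proc Node R D)
    (m : Node) : Timed (Tables Proc Node R D) :=
  T.reach.bind fun reached =>
  if reached m ∧ m ≠ T.fin then
    (T.testReduced m).bind fun b => if b then Timed.step T else whileBody solve reached T m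
  else Timed.step T

/-- The while loop: the nodes are inspected in the order of the sizes of their domains. -/
def reduceAll (solve : FlowGraph (Option Node) D → Timed (D → D)) (T : Tables Proc Node R D) :
    Timed (Tables Proc Node R D) :=
  Timed.forIn (fun T c => Timed.forIn (fun T m =>
    if (T.dom m).length = c then visit solve T m else Timed.step T) T.nodes T)
    (List.range ((T.dom T.init).length + 1)) T

/-- The implementation of the reduction algorithm, with a procedure `solve` for the analysis of
flow-graphs. It returns the tables at the end of the while loop, and the transformer of the outcome
of the initial node. -/
def run (solve : FlowGraph (Option Node) D → Timed (D → D)) (T : Tables Proc Node R D) :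
    Timed (Tables Proc Node R D × Option (D → D)) :=
  (reduceAll solve T).bind fun T' =>
  Timed.step (T', (T'.out T'.init).head?.map (T'.val T'.init))

end Tables

set_option linter.unusedSectionVars false

namespace Negotiation

/-! ## Runs and commutation -/

section Basics

variable {Proc Node R D : Type*} {N : Negotiation Proc Node R}

theorem run_nil_iff {C C' : Config Proc Node} : N.Run C [] C' ↔ C = C' :=
  ⟨fun h => by cases h; rfl, fun h => h ▸ Run.nil C⟩

theorem run_cons_iff {C C' : Config Proc Node} {n : Node} {a : R} {w : List (Node × R)} :
    N.Run C ((n, a) :: w) C' ↔ N.Enabled C n ∧ a ∈ N.out n ∧ N.Run (N.after C n a) w C' :=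
  ⟨fun h => by cases h with | cons h1 h2 h3 => exact ⟨h1, h2, h3⟩, fun h => .cons h.1 h.2.1 h.2.2⟩

theorem run_append_iff {C C' : Config Proc Node} {u v : List (Node × R)} :
    N.Run C (u ++ v) C' ↔ ∃ E, N.Run C u E ∧ N.Run E v C' := by
  induction u generalizing C with
  | nil => simp [run_nil_iff]
  | cons l u ih =>
    obtain ⟨n, a⟩ := l
    simp only [List.cons_append, run_cons_iff, ih]
    grind

theorem Run.append {C E C' : Config Proc Node} {u v : List (Node × R)} (h : N.Run C u E)
    (h' : N.Run E v C') : N.Run C (u ++ v) C' :=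
  run_append_iff.2 ⟨E, h, h'⟩

theorem Run.eq {C C' C'' : Config Proc Node} {w : List (Node × R)} (h : N.Run C w C')
    (h' : N.Run C w C'') : C' = C'' := by
  induction h with
  | nil => exact run_nil_iff.1 h'
  | cons _ _ _ ih => exact ih (run_cons_iff.1 h').2.2

theorem Run.isLoc {C C' : Config Proc Node} {w : List (Node × R)} (h : N.Run C w C') :
    ∀ l ∈ w, N.IsLoc l := by
  induction h with
  | nil => simp
  | cons h1 h2 _ ih =>
    intro l hl
    rcases List.mem_cons.1 hl with rfl | hl
    · exact ⟨h1.1, h2⟩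
    · exact ih l hl

theorem after_of_mem {C : Config Proc Node} {n : Node} {a : R} {p : Proc} (h : p ∈ N.dom n) :
    N.after C n a p = N.δ n a p := by
  simp [after, h]

theorem after_of_notMem {C : Config Proc Node} {n : Node} {a : R} {p : Proc} (h : p ∉ N.dom n) :
    N.after C n a p = C p := by
  simp [after, h]

theorem Run.outside {C C' : Config Proc Node} {w : List (Node × R)} (h : N.Run C w C') {p : Proc}
    (hp : ∀ l ∈ w, p ∉ N.dom l.1) : C' p = C p := by
  induction h with
  | nil => rfl
  | cons h1 h2 _ ih =>
    rw [ih fun l hl => hp l (List.mem_cons_of_mem _ hl), after_of_notMem (hp _ List.mem_cons_self)]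

theorem after_comm {C : Config Proc Node} {n m : Node} {a b : R}
    (h : Disjoint (N.dom n) (N.dom m)) :
    N.after (N.after C n a) m b = N.after (N.after C m b) n a := by
  funext p
  by_cases hn : p ∈ N.dom n <;> by_cases hm : p ∈ N.dom m
  · exact absurd hm (Finset.disjoint_left.1 h hn)
  all_goals simp [after, hn, hm]

theorem enabled_congr {C C' : Config Proc Node} {n : Node} (h : ∀ p ∈ N.dom n, C p = C' p) :
    N.Enabled C n ↔ N.Enabled C' n := by
  unfold Enabled
  refine and_congr_right fun _ => forall₂_congr fun p hp => by rw [h p hp]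

theorem enabled_after_iff {C : Config Proc Node} {n m : Node} {b : R}
    (h : Disjoint (N.dom n) (N.dom m)) : N.Enabled (N.after C m b) n ↔ N.Enabled C n :=
  enabled_congr fun _ hp => after_of_notMem (Finset.disjoint_left.1 h hp)

theorem Run.congr {C C' E : Config Proc Node} {w : List (Node × R)} {X : Finset Proc}
    (h : N.Run C w C') (hX : ∀ l ∈ w, N.dom l.1 ⊆ X) (hE : ∀ p ∈ X, C p = E p) :
    ∃ E', N.Run E w E' ∧ (∀ p ∈ X, E' p = C' p) ∧ ∀ p ∉ X, E' p = E p := by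
  induction h generalizing E with
  | nil => exact ⟨E, .nil E, fun p hp => (hE p hp).symm, fun _ _ => rfl⟩
  | @cons C C' n a w h1 h2 _ ih =>
    have hn := hX _ List.mem_cons_self
    obtain ⟨E', r, i, o⟩ := ih (E := N.after E n a)
      (fun l hl => hX l (List.mem_cons_of_mem _ hl)) (fun p hp => by
        by_cases h : p ∈ N.dom n
        · simp [after, h]
        · simp [after, h, hE p hp])
    refine ⟨E', .cons ((enabled_congr fun p hp => hE p (hn hp)).1 h1) h2 r, i, fun p hp => ?_⟩
    rw [o p hp, after_of_notMem fun h => hp (hn h)]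

/-- Every process is ready to engage in at most one node. -/
def Subsing (C : Config Proc Node) : Prop := ∀ p, (C p).Subsingleton

theorem Subsing.after (hD : N.Deterministic) {C : Config Proc Node} (hC : Subsing C) {n : Node}
    {a : R} (hn : n ∈ N.nodes) (ha : a ∈ N.out n) : Subsing (N.after C n a) := by
  intro p
  by_cases h : p ∈ N.dom n
  · rw [after_of_mem h]; exact hD n hn a ha p h
  · rw [after_of_notMem h]; exact hC p

theorem Subsing.run (hD : N.Deterministic) {C C' : Config Proc Node} {w : List (Node × R)}
    (h : N.Run C w C') (hC : Subsing C) : Subsing C' := by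
  induction h with
  | nil => exact hC
  | cons h1 h2 _ ih => exact ih (hC.after hD h1.1 h2)

theorem subsing_cInit : Subsing N.cInit := by
  rintro p x ⟨_, rfl⟩ y ⟨_, rfl⟩; rfl

theorem Subsing.eq_singleton {C : Config Proc Node} (hC : Subsing C) {p : Proc} {k : Node}
    (h : k ∈ C p) : C p = {k} :=
  (hC p).eq_singleton_of_mem h

theorem Enabled.disjoint {C : Config Proc Node} (hC : Subsing C) {k m : Node}
    (hk : N.Enabled C k) (hm : N.Enabled C m) (h : k ≠ m) : Disjoint (N.dom k) (N.dom m) :=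
  Finset.disjoint_left.2 fun p h1 h2 => h (hC p (hk.2 p h1) (hm.2 p h2))

/-- Equality of sequences of locations up to the order of adjacent locations with disjoint
domains. -/
inductive TraceEq (N : Negotiation Proc Node R) : List (Node × R) → List (Node × R) → Prop
  | refl (w) : TraceEq N w w
  | cons (l) {u v} : TraceEq N u v → TraceEq N (l :: u) (l :: v)
  | swap (l l') (u) : Disjoint (N.dom l.1) (N.dom l'.1) → TraceEq N (l :: l' :: u) (l' :: l :: u)
  | trans {u v w} : TraceEq N u v → TraceEq N v w → TraceEq N u w

theorem TraceEq.perm {u v : List (Node × R)} (h : N.TraceEq u v) : u.Perm v := by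
  induction h with
  | refl => rfl
  | cons l _ ih => exact ih.cons l
  | swap l l' u _ => exact List.Perm.swap l' l u
  | trans _ _ h1 h2 => exact h1.trans h2

theorem TraceEq.run {u v : List (Node × R)} (h : N.TraceEq u v) {C C' : Config Proc Node}
    (hr : N.Run C u C') : N.Run C v C' := by
  induction h generalizing C with
  | refl => exact hr
  | cons l _ ih =>
    obtain ⟨h1, h2, h3⟩ := run_cons_iff.1 hr
    exact .cons h1 h2 (ih h3)
  | swap l l' u hd =>
    obtain ⟨h1, h2, h3⟩ := run_cons_iff.1 hr
    obtain ⟨h4, h5, h6⟩ := run_cons_iff.1 h3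
    refine .cons ((enabled_after_iff hd.symm).1 h4) h5 (.cons ((enabled_after_iff hd).2 h1) h2 ?_)
    rwa [← after_comm hd]
  | trans _ _ h1 h2 => exact h2 (h1 hr)

theorem semRun_append (sem : Node × R → D → D) (u v : List (Node × R)) :
    semRun sem (u ++ v) = semRun sem v ∘ semRun sem u := by
  induction u with
  | nil => rfl
  | cons l u ih => rw [List.cons_append, semRun, ih, semRun]; rfl

theorem TraceEq.semRun {sem : Node × R → D → D} (hM : N.MazurkiewiczInvariant sem)
    {u v : List (Node × R)} (h : N.TraceEq u v) (hu : ∀ l ∈ u, N.IsLoc l) :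
    semRun sem u = semRun sem v := by
  induction h with
  | refl => rfl
  | cons l _ ih =>
    rw [Negotiation.semRun, Negotiation.semRun, ih fun l hl => hu l (List.mem_cons_of_mem _ hl)]
  | swap l l' u hd =>
    simp only [Negotiation.semRun, Function.comp_assoc]
    rw [hM l' l (hu _ (by simp)) (hu _ (by simp)) hd.symm]
  | trans h1 _ ih1 ih2 => rw [ih1 hu, ih2 fun l hl => hu l (h1.perm.mem_iff.2 hl)]

/-- Either an enabled node is not executed in a run, and then it stays enabled, or its first
execution can be moved to the front. -/
theorem Run.pull (hD : N.Deterministic) {C C' : Config Proc Node} (hC : Subsing C)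
    {w : List (Node × R)} (h : N.Run C w C') {k : Node} (hk : N.Enabled C k) :
    ((∀ l ∈ w, Disjoint (N.dom l.1) (N.dom k)) ∧ N.Enabled C' k) ∨
      ∃ a w', N.TraceEq w ((k, a) :: w') ∧ N.Run C ((k, a) :: w') C' := by
  induction h with
  | nil => exact .inl ⟨by simp, hk⟩
  | @cons C C' n a w h1 h2 h3 ih =>
    by_cases hnk : n = k
    · subst hnk
      exact .inr ⟨a, w, .refl _, .cons h1 h2 h3⟩
    have hd := h1.disjoint hC hk hnk
    rcases ih (hC.after hD h1.1 h2) ((enabled_after_iff hd.symm).2 hk) with ⟨i1, i2⟩ | ⟨b, w', i1, _⟩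
    · refine .inl ⟨fun l hl => ?_, i2⟩
      rcases List.mem_cons.1 hl with rfl | hl
      exacts [hd, i1 l hl]
    · have ht : N.TraceEq ((n, a) :: w) ((k, b) :: (n, a) :: w') := (i1.cons _).trans (.swap _ _ _ hd)
      exact .inr ⟨b, _, ht, ht.run (.cons h1 h2 h3)⟩

/-- If a process leaves a node during a run, then the node is executed. -/
theorem Run.exists_leave (hD : N.Deterministic) {C C' : Config Proc Node} (hC : Subsing C)
    {w : List (Node × R)} (h : N.Run C w C') {p : Proc} {k : Node} (hk : k ∈ C p)
    (hk' : k ∉ C' p) : ∃ w₁ a w₂ E, w = w₁ ++ (k, a) :: w₂ ∧ (∀ l ∈ w₁, p ∉ N.dom l.1) ∧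
      N.Run C w₁ E ∧ N.Enabled E k ∧ p ∈ N.dom k := by
  induction h with
  | nil => exact absurd hk hk'
  | @cons C C' n a w h1 h2 h3 ih =>
    by_cases hp : p ∈ N.dom n
    · obtain rfl := hC p hk (h1.2 p hp)
      exact ⟨[], a, w, C, rfl, by simp, .nil C, h1, hp⟩
    · obtain ⟨w₁, b, w₂, E, rfl, i1, i2, i3⟩ := ih (hC.after hD h1.1 h2)
        (by rwa [after_of_notMem hp]) hk'
      refine ⟨(n, a) :: w₁, b, w₂, E, rfl, fun l hl => ?_, .cons h1 h2 i2, i3⟩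
      rcases List.mem_cons.1 hl with rfl | hl
      exacts [hp, i1 l hl]

end Basics

/-! ## Sound deterministic diagrams -/

/-- Sound deterministic diagrams. -/
structure SoundDet {Proc Node R : Type*} (N : Negotiation Proc Node R) : Prop where
  wf : N.WellFormed
  det : N.Deterministic
  sound : N.Sound

section SoundDet

variable {Proc Node R D : Type*} {N : Negotiation Proc Node R}

theorem Reachable.subsing (hN : N.SoundDet) {C : Config Proc Node} (h : N.Reachable C) :
    Subsing C :=
  h.elim fun _ hw => subsing_cInit.run hN.det hw

theorem Reachable.run {C C' : Config Proc Node} {w : List (Node × R)} (h : N.Reachable C)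
    (hr : N.Run C w C') : N.Reachable C' :=
  h.elim fun _ hw => ⟨_, hw.append hr⟩

theorem Reachable.after {C : Config Proc Node} {n : Node} {a : R} (h : N.Reachable C)
    (hn : N.Enabled C n) (ha : a ∈ N.out n) : N.Reachable (N.after C n a) :=
  h.run (.cons hn ha (.nil _))

theorem reachable_cInit : N.Reachable N.cInit := ⟨[], .nil _⟩

theorem Reachable.sound (hN : N.SoundDet) {C : Config Proc Node} (h : N.Reachable C) :
    ∃ w, N.Run C w N.cFin :=
  h.elim fun w hw => hN.sound w C hw

theorem Run.typed (hN : N.WellFormed) {C C' : Config Proc Node} {w : List (Node × R)}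
    (h : N.Run C w C') (hC : ∀ p, ∀ k ∈ C p, k ∈ N.nodes ∧ p ∈ N.dom k) :
    ∀ p, ∀ k ∈ C' p, k ∈ N.nodes ∧ p ∈ N.dom k := by
  induction h with
  | nil => exact hC
  | @cons C C' n a w h1 h2 h3 ih =>
    refine ih fun p k hk => ?_
    by_cases hp : p ∈ N.dom n
    · exact hN.δ_mem n h1.1 a h2 p hp k (by rwa [after_of_mem hp] at hk)
    · exact hC p k (by rwa [after_of_notMem hp] at hk)

theorem Reachable.typed (hN : N.SoundDet) {C : Config Proc Node} (h : N.Reachable C) {p : Proc}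
    {k : Node} (hk : k ∈ C p) : k ∈ N.nodes ∧ p ∈ N.dom k := by
  obtain ⟨w, hw⟩ := h
  refine hw.typed hN.wf ?_ p k hk
  rintro p k ⟨hp, rfl⟩
  exact ⟨hN.wf.init_mem, hN.wf.dom_init ▸ hp⟩

theorem Run.isEmpty {C C' : Config Proc Node} {w : List (Node × R)} (h : N.Run C w C') {p : Proc}
    (hp : C p = ∅) : C' p = ∅ := by
  induction h with
  | nil => exact hp
  | @cons C C' n a w h1 h2 h3 ih =>
    refine ih ?_
    rw [after_of_notMem fun h => by simpa [hp] using h1.2 p h, hp]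

theorem Reachable.exists_mem (hN : N.SoundDet) {C : Config Proc Node} (h : N.Reachable C)
    {p : Proc} (hp : p ∈ N.procs) : ∃ k, C p = {k} := by
  obtain ⟨w, hw⟩ := h.sound hN
  rcases (h.subsing hN p).eq_empty_or_singleton with he | he
  · have : N.fin ∈ N.cFin p := ⟨hp, rfl⟩
    rw [hw.isEmpty he] at this
    exact absurd this (Set.notMem_empty _)
  · exact he

theorem Reachable.eq_empty {C : Config Proc Node} (h : N.Reachable C)
    {p : Proc} (hp : p ∉ N.procs) : C p = ∅ := by
  obtain ⟨w, hw⟩ := h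
  exact hw.isEmpty (Set.eq_empty_of_forall_notMem fun k hk => hp hk.1)

theorem enabled_cFin (hN : N.WellFormed) {k : Node} (h : N.Enabled N.cFin k) : k = N.fin := by
  obtain ⟨p, hp⟩ := hN.dom_nonempty k h.1
  exact (h.2 p hp).2

theorem Reachable.eq_cFin (hN : N.SoundDet) {C : Config Proc Node} (h : N.Reachable C)
    (hf : N.Enabled C N.fin) : C = N.cFin := by
  funext p
  by_cases hp : p ∈ N.procs
  · rw [(h.subsing hN).eq_singleton (hf.2 p (hN.wf.dom_fin ▸ hp))]
    ext k; simp [cFin, hp]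
  · rw [h.eq_empty hp]
    ext k; simp [cFin, hp]

/-- An enabled node has an outcome, unless it is final. -/
theorem SoundDet.ne_fin_of_mem_out (hN : N.SoundDet) {n : Node} {a : R} (h : a ∈ N.out n) :
    n ≠ N.fin := by
  rintro rfl; simp [hN.wf.out_fin] at h

theorem Reachable.progress (hN : N.SoundDet) {C : Config Proc Node} (h : N.Reachable C)
    (hC : C ≠ N.cFin) : ∃ k, N.Enabled C k ∧ k ≠ N.fin := by
  obtain ⟨w, hw⟩ := h.sound hN
  cases hw with
  | nil => exact absurd rfl hC
  | cons h1 h2 _ => exact ⟨_, h1, hN.ne_fin_of_mem_out h2⟩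

/-- In a run to the final configuration every enabled node can be executed first. -/
theorem Run.pull_fin (hN : N.SoundDet) {C : Config Proc Node} (hC : N.Reachable C)
    {w : List (Node × R)} (h : N.Run C w N.cFin) {k : Node} (hk : N.Enabled C k) (hf : k ≠ N.fin) :
    ∃ a w', N.TraceEq w ((k, a) :: w') ∧ N.Run C ((k, a) :: w') N.cFin :=
  (h.pull hN.det (hC.subsing hN) hk).resolve_left fun h => hf (enabled_cFin hN.wf h.2)

/-- A node in which some process is ready to engage is eventually enabled. -/
theorem Reachable.exists_enabled (hN : N.SoundDet) {C : Config Proc Node} (hC : N.Reachable C)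
    {p : Proc} {k : Node} (hk : k ∈ C p) : ∃ w C', N.Run C w C' ∧ N.Enabled C' k := by
  obtain ⟨w, hw⟩ := hC.sound hN
  by_cases hf : k = N.fin
  · subst hf
    exact ⟨w, _, hw, hN.wf.fin_mem, fun p hp => ⟨hN.wf.dom_fin ▸ hp, rfl⟩⟩
  · obtain ⟨w₁, a, w₂, E, -, -, h1, h2, -⟩ := hw.exists_leave hN.det (hC.subsing hN) hk fun h => hf h.2
    exact ⟨w₁, E, h1, h2⟩

theorem Reachable.reachableNode (hN : N.SoundDet) {C : Config Proc Node} (hC : N.Reachable C)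
    {p : Proc} {k : Node} (hk : k ∈ C p) : N.ReachableNode k := by
  obtain ⟨w, C', h1, h2⟩ := hC.exists_enabled hN hk
  exact ⟨C', hC.run h1, h2⟩

theorem Enabled.eq_singleton (hN : N.SoundDet) {C : Config Proc Node} (hC : N.Reachable C)
    {k : Node} (hk : N.Enabled C k) {p : Proc} (hp : p ∈ N.dom k) : C p = {k} :=
  (hC.subsing hN).eq_singleton (hk.2 p hp)

theorem SoundDet.mem_procs (hN : N.SoundDet) {k : Node} (hk : k ∈ N.nodes) {p : Proc}
    (hp : p ∈ N.dom k) : p ∈ N.procs := hN.wf.dom_subset k hk hp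

/-- The targets of the locations of a reachable node are reachable. -/
theorem ReachableNode.target (hN : N.SoundDet) {n : Node} (hn : N.ReachableNode n) {a : R}
    (ha : a ∈ N.out n) {p : Proc} (hp : p ∈ N.dom n) :
    ∃ k, N.δ n a p = {k} ∧ N.ReachableNode k ∧ p ∈ N.dom k := by
  obtain ⟨C, hC, hn⟩ := hn
  have hA := hC.after hn ha
  obtain ⟨k, hk⟩ := hA.exists_mem hN (hN.mem_procs hn.1 hp)
  have hk' : k ∈ N.after C n a p := by rw [hk]; rfl
  refine ⟨k, by rw [← hk, after_of_mem hp], hA.reachableNode hN hk', (hA.typed hN hk').2⟩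

theorem ReachableNode.mem {n : Node} (hn : N.ReachableNode n) : n ∈ N.nodes :=
  hn.elim fun _ h => h.2.1

theorem SoundDet.reachableNode_init (hN : N.SoundDet) : N.ReachableNode N.init :=
  ⟨_, reachable_cInit, hN.wf.init_mem, fun _ hp => ⟨hN.wf.dom_init ▸ hp, rfl⟩⟩

end SoundDet

end Negotiation

namespace Negotiation

/-! ## Ranks -/

section Rank

variable {Proc Node R D : Type*} {N : Negotiation Proc Node R}

/-- Outcome `a` of `n` leads all processes to nodes of smaller rank. -/
def Lowers (N : Negotiation Proc Node R) (r : Node → ℕ) (n : Node) (a : R) : Prop :=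
  ∀ p ∈ N.dom n, ∀ k ∈ N.δ n a p, r k < r n

/-- Every reachable node other than the final one has an outcome that lowers the rank. -/
def IsRank (N : Negotiation Proc Node R) (r : Node → ℕ) : Prop :=
  ∀ n, N.ReachableNode n → n ≠ N.fin → ∃ a ∈ N.out n, N.Lowers r n a

/-- The nodes from which all processes can be forced into the final node in `i` rounds. -/
def attr (N : Negotiation Proc Node R) : ℕ → Node → Prop
  | 0, n => n = N.fin
  | i + 1, n => N.attr i n ∨ ∃ a ∈ N.out n, ∀ p ∈ N.dom n, ∀ k ∈ N.δ n a p, N.attr i k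

theorem attr_mono {i j : ℕ} (h : i ≤ j) {n : Node} (hn : N.attr i n) : N.attr j n := by
  induction h with
  | refl => exact hn
  | step _ ih => exact .inl ih

theorem SoundDet.exists_attr (hN : N.SoundDet) {n : Node} (hn : N.ReachableNode n) :
    ∃ i, N.attr i n := by
  by_contra hne
  have key : ∀ C w C', N.Run C w C' → N.Reachable C → (∃ p, ∃ k ∈ C p, ¬ ∃ i, N.attr i k) →
      ∃ p, ∃ k ∈ C' p, ¬ ∃ i, N.attr i k := by
    intro C w C' h
    induction h with
    | nil => exact fun _ h => h
    | @cons C C' m a w h1 h2 _ ih =>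
      rintro hC ⟨p, k, hk, hi⟩
      refine ih (hC.after h1 h2) ?_
      by_cases hp : p ∈ N.dom m
      · obtain rfl := hC.subsing hN p hk (h1.2 p hp)
        by_contra hcon
        push Not at hcon
        have hcon' : ∀ q, ∃ i, q ∈ N.dom k → ∀ j ∈ N.δ k a q, N.attr i j := by
          intro q
          by_cases hq : q ∈ N.dom k
          · obtain ⟨j, hj, -⟩ := ReachableNode.target hN ⟨C, hC, h1⟩ h2 hq
            obtain ⟨i, hi⟩ := hcon q j (by rw [after_of_mem hq, hj]; rfl)
            refine ⟨i, fun _ j' hj' => ?_⟩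
            rw [hj] at hj'
            obtain rfl : j' = j := hj'
            exact hi
          · exact ⟨0, fun h => absurd h hq⟩
        choose f hf using hcon'
        exact hi ⟨(N.dom k).sup f + 1, .inr ⟨a, h2, fun q hq j hj =>
          attr_mono (Finset.le_sup hq) (hf q hq j hj)⟩⟩
      · exact ⟨p, k, by rwa [after_of_notMem hp], hi⟩
  obtain ⟨C, hC, h⟩ := hn
  obtain ⟨w, hw⟩ := hC.sound hN
  obtain ⟨p, hp⟩ := hN.wf.dom_nonempty n h.1
  obtain ⟨q, k, hk, hi⟩ := key C w _ hw hC ⟨p, n, h.2 p hp, hne⟩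
  exact hi ⟨0, hk.2⟩

open Classical in
theorem SoundDet.exists_isRank (hN : N.SoundDet) : ∃ r, N.IsRank r := by
  refine ⟨fun n => if h : ∃ i, N.attr i n then Nat.find h else 0, fun n hn hf => ?_⟩
  have h := hN.exists_attr hn
  have hr := Nat.find_spec h
  cases he : Nat.find h with
  | zero => rw [he] at hr; exact absurd hr hf
  | succ i =>
    rw [he] at hr
    rcases hr with hr | ⟨a, ha, h'⟩
    · exact absurd (Nat.find_min' h hr) (by omega)
    · refine ⟨a, ha, fun p hp k hk => ?_⟩
      have hk' := h' p hp k hk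
      have hex : ∃ i, N.attr i k := ⟨i, hk'⟩
      simp only [dif_pos h, dif_pos hex, he]
      exact Nat.lt_succ_of_le (Nat.find_min' hex hk')

/-- The rank of the node in which a process is ready to engage. -/
noncomputable def rk (r : Node → ℕ) (s : Set Node) : ℕ := sInf (r '' s)

@[simp] theorem rk_singleton (r : Node → ℕ) (k : Node) : rk r {k} = r k := by
  simp [rk]

theorem rk_of_mem (hN : N.SoundDet) (r : Node → ℕ) {C : Config Proc Node} (hC : N.Reachable C)
    {p : Proc} {k : Node} (h : k ∈ C p) : rk r (C p) = r k := by
  rw [(hC.subsing hN).eq_singleton h, rk_singleton]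

theorem rk_after (hN : N.SoundDet) {r : Node → ℕ} {C : Config Proc Node} (hC : N.Reachable C)
    {n : Node} (hn : N.Enabled C n) {a : R} (ha : a ∈ N.out n) (hl : N.Lowers r n a) {p : Proc}
    (hp : p ∈ N.dom n) : rk r (N.after C n a p) < r n := by
  obtain ⟨k, hk, -⟩ := ReachableNode.target hN ⟨C, hC, hn⟩ ha hp
  rw [after_of_mem hp, hk, rk_singleton]
  exact hl p hp k (by rw [hk]; rfl)

/-- The total rank of a configuration. -/
noncomputable def weight (N : Negotiation Proc Node R) (r : Node → ℕ) (C : Config Proc Node) : ℕ :=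
  ∑ p ∈ N.procs, rk r (C p)

theorem weight_after_lt (hN : N.SoundDet) {r : Node → ℕ} {C : Config Proc Node}
    (hC : N.Reachable C) {n : Node} (hn : N.Enabled C n) {a : R} (ha : a ∈ N.out n)
    (hl : N.Lowers r n a) : N.weight r (N.after C n a) < N.weight r C := by
  have key : ∀ p ∈ N.dom n, rk r (N.after C n a p) < rk r (C p) := fun p hp => by
    rw [rk_of_mem hN r hC (hn.2 p hp)]
    exact rk_after hN hC hn ha hl hp
  obtain ⟨p, hp⟩ := hN.wf.dom_nonempty n hn.1
  refine Finset.sum_lt_sum (fun q _ => ?_) ⟨p, hN.mem_procs hn.1 hp, key p hp⟩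
  by_cases hq : q ∈ N.dom n
  · exact (key q hq).le
  · rw [after_of_notMem hq]

/-- In a run of rank-lowering locations, all executed nodes have at most the rank of the nodes in
which their processes are ready at first, and the rank of a process that moves decreases. -/
theorem Run.rank (hN : N.SoundDet) {r : Node → ℕ} {C C' : Config Proc Node} {w : List (Node × R)}
    (h : N.Run C w C') (hC : N.Reachable C) (hw : ∀ l ∈ w, N.Lowers r l.1 l.2) (p : Proc) :
    (rk r (C' p) ≤ rk r (C p)) ∧
      ∀ l ∈ w, p ∈ N.dom l.1 → r l.1 ≤ rk r (C p) ∧ rk r (C' p) < rk r (C p) := by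
  induction h with
  | nil => simp
  | @cons C C' n a w h1 h2 _ ih =>
    have ih := ih (hC.after h1 h2) fun l hl => hw l (List.mem_cons_of_mem _ hl)
    by_cases hp : p ∈ N.dom n
    · have h3 := rk_after hN hC h1 h2 (hw _ List.mem_cons_self) hp
      have h4 := rk_of_mem hN r hC (h1.2 p hp)
      refine ⟨by omega, fun l hl hpl => ?_⟩
      rcases List.mem_cons.1 hl with rfl | hl
      · exact ⟨h4.ge, by omega⟩
      · have := ih.2 l hl hpl
        omega
    · rw [after_of_notMem hp] at ih
      refine ⟨ih.1, fun l hl hpl => ?_⟩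
      rcases List.mem_cons.1 hl with rfl | hl
      · exact absurd hpl hp
      · exact ih.2 l hl hpl

/-- No node is executed twice in a run of rank-lowering locations. -/
theorem Run.nodup (hN : N.SoundDet) {r : Node → ℕ} {C C' : Config Proc Node} {w : List (Node × R)}
    (h : N.Run C w C') (hC : N.Reachable C) (hw : ∀ l ∈ w, N.Lowers r l.1 l.2) :
    (w.map Prod.fst).Nodup := by
  induction h with
  | nil => simp
  | @cons C C' n a w h1 h2 h3 ih =>
    have hw' : ∀ l ∈ w, N.Lowers r l.1 l.2 := fun l hl => hw l (List.mem_cons_of_mem _ hl)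
    refine List.nodup_cons.2 ⟨fun hmem => ?_, ih (hC.after h1 h2) hw'⟩
    obtain ⟨l, hl, he⟩ := List.mem_map.1 hmem
    obtain ⟨p, hp⟩ := hN.wf.dom_nonempty n h1.1
    have h4 := ((h3.rank hN (hC.after h1 h2) hw' p).2 l hl (he ▸ hp)).1
    have h5 := rk_after hN hC h1 h2 (hw _ List.mem_cons_self) hp
    simp only at he
    rw [he] at h4
    omega

/-- From every reachable configuration nodes with property `P` can be executed, lowering the rank,
until no node with property `P` is enabled. -/
theorem Reachable.descend (hN : N.SoundDet) {r : Node → ℕ} (hr : N.IsRank r) (P : Node → Prop)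
    {C : Config Proc Node} (hC : N.Reachable C) : ∃ w C', N.Run C w C' ∧
      (∀ l ∈ w, P l.1 ∧ N.Lowers r l.1 l.2) ∧ ∀ k, N.Enabled C' k → k ≠ N.fin → ¬ P k := by
  induction hm : N.weight r C using Nat.strong_induction_on generalizing C with
  | _ m ih =>
    by_cases h : ∃ k, N.Enabled C k ∧ k ≠ N.fin ∧ P k
    · obtain ⟨k, hk, hf, hP⟩ := h
      obtain ⟨a, ha, hl⟩ := hr k ⟨C, hC, hk⟩ hf
      obtain ⟨w, C', h1, h2, h3⟩ := ih _ (hm ▸ weight_after_lt hN hC hk ha hl) (hC.after hk ha) rfl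
      refine ⟨(k, a) :: w, C', .cons hk ha h1, fun l hmem => ?_, h3⟩
      rcases List.mem_cons.1 hmem with rfl | hmem
      exacts [⟨hP, hl⟩, h2 l hmem]
    · exact ⟨[], C, .nil _, by simp, fun k hk hf hP => h ⟨k, hk, hf, hP⟩⟩

/-- If some process is ready in `k`, and the rank of `k` is at least that of all enabled nodes,
then `k` is enabled. -/
theorem Reachable.enabled_of_rank_le (hN : N.SoundDet) {r : Node → ℕ} (hr : N.IsRank r)
    {B : Config Proc Node} (hB : N.Reachable B) {k : Node} (hf : k ≠ N.fin) {y : Proc}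
    (hy : k ∈ B y) (hmax : ∀ j, N.Enabled B j → j ≠ N.fin → r j ≤ r k) : N.Enabled B k := by
  suffices H : ∀ m C, N.weight r C = m → N.Reachable C → k ∈ C y →
      (∀ p, C p = B p ∨ rk r (C p) < r k) → N.Enabled B k from
    H _ B rfl hB hy fun _ => .inl rfl
  intro m
  induction m using Nat.strong_induction_on with
  | _ m ih =>
    intro C hm hC hyC hCB
    obtain ⟨j, hj, hjf⟩ := hC.progress hN (by rintro rfl; exact hf hyC.2)
    have hall : (∀ p ∈ N.dom j, C p = B p) → N.Enabled B j := fun h => (enabled_congr h).1 hj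
    by_cases hjk : j = k
    · subst hjk
      refine hall fun p hp => (hCB p).resolve_right ?_
      rw [rk_of_mem hN r hC (hj.2 p hp)]
      exact lt_irrefl _
    · have hle : r j ≤ r k := by
        by_cases h : ∀ p ∈ N.dom j, C p = B p
        · exact hmax j (hall h) hjf
        · push Not at h
          obtain ⟨p, hp, hne⟩ := h
          have := (hCB p).resolve_left hne
          rw [rk_of_mem hN r hC (hj.2 p hp)] at this
          exact this.le
      obtain ⟨a, ha, hl⟩ := hr j ⟨C, hC, hj⟩ hjf
      refine ih _ (hm ▸ weight_after_lt hN hC hj ha hl) _ rfl (hC.after hj ha) ?_ fun p => ?_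
      · rw [after_of_notMem fun h => hjk (hC.subsing hN y (hj.2 y h) hyC)]
        exact hyC
      · by_cases hp : p ∈ N.dom j
        · exact .inr ((rk_after hN hC hj ha hl hp).trans_le hle)
        · rw [after_of_notMem hp]; exact hCB p

/-- Two reachable configurations coincide if no node all of whose processes are in different
places is enabled in one of them. -/
theorem SoundDet.config_unique (hN : N.SoundDet) {A B : Config Proc Node} (hA : N.Reachable A)
    (hB : N.Reachable B) (h : ∀ k, k ≠ N.fin → (∀ p ∈ N.dom k, A p ≠ B p) →
      ¬ N.Enabled A k ∧ ¬ N.Enabled B k) : A = B := by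
  obtain ⟨r, hr⟩ := hN.exists_isRank
  induction hm : N.weight r A using Nat.strong_induction_on generalizing A B with
  | _ m ih =>
    by_cases hboth : ∃ k, k ≠ N.fin ∧ N.Enabled A k ∧ N.Enabled B k
    · obtain ⟨k, hf, hkA, hkB⟩ := hboth
      obtain ⟨a, ha, hl⟩ := hr k ⟨A, hA, hkA⟩ hf
      have hAB : ∀ p ∈ N.dom k, A p = B p := fun p hp => by
        rw [hkA.eq_singleton hN hA hp, hkB.eq_singleton hN hB hp]
      have he := ih _ (hm ▸ weight_after_lt hN hA hkA ha hl) (hA.after hkA ha) (hB.after hkB ha)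
        (fun j hj hd => by
          have hdis : Disjoint (N.dom j) (N.dom k) := Finset.disjoint_left.2 fun p h1 h2 =>
            hd p h1 (by rw [after_of_mem h2, after_of_mem h2])
          rw [enabled_after_iff hdis, enabled_after_iff hdis]
          refine h j hj fun p hp => ?_
          have := hd p hp
          rwa [after_of_notMem (Finset.disjoint_left.1 hdis hp),
            after_of_notMem (Finset.disjoint_left.1 hdis hp)] at this) rfl
      funext p
      by_cases hp : p ∈ N.dom k
      · exact hAB p hp
      · have := congrFun he p
        rwa [after_of_notMem hp, after_of_notMem hp] at this
    · by_contra hne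
      classical
      let S := N.nodes.filter fun k => k ≠ N.fin ∧ (N.Enabled A k ∨ N.Enabled B k)
      have hS : S.Nonempty := by
        by_cases hAf : A = N.cFin
        · obtain ⟨k, hk, hf⟩ := hB.progress hN fun hBf => hne (hAf.trans hBf.symm)
          exact ⟨k, by simp [S, hk.1, hf, hk]⟩
        · obtain ⟨k, hk, hf⟩ := hA.progress hN hAf
          exact ⟨k, by simp [S, hk.1, hf, hk]⟩
      obtain ⟨k, hk, hmax⟩ := S.exists_max_image r hS
      obtain ⟨-, hf, hk⟩ := Finset.mem_filter.1 hk
      have hy : ∃ y ∈ N.dom k, A y = B y := by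
        by_contra hcon
        push Not at hcon
        have := h k hf hcon
        tauto
      obtain ⟨y, hy, hAB⟩ := hy
      have hmem : k ∈ A y ∧ k ∈ B y := by
        rcases hk with hk | hk
        · exact ⟨hk.2 y hy, hAB ▸ hk.2 y hy⟩
        · exact ⟨hAB ▸ hk.2 y hy, hk.2 y hy⟩
      exact hboth ⟨k, hf,
        hA.enabled_of_rank_le hN hr hf hmem.1 fun j hj hjf =>
          hmax j (by simp [S, hj.1, hjf, hj]),
        hB.enabled_of_rank_le hN hr hf hmem.2 fun j hj hjf =>
          hmax j (by simp [S, hj.1, hjf, hj])⟩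

end Rank

/-! ## The configurations `I(n)`, `F(n)` and `F(ℓ)` -/

section FirstLast

variable {Proc Node R D : Type*} {N : Negotiation Proc Node R}

theorem IsFirst.enabled {n : Node} {C : Config Proc Node} (h : N.IsFirst n C) : N.Enabled C n :=
  (h.2 n).2 rfl

theorem IsFirst.unique (hN : N.SoundDet) {n : Node} {C C' : Config Proc Node}
    (h : N.IsFirst n C) (h' : N.IsFirst n C') : C = C' := by
  refine hN.config_unique h.1 h'.1 fun k _ hd => ?_
  have hk : k ≠ n := by
    rintro rfl
    obtain ⟨p, hp⟩ := hN.wf.dom_nonempty k h.enabled.1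
    exact hd p hp (by rw [h.enabled.eq_singleton hN h.1 hp, h'.enabled.eq_singleton hN h'.1 hp])
  rw [h.2, h'.2]
  exact ⟨hk, hk⟩

/-- From a reachable configuration in which some process is ready in `k`, the configuration `I(k)`
can be reached by lowering the rank. -/
theorem Reachable.exists_isFirst (hN : N.SoundDet) {r : Node → ℕ} (hr : N.IsRank r)
    {C : Config Proc Node} (hC : N.Reachable C) {k : Node} {p : Proc} (hk : k ∈ C p)
    (hf : k ≠ N.fin) : ∃ w C', N.Run C w C' ∧ N.IsFirst k C' ∧ ∀ l ∈ w, N.Lowers r l.1 l.2 := by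
  obtain ⟨w, C', h1, h2, h3⟩ := hC.descend hN hr (· ≠ k)
  have hC' := hC.run h1
  have hk' : k ∈ C' p := by
    by_contra hcon
    obtain ⟨w₁, a, w₂, -, rfl, -⟩ := h1.exists_leave hN.det (hC.subsing hN) hk hcon
    exact (h2 (k, a) (by simp)).1 rfl
  have hne : C' ≠ N.cFin := by rintro rfl; exact hf hk'.2
  have hall : ∀ j, N.Enabled C' j → j = k := fun j hj => by
    by_contra hjk
    by_cases hjf : j = N.fin
    · exact hne (hC'.eq_cFin hN (hjf ▸ hj))
    · exact h3 j hj hjf hjk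
  obtain ⟨j, hj, -⟩ := hC'.progress hN hne
  refine ⟨w, C', h1, ⟨hC', fun j' => ⟨hall j', ?_⟩⟩, fun l hl => (h2 l hl).2⟩
  rintro rfl
  exact hall j hj ▸ hj

theorem ReachableNode.exists_isFirst (hN : N.SoundDet) {n : Node} (hn : N.ReachableNode n)
    (hf : n ≠ N.fin) : ∃ C, N.IsFirst n C := by
  obtain ⟨C, hC, h⟩ := hn
  obtain ⟨r, hr⟩ := hN.exists_isRank
  obtain ⟨p, hp⟩ := hN.wf.dom_nonempty n h.1
  obtain ⟨_, C', _, h', _⟩ := hC.exists_isFirst hN hr (h.2 p hp) hf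
  exact ⟨C', h'⟩

/-- No node with domain included in `X` is enabled in `C`, except possibly the final node. -/
def Quiet (N : Negotiation Proc Node R) (X : Finset Proc) (C : Config Proc Node) : Prop :=
  ∀ k, N.Enabled C k → k ≠ N.fin → ¬ N.dom k ⊆ X

theorem Quiet.congr {X : Finset Proc} {C C' : Config Proc Node} (h : N.Quiet X C)
    (hX : ∀ p ∈ X, C' p = C p) : N.Quiet X C' :=
  fun k hk hf hd => h k ((enabled_congr fun p hp => hX p (hd hp)).1 hk) hf hd

theorem Quiet.unique (hN : N.SoundDet) {X : Finset Proc} {C C' : Config Proc Node}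
    (hC : N.Reachable C) (hC' : N.Reachable C') (h : N.Quiet X C) (h' : N.Quiet X C')
    (he : ∀ p ∉ X, C p = C' p) : C = C' :=
  hN.config_unique hC hC' fun k hf hd => by
    have hX : N.dom k ⊆ X := fun p hp => by
      by_contra hpX
      exact hd p hp (he p hpX)
    exact ⟨fun hk => h k hk hf hX, fun hk => h' k hk hf hX⟩

theorem Run.eq_of_notMem {X : Finset Proc} {C C' : Config Proc Node} {w : List (Node × R)}
    (h : N.Run C w C') (hw : ∀ l ∈ w, N.dom l.1 ⊆ X) {p : Proc} (hp : p ∉ X) : C' p = C p :=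
  h.outside fun l hl hpl => hp (hw l hl hpl)

theorem IsFirst.exists_isLastNode (hN : N.SoundDet) {n : Node} {C₀ : Config Proc Node}
    (h₀ : N.IsFirst n C₀) : ∃ C, N.IsLastNode n C₀ C := by
  obtain ⟨r, hr⟩ := hN.exists_isRank
  obtain ⟨w, C, h1, h2, h3⟩ := h₀.1.descend hN hr fun k => N.dom k ⊆ N.dom n
  exact ⟨C, ⟨w, fun l hl => (h2 l hl).1, h1⟩, h3⟩

theorem IsFirst.exists_isLastLoc (hN : N.SoundDet) {n : Node} {a : R} {C₀ : Config Proc Node}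
    (h₀ : N.IsFirst n C₀) (ha : a ∈ N.out n) : ∃ C, N.IsLastLoc n a C₀ C := by
  obtain ⟨r, hr⟩ := hN.exists_isRank
  obtain ⟨w, C, h1, h2, h3⟩ := (h₀.1.after h₀.enabled ha).descend hN hr
    fun k => N.dom k ⊂ N.dom n
  refine ⟨C, ⟨w, fun l hl => (h2 l hl).1, .cons h₀.enabled ha h1⟩, fun k hk hd => ?_⟩
  refine h3 k hk ?_ hd
  rintro rfl
  exact (hN.wf.dom_fin ▸ hd).not_subset (hN.wf.dom_subset n h₀.enabled.1)

/-- A process that is ready in `k` in a configuration that agrees with `I(k)` outside of the domain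
of `k` can engage in a node with domain included in that of `k`. -/
theorem IsFirst.notMem_of_quiet (hN : N.SoundDet) {k : Node} (hf : k ≠ N.fin)
    {E C : Config Proc Node} (hE : N.IsFirst k E) (hC : N.Reachable C)
    (he : ∀ p ∉ N.dom k, C p = E p) (hq : N.Quiet (N.dom k) C) (p : Proc) : k ∉ C p := by
  intro hk
  obtain ⟨r, hr⟩ := hN.exists_isRank
  obtain ⟨w, C', hw, hC', hl⟩ := hC.exists_isFirst hN hr hk hf
  obtain rfl := hC'.unique hN hE
  have hsub : ∀ l ∈ w, N.dom l.1 ⊆ N.dom k := fun l hlw q hq => by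
    by_contra hqk
    have := ((hw.rank hN hC hl q).2 l hlw hq).2
    rw [he q hqk] at this
    exact lt_irrefl _ this
  cases hw with
  | nil => exact hq k hE.enabled hf subset_rfl
  | cons h1 h2 _ => exact hq _ h1 (hN.ne_fin_of_mem_out h2) (hsub _ List.mem_cons_self)

/-- After its single outcome, no node with domain included in that of `n` is enabled. -/
def LocallyReduced (N : Negotiation Proc Node R) (n : Node) : Prop :=
  ∃ a, N.out n = {a} ∧ ∀ k ∈ N.nodes, k ≠ N.fin → N.dom k ⊆ N.dom n →
    ¬ ∀ p ∈ N.dom k, k ∈ N.δ n a p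

theorem reducedNode_iff (hN : N.SoundDet) {n : Node} (hn : N.ReachableNode n) (hf : n ≠ N.fin) :
    N.ReducedNode n ↔ N.LocallyReduced n := by
  constructor
  · rintro ⟨a, ha, C₀, C, h₀, hC, hδ⟩
    refine ⟨a, ha, fun k hk hkf hd hall => hC.2 k ⟨hk, fun p hp => ?_⟩ hkf hd⟩
    rw [← hδ p (hd hp)]
    exact hall p hp
  · rintro ⟨a, ha, hl⟩
    obtain ⟨C₀, h₀⟩ := hn.exists_isFirst hN hf
    refine ⟨a, ha, C₀, N.after C₀ n a, h₀, ⟨⟨[(n, a)], ?_, ?_⟩, ?_⟩, fun p hp => (after_of_mem hp).symm⟩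
    · simp [IsSeq]
    · exact .cons h₀.enabled (by simp [ha]) (.nil _)
    · intro k hk hkf hd
      refine hl k hk.1 hkf hd fun p hp => ?_
      rw [← after_of_mem (hd hp)]
      exact hk.2 p hp

end FirstLast

end Negotiation

namespace Negotiation

/-! ## Distributive functions, and the independence of the abstract semantics of the scheduler -/

section Lattice

variable {Proc Node R D : Type*} [CompleteLattice D]

/-- Monotone functions that commute with joins of non-empty sets. -/
def Distributive (f : D → D) : Prop :=
  Monotone f ∧ ∀ S : Set D, S.Nonempty → f (sSup S) = sSup (f '' S)

theorem distributive_id : Distributive (id : D → D) := ⟨monotone_id, fun S _ => by simp⟩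

theorem Distributive.comp {f g : D → D} (hf : Distributive f) (hg : Distributive g) :
    Distributive (f ∘ g) :=
  ⟨hf.1.comp hg.1, fun S hS => by
    rw [Function.comp_apply, hg.2 S hS, hf.2 _ (hS.image g), Set.image_image]; rfl⟩

theorem sSup_fun_apply (F : Set (D → D)) (x : D) : sSup F x = sSup ((fun f => f x) '' F) := by
  rw [sSup_apply, sSup_image, iSup_subtype]

theorem distributive_sSup {F : Set (D → D)} (h : ∀ f ∈ F, Distributive f) :
    Distributive (sSup F) := by
  constructor
  · intro x y hxy
    rw [sSup_fun_apply, sSup_fun_apply]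
    refine sSup_le ?_
    rintro _ ⟨f, hf, rfl⟩
    exact ((h f hf).1 hxy).trans (le_sSup ⟨f, hf, rfl⟩)
  · intro S hS
    refine le_antisymm ?_ (sSup_le ?_)
    · rw [sSup_fun_apply]
      refine sSup_le ?_
      rintro _ ⟨f, hf, rfl⟩
      simp only
      rw [(h f hf).2 S hS]
      refine sSup_le ?_
      rintro _ ⟨x, hx, rfl⟩
      refine le_trans ?_ (le_sSup ⟨x, hx, rfl⟩)
      exact le_sSup hf x
    · rintro _ ⟨x, hx, rfl⟩
      rw [sSup_fun_apply]
      refine sSup_le ?_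
      rintro _ ⟨f, hf, rfl⟩
      exact ((h f hf).1 (le_sSup hx)).trans (le_sSup hf _)

theorem comp_sSup_comm {F : Set (D → D)} (hF : F.Nonempty) {g : D → D} (hg : Distributive g)
    (h : ∀ f ∈ F, g ∘ f = f ∘ g) : g ∘ sSup F = sSup F ∘ g := by
  funext x
  rw [Function.comp_apply, sSup_fun_apply, hg.2 _ (hF.image _), Function.comp_apply,
    sSup_fun_apply, Set.image_image]
  congr 1
  exact Set.image_congr fun f hf => congrFun (h f hf) x

variable {N : Negotiation Proc Node R} {sem : Node × R → D → D}

theorem distributive_semRun (hF : N.IsFramework sem) {w : List (Node × R)}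
    (hw : ∀ l ∈ w, N.IsLoc l) : Distributive (semRun sem w) := by
  induction w with
  | nil => exact distributive_id
  | cons l w ih =>
    exact (ih fun l hl => hw l (List.mem_cons_of_mem _ hl)).comp (hF l (hw l List.mem_cons_self))

omit [CompleteLattice D] in
theorem semRun_comm (hM : N.MazurkiewiczInvariant sem) {u v : List (Node × R)}
    (hu : ∀ l ∈ u, N.IsLoc l) (hv : ∀ l ∈ v, N.IsLoc l)
    (hd : ∀ l ∈ u, ∀ l' ∈ v, Disjoint (N.dom l.1) (N.dom l'.1)) :
    semRun sem u ∘ semRun sem v = semRun sem v ∘ semRun sem u := by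
  have one : ∀ l, N.IsLoc l → ∀ v : List (Node × R), (∀ l' ∈ v, N.IsLoc l') →
      (∀ l' ∈ v, Disjoint (N.dom l.1) (N.dom l'.1)) → sem l ∘ semRun sem v = semRun sem v ∘ sem l := by
    intro l hl v hv hd
    induction v with
    | nil => rfl
    | cons l' v ih =>
      have := ih (fun x hx => hv x (List.mem_cons_of_mem _ hx))
        fun x hx => hd x (List.mem_cons_of_mem _ hx)
      rw [semRun, ← Function.comp_assoc, this, Function.comp_assoc, Function.comp_assoc,
        hM l l' hl (hv l' List.mem_cons_self) (hd l' List.mem_cons_self)]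
  induction u with
  | nil => rfl
  | cons l u ih =>
    have := ih (fun x hx => hu x (List.mem_cons_of_mem _ hx))
      fun x hx => hd x (List.mem_cons_of_mem _ hx)
    rw [semRun, Function.comp_assoc, one l (hu l List.mem_cons_self) v hv (hd l List.mem_cons_self),
      ← Function.comp_assoc, this, Function.comp_assoc]

/-- Every run to the final configuration can be reordered according to a scheduler. -/
theorem Run.exists_compatible (hN : N.SoundDet) {S : List (Node × R) → Option Node}
    (hS : N.IsScheduler S) {v : List (Node × R)} {C : Config Proc Node} (hv : N.Run N.cInit v C)
    {w : List (Node × R)} (hw : N.Run C w N.cFin) :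
    ∃ w', N.TraceEq w w' ∧ ∀ (i : ℕ) (hi : i < w'.length), S (v ++ w'.take i) = some w'[i].1 := by
  induction hm : w.length generalizing v C w with
  | zero => exact ⟨w, .refl _, fun i hi => by omega⟩
  | succ m ih =>
    have hC : N.Reachable C := ⟨v, hv⟩
    have hex : ∃ n, N.Enabled C n := by
      cases hw with
      | nil => simp at hm
      | cons h1 _ _ => exact ⟨_, h1⟩
    obtain ⟨k, hk⟩ := (hS v C hv).2 hex
    have hkC := (hS v C hv).1 k hk
    have hkf : k ≠ N.fin := by
      rintro rfl
      have := hC.eq_cFin hN hkC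
      cases hw with
      | nil => simp at hm
      | cons h1 h2 _ => rw [this] at h1; exact hN.ne_fin_of_mem_out h2 (enabled_cFin hN.wf h1)
    obtain ⟨a, w₁, ht, hr⟩ := hw.pull_fin hN hC hkC hkf
    obtain ⟨h1, h2, h3⟩ := run_cons_iff.1 hr
    have hlen : w₁.length = m := by
      have := ht.perm.length_eq
      simp only [List.length_cons] at this
      omega
    obtain ⟨w', ht', hc⟩ := ih (v := v ++ [(k, a)]) (hv.append (.cons h1 h2 (.nil _))) h3 hlen
    refine ⟨(k, a) :: w', ht.trans (ht'.cons _), fun i hi => ?_⟩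
    cases i with
    | zero => simpa using hk
    | succ i =>
      have := hc i (by simpa using hi)
      simpa using this

theorem semScheduler_eq_mop (hN : N.SoundDet) (hM : N.MazurkiewiczInvariant sem)
    {S : List (Node × R) → Option Node} (hS : N.IsScheduler S) :
    N.semScheduler sem S = N.mop sem := by
  refine le_antisymm (sSup_le_sSup ?_) (sSup_le ?_)
  · rintro f ⟨w, hw, -, rfl⟩
    exact ⟨w, hw, rfl⟩
  · rintro _ ⟨w, hw, rfl⟩
    obtain ⟨w', ht, hc⟩ := Run.exists_compatible hN hS (.nil _) hw
    rw [ht.semRun hM (Run.isLoc hw)]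
    exact le_sSup ⟨w', ht.run hw, fun i hi _ => by simpa using hc i hi, rfl⟩

theorem exists_isScheduler (N : Negotiation Proc Node R) : ∃ S, N.IsScheduler S := by
  classical
  refine ⟨fun w => if h : ∃ C n, N.Run N.cInit w C ∧ N.Enabled C n then some h.choose_spec.choose
    else none, fun w C hw => ⟨fun n hn => ?_, fun ⟨n, hn⟩ => ?_⟩⟩
  · dsimp only at hn
    split at hn
    · next h =>
      have h' := h.choose_spec.choose_spec
      rw [hw.eq h'.1]
      simp only [Option.some.injEq] at hn
      rw [← hn]
      exact h'.2
    · simp at hn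
  · have h : ∃ C n, N.Run N.cInit w C ∧ N.Enabled C n := ⟨C, n, hw, hn⟩
    exact ⟨_, dif_pos h⟩

theorem semInf_eq_mop (hN : N.SoundDet) (hM : N.MazurkiewiczInvariant sem) :
    N.semInf sem = N.mop sem := by
  obtain ⟨S, hS⟩ := exists_isScheduler N
  refine le_antisymm (sInf_le ⟨S, hS, (semScheduler_eq_mop hN hM hS).symm⟩) (le_sInf ?_)
  rintro _ ⟨S, hS, rfl⟩
  exact (semScheduler_eq_mop hN hM hS).ge

theorem semSup_eq_mop (hN : N.SoundDet) (hM : N.MazurkiewiczInvariant sem) :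
    N.semSup sem = N.mop sem := by
  obtain ⟨S, hS⟩ := exists_isScheduler N
  refine le_antisymm (sSup_le ?_) (le_sSup ⟨S, hS, (semScheduler_eq_mop hN hM hS).symm⟩)
  rintro _ ⟨S, hS, rfl⟩
  exact (semScheduler_eq_mop hN hM hS).le

end Lattice

/-! ## Summaries -/

section Summary

variable {Proc Node R D : Type*} [CompleteLattice D]

/-- The diagram `N'` arises from `N` by summarizing sets of runs into single locations: the
location `l` of `N'` stands for the runs `V l` of `N`. -/
structure Summary (N : Negotiation Proc Node R) (sem : Node × R → D → D)
    (N' : Negotiation Proc Node R) (sem' : Node × R → D → D)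
    (V : Node × R → Set (List (Node × R))) : Prop where
  procs_eq : N'.procs = N.procs
  nodes_eq : N'.nodes = N.nodes
  dom_eq : N'.dom = N.dom
  init_eq : N'.init = N.init
  fin_eq : N'.fin = N.fin
  nonempty : ∀ l, N'.IsLoc l → (V l).Nonempty
  run : ∀ l, N'.IsLoc l → ∀ v ∈ V l, ∀ C, N.Enabled C l.1 → N.Run C v (N'.after C l.1 l.2)
  ne_nil : ∀ l, N'.IsLoc l → ∀ v ∈ V l, v ≠ []
  dom_subset : ∀ l, N'.IsLoc l → ∀ v ∈ V l, ∀ x ∈ v, N.dom x.1 ⊆ N.dom l.1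
  sem_eq : ∀ l, N'.IsLoc l → sem' l = sSup (semRun sem '' V l)
  complete : ∀ C, N.Reachable C → ∀ w, N.Run C w N.cFin → w ≠ [] → ∃ l v w', N'.IsLoc l ∧
    N.Enabled C l.1 ∧ v ∈ V l ∧ N.TraceEq w (v ++ w')

variable {N N' : Negotiation Proc Node R} {sem sem' : Node × R → D → D}
  {V : Node × R → Set (List (Node × R))}

namespace Summary

variable (h : N.Summary sem N' sem' V)
include h

theorem cInit_eq : N'.cInit = N.cInit := by
  unfold cInit; rw [h.procs_eq, h.init_eq]

theorem cFin_eq : N'.cFin = N.cFin := by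
  unfold cFin; rw [h.procs_eq, h.fin_eq]

theorem enabled_iff {C : Config Proc Node} {n : Node} : N'.Enabled C n ↔ N.Enabled C n := by
  unfold Enabled; rw [h.nodes_eq, h.dom_eq]

theorem isLoc_of_mem {l : Node × R} (hl : N'.IsLoc l) {v : List (Node × R)} (hv : v ∈ V l) :
    ∀ x ∈ v, N.IsLoc x :=
  (h.run l hl v hv (fun _ => {l.1}) ⟨h.nodes_eq ▸ hl.1, fun _ _ => rfl⟩).isLoc

theorem expand {C C' : Config Proc Node} {w : List (Node × R)} (hw : N'.Run C w C') :
    ∃ w', N.Run C w' C' := by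
  induction hw with
  | nil => exact ⟨[], .nil _⟩
  | @cons C C' n a w h1 h2 _ ih =>
    obtain ⟨w', hw'⟩ := ih
    obtain ⟨v, hv⟩ := h.nonempty (n, a) ⟨h1.1, h2⟩
    exact ⟨v ++ w', (h.run (n, a) ⟨h1.1, h2⟩ v hv C (h.enabled_iff.1 h1)).append hw'⟩

theorem reachable {C : Config Proc Node} (hC : N'.Reachable C) : N.Reachable C := by
  obtain ⟨w, hw⟩ := hC
  rw [h.cInit_eq] at hw
  exact h.expand hw

theorem reachableNode {n : Node} (hn : N'.ReachableNode n) : N.ReachableNode n :=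
  hn.elim fun C hC => ⟨C, h.reachable hC.1, h.enabled_iff.1 hC.2⟩

theorem run_typed {l : Node × R} (hl : N'.IsLoc l) (hN : N.SoundDet) :
    (∀ p, ∀ k ∈ N'.after (fun p => {k | k = l.1 ∧ p ∈ N.dom k}) l.1 l.2 p,
      k ∈ N.nodes ∧ p ∈ N.dom k) ∧
      Subsing (N'.after (fun p => {k | k = l.1 ∧ p ∈ N.dom k}) l.1 l.2) := by
  have hn : l.1 ∈ N.nodes := h.nodes_eq ▸ hl.1
  obtain ⟨v, hv⟩ := h.nonempty l hl
  have hr := h.run l hl v hv (fun p => {k | k = l.1 ∧ p ∈ N.dom k}) ⟨hn, fun p hp => ⟨rfl, hp⟩⟩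
  refine ⟨hr.typed hN.wf ?_, Subsing.run hN.det hr ?_⟩
  · rintro p k ⟨rfl, hp⟩
    exact ⟨hn, hp⟩
  · rintro p x ⟨rfl, -⟩ y ⟨rfl, -⟩
    rfl

/-- Runs of `N` to the final configuration are matched by runs of `N'`. -/
theorem compress (hF : N.IsFramework sem) (hM : N.MazurkiewiczInvariant sem)
    {C : Config Proc Node} (hC : N.Reachable C) {w : List (Node × R)} (hw : N.Run C w N.cFin) :
    ∃ w', N'.Run C w' N'.cFin ∧ semRun sem w ≤ semRun sem' w' ∧
      ∀ k, (∀ l, N'.IsLoc l → ∀ v ∈ V l, ∀ x ∈ v, x.1 = k → l.1 = k) →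
        (∃ x ∈ w, x.1 = k) → ∃ x ∈ w', x.1 = k := by
  induction hm : w.length using Nat.strong_induction_on generalizing C w with
  | _ m ih =>
    by_cases hw0 : w = []
    · subst hw0
      rw [run_nil_iff.1 hw, h.cFin_eq]
      exact ⟨[], .nil _, le_rfl, by simp⟩
    obtain ⟨l, v, w₁, hl, hCl, hv, ht⟩ := h.complete C hC w hw hw0
    obtain ⟨E, hE, hr⟩ := run_append_iff.1 (ht.run hw)
    have hv' := h.run l hl v hv C hCl
    obtain rfl := hE.eq hv'
    have hlen := ht.perm.length_eq
    have hv0 := List.length_pos_iff.2 (h.ne_nil l hl v hv)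
    rw [List.length_append] at hlen
    obtain ⟨w', h1, h2, h3⟩ := ih w₁.length (by omega) (hC.run hv') hr rfl
    refine ⟨l :: w', .cons (h.enabled_iff.2 hCl) hl.2 h1, ?_, fun k hk => ?_⟩
    · rw [ht.semRun hM hw.isLoc, semRun_append, semRun]
      intro x
      refine le_trans ?_ (h2 _)
      refine (distributive_semRun hF hr.isLoc).1 ?_
      rw [h.sem_eq l hl]
      exact (le_sSup (Set.mem_image_of_mem _ hv) : semRun sem v ≤ sSup (semRun sem '' V l)) x
    · rintro ⟨x, hx, rfl⟩
      rcases List.mem_append.1 (ht.perm.mem_iff.1 hx) with hx | hx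
      · exact ⟨l, List.mem_cons_self, hk l hl v hv x hx rfl⟩
      · obtain ⟨y, hy, he⟩ := h3 _ hk ⟨x, hx, rfl⟩
        exact ⟨y, List.mem_cons_of_mem _ hy, he⟩

theorem isFramework (hF : N.IsFramework sem) : N'.IsFramework sem' := fun l hl => by
  rw [h.sem_eq l hl]
  refine distributive_sSup ?_
  rintro _ ⟨v, hv, rfl⟩
  exact distributive_semRun hF (h.isLoc_of_mem hl hv)

theorem mazurkiewiczInvariant (hF : N.IsFramework sem) (hM : N.MazurkiewiczInvariant sem) :
    N'.MazurkiewiczInvariant sem' := by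
  intro l₁ l₂ h₁ h₂ hd
  rw [h.dom_eq] at hd
  have hF' := h.isFramework hF
  rw [h.sem_eq l₂ h₂]
  refine comp_sSup_comm ((h.nonempty l₂ h₂).image _) (hF' l₁ h₁) ?_
  rintro _ ⟨v₂, hv₂, rfl⟩
  rw [h.sem_eq l₁ h₁]
  refine (comp_sSup_comm ((h.nonempty l₁ h₁).image _)
    (distributive_semRun hF (h.isLoc_of_mem h₂ hv₂)) ?_).symm
  rintro _ ⟨v₁, hv₁, rfl⟩
  refine semRun_comm hM (h.isLoc_of_mem h₂ hv₂) (h.isLoc_of_mem h₁ hv₁) fun x hx y hy => ?_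
  exact (hd.symm.mono_left (h.dom_subset l₂ h₂ v₂ hv₂ x hx)).mono_right
    (h.dom_subset l₁ h₁ v₁ hv₁ y hy)

theorem soundDet (hN : N.SoundDet) (hF : N.IsFramework sem) (hM : N.MazurkiewiczInvariant sem)
    (hout : ∀ n ∈ N.nodes, n ≠ N.fin → (N'.out n).Nonempty) (hfin : N'.out N.fin = ∅) :
    N'.SoundDet where
  wf :=
    { dom_subset := by rw [h.nodes_eq, h.dom_eq, h.procs_eq]; exact hN.wf.dom_subset
      dom_nonempty := by rw [h.nodes_eq, h.dom_eq]; exact hN.wf.dom_nonempty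
      δ_mem := fun n hn a ha p hp k hk => by
        have := (h.run_typed (l := (n, a)) ⟨hn, ha⟩ hN).1 p k (by rwa [after_of_mem hp])
        rwa [h.nodes_eq, h.dom_eq]
      init_mem := by rw [h.nodes_eq, h.init_eq]; exact hN.wf.init_mem
      fin_mem := by rw [h.nodes_eq, h.fin_eq]; exact hN.wf.fin_mem
      init_ne_fin := by rw [h.init_eq, h.fin_eq]; exact hN.wf.init_ne_fin
      dom_init := by rw [h.init_eq, h.dom_eq, h.procs_eq]; exact hN.wf.dom_init
      dom_fin := by rw [h.fin_eq, h.dom_eq, h.procs_eq]; exact hN.wf.dom_fin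
      out_nonempty := by rw [h.nodes_eq, h.fin_eq]; exact hout
      out_fin := by rw [h.fin_eq]; exact hfin }
  det := fun n hn a ha p hp => by
    have := (h.run_typed (l := (n, a)) ⟨hn, ha⟩ hN).2 p
    rwa [after_of_mem hp] at this
  sound := fun w C hw => by
    have hC := h.reachable ⟨w, hw⟩
    obtain ⟨w₁, hw₁⟩ := hC.sound hN
    obtain ⟨w', hw', -⟩ := h.compress hF hM hC hw₁
    exact ⟨w', hw'⟩

/-- Nodes that are not executed inside of summarized runs stay reachable. -/
theorem reachableNode_of (hN : N.SoundDet) (hF : N.IsFramework sem)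
    (hM : N.MazurkiewiczInvariant sem) {k : Node} (hk : N.ReachableNode k) (hf : k ≠ N.fin)
    (hkV : ∀ l, N'.IsLoc l → ∀ v ∈ V l, ∀ x ∈ v, x.1 = k → l.1 = k) : N'.ReachableNode k := by
  obtain ⟨C, ⟨u, hu⟩, hk⟩ := hk
  have hC : N.Reachable C := ⟨u, hu⟩
  obtain ⟨w, hw⟩ := hC.sound hN
  obtain ⟨a, w₁, ht, -⟩ := hw.pull_fin hN hC hk hf
  obtain ⟨w', hw', -, h3⟩ := h.compress hF hM reachable_cInit (hu.append hw)
  obtain ⟨x, hx, rfl⟩ := h3 k hkV ⟨(k, a), List.mem_append_right _ (ht.perm.mem_iff.2 (by simp)), rfl⟩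
  obtain ⟨w₂, w₃, rfl⟩ := List.append_of_mem hx
  obtain ⟨E, hE, hr⟩ := run_append_iff.1 hw'
  exact ⟨E, ⟨w₂, h.cInit_eq ▸ hE⟩, (run_cons_iff.1 hr).1⟩

theorem mop_eq (hF : N.IsFramework sem) (hM : N.MazurkiewiczInvariant sem) :
    N'.mop sem' = N.mop sem := by
  have key : ∀ C w C', N'.Run C w C' → ∀ x : D,
      semRun sem' w x ≤ sSup {y | ∃ v, N.Run C v C' ∧ y = semRun sem v x} := by
    intro C w C' hw
    induction hw with
    | nil C => exact fun x => le_sSup ⟨[], .nil _, rfl⟩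
    | @cons C C' n a w h1 h2 h3 ih =>
      intro x
      have hl : N'.IsLoc (n, a) := ⟨h1.1, h2⟩
      rw [semRun, Function.comp_apply, h.sem_eq _ hl, sSup_fun_apply,
        (distributive_semRun (h.isFramework hF) h3.isLoc).2 _
          (((h.nonempty _ hl).image _).image _)]
      refine sSup_le ?_
      rintro _ ⟨_, ⟨_, ⟨v, hv, rfl⟩, rfl⟩, rfl⟩
      refine (ih _).trans (sSup_le ?_)
      rintro _ ⟨u, hu, rfl⟩
      refine le_sSup ⟨v ++ u, (h.run _ hl v hv C (h.enabled_iff.1 h1)).append hu, ?_⟩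
      rw [semRun_append]; rfl
  refine le_antisymm (sSup_le ?_) (sSup_le ?_)
  · rintro _ ⟨w, hw, rfl⟩ x
    refine (key _ _ _ hw x).trans ?_
    rw [mop, sSup_fun_apply]
    refine sSup_le_sSup ?_
    rintro _ ⟨v, hv, rfl⟩
    rw [h.cInit_eq, h.cFin_eq] at hv
    exact ⟨_, ⟨v, hv, rfl⟩, rfl⟩
  · rintro _ ⟨w, hw, rfl⟩
    obtain ⟨w', hw', hle, -⟩ := h.compress hF hM reachable_cInit hw
    refine hle.trans (le_sSup ⟨w', ?_, rfl⟩)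
    rw [Successful, h.cInit_eq]
    exact hw'

end Summary

end Summary

end Negotiation

namespace Negotiation

section Transfer

variable {Proc Node R : Type*} {N : Negotiation Proc Node R}

/-- The runs from `I(n)` within the domain of `n` are possible whenever `n` is enabled. -/
theorem IsFirst.transfer {n : Node} {C₀ C E : Config Proc Node} (h₀ : N.IsFirst n C₀)
    {v : List (Node × R)} (hv : N.Run C₀ v C) (hd : ∀ l ∈ v, N.dom l.1 ⊆ N.dom n) (hne : v ≠ [])
    (hE : N.Enabled E n) :
    ∃ E', N.Run E v E' ∧ (∀ p ∈ N.dom n, E' p = C p) ∧ ∀ p ∉ N.dom n, E' p = E p := by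
  cases hv with
  | nil => exact absurd rfl hne
  | @cons _ _ m a v h1 h2 h3 =>
    obtain rfl := (h₀.2 m).1 h1
    obtain ⟨E', h4, h5, h6⟩ := h3.congr (fun l hl => hd l (List.mem_cons_of_mem _ hl))
      (E := N.after E m a) fun p hp => by rw [after_of_mem hp, after_of_mem hp]
    exact ⟨E', .cons hE h2 h4, h5, fun p hp => by rw [h6 p hp, after_of_notMem hp]⟩

end Transfer

/-! ## Subdiagrams spanned by sets of runs -/

section Span

variable {Proc Node R D : Type*}

open Classical in
/-- The subdiagram spanned by the set `V` of runs, where `C` is the last configuration. -/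
noncomputable def span (N : Negotiation Proc Node R) (n : Node) (C : Config Proc Node)
    (V : Set (List (Node × R))) : Negotiation Proc (Option Node) R where
  procs := N.dom n
  nodes := Finset.insertNone (N.nodes.filter fun m => ∃ v ∈ V, ∃ b, (m, b) ∈ v)
  dom := fun m => m.elim (N.dom n) N.dom
  out := fun m => m.elim ∅ fun m => (N.out m).filter fun b => ∃ v ∈ V, (m, b) ∈ v
  δ := N.subδ C
  init := some n
  fin := none

/-- `V` is a set of runs from `C₀` to `C` whose locations have domains included in that of `n`, and
a process that reaches its last node stays there. -/
structure Spans (N : Negotiation Proc Node R) (n : Node) (C₀ C : Config Proc Node)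
    (V : Set (List (Node × R))) : Prop where
  first : N.IsFirst n C₀
  run : ∀ v ∈ V, N.Run C₀ v C
  dom_subset : ∀ v ∈ V, ∀ l ∈ v, N.dom l.1 ⊆ N.dom n
  exists_mem : ∃ v, v ∈ V
  mem_init : ∀ v ∈ V, ∃ b, (n, b) ∈ v
  stay : ∀ v₁ m b v₂, v₁ ++ (m, b) :: v₂ ∈ V → ∀ p ∈ N.dom m, N.δ m b p = C p →
    ∀ l ∈ v₂, p ∉ N.dom l.1

variable {N : Negotiation Proc Node R} {n : Node} {C₀ C : Config Proc Node}
  {V : Set (List (Node × R))}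

theorem mem_span_nodes {m : Node} :
    some m ∈ (N.span n C V).nodes ↔ m ∈ N.nodes ∧ ∃ v ∈ V, ∃ b, (m, b) ∈ v := by
  simp [span]

theorem none_mem_span_nodes : none ∈ (N.span n C V).nodes := by
  simp [span]

theorem mem_span_out {m : Node} {b : R} :
    b ∈ (N.span n C V).out (some m) ↔ b ∈ N.out m ∧ ∃ v ∈ V, (m, b) ∈ v := by
  simp [span]

theorem span_out_none : (N.span n C V).out none = ∅ := rfl

theorem span_δ_of_eq {m : Node} {b : R} {p : Proc} (h : N.δ m b p = C p) :
    (N.span n C V).δ (some m) b p = {none} := by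
  simp [span, subδ, h]

theorem span_δ_of_ne {m : Node} {b : R} {p : Proc} (h : N.δ m b p ≠ C p) :
    (N.span n C V).δ (some m) b p = some '' N.δ m b p := by
  simp [span, subδ, h]

namespace Spans

theorem leave (hN : N.SoundDet) (h : N.Spans n C₀ C V) {v₁ v₂ : List (Node × R)} {m : Node} {b : R}
    (hv : v₁ ++ (m, b) :: v₂ ∈ V) {p : Proc} (hp : p ∈ N.dom m) (hne : N.δ m b p ≠ C p) {k : Node}
    (hk : k ∈ N.δ m b p) : ∃ c, (k, c) ∈ v₂ := by
  obtain ⟨E, hE, hr⟩ := run_append_iff.1 (h.run _ hv)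
  obtain ⟨h1, h2, h3⟩ := run_cons_iff.1 hr
  have hE' := h.first.1.run hE
  have hs := (hE'.after h1 h2).subsing hN
  have hk' : k ∈ N.after E m b p := by rwa [after_of_mem hp]
  obtain ⟨w₁, c, w₂, -, rfl, -⟩ := h3.exists_leave hN.det hs hk' fun hkC => hne <| by
    rw [← after_of_mem (N := N) (C := E) hp, hs.eq_singleton hk',
      ((hE'.run hr).subsing hN).eq_singleton hkC]
  exact ⟨c, by simp⟩

theorem mem_nodes (h : N.Spans n C₀ C V) {v : List (Node × R)} (hv : v ∈ V) {l : Node × R}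
    (hl : l ∈ v) : some l.1 ∈ (N.span n C V).nodes :=
  mem_span_nodes.2 ⟨((h.run v hv).isLoc l hl).1, v, hv, l.2, hl⟩

theorem mem_out (h : N.Spans n C₀ C V) {v : List (Node × R)} (hv : v ∈ V) {l : Node × R}
    (hl : l ∈ v) : l.2 ∈ (N.span n C V).out (some l.1) :=
  mem_span_out.2 ⟨((h.run v hv).isLoc l hl).2, v, hv, hl⟩

theorem wellFormed (hN : N.SoundDet) (h : N.Spans n C₀ C V) : (N.span n C V).WellFormed where
  dom_subset := by
    rintro (_ | m) hm
    · exact subset_rfl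
    · obtain ⟨-, v, hv, b, hb⟩ := mem_span_nodes.1 hm
      exact h.dom_subset v hv _ hb
  dom_nonempty := by
    rintro (_ | m) hm
    · exact hN.wf.dom_nonempty n h.first.enabled.1
    · exact hN.wf.dom_nonempty m (mem_span_nodes.1 hm).1
  δ_mem := by
    rintro (_ | m) hm b hb p hp k hk
    · simp [span_out_none] at hb
    · obtain ⟨hb', v, hv, hmb⟩ := mem_span_out.1 hb
      by_cases he : N.δ m b p = C p
      · rw [span_δ_of_eq he] at hk
        obtain rfl : k = none := hk
        exact ⟨none_mem_span_nodes, h.dom_subset v hv _ hmb hp⟩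
      · rw [span_δ_of_ne he] at hk
        obtain ⟨k, hk, rfl⟩ := hk
        obtain ⟨v₁, v₂, rfl⟩ := List.append_of_mem hmb
        obtain ⟨c, hc⟩ := h.leave hN hv hp he hk
        exact ⟨h.mem_nodes (l := (k, c)) hv (by simp [hc]),
          (hN.wf.δ_mem m (mem_span_nodes.1 hm).1 b hb' p hp k hk).2⟩
  init_mem := by
    obtain ⟨v, hv⟩ := h.exists_mem
    obtain ⟨b, hb⟩ := h.mem_init v hv
    exact h.mem_nodes hv hb
  fin_mem := none_mem_span_nodes
  init_ne_fin := by simp [span]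
  dom_init := rfl
  dom_fin := rfl
  out_nonempty := by
    rintro (_ | m) hm hf
    · exact absurd rfl hf
    · obtain ⟨-, v, hv, b, hb⟩ := mem_span_nodes.1 hm
      exact ⟨b, h.mem_out hv hb⟩
  out_fin := rfl

/-- Runs of the spanned diagram are runs of the original diagram. -/
theorem lift_run {E E' : Config Proc (Option Node)} {w : List (Option Node × R)}
    (hw : (N.span n C V).Run E w E') {F : Config Proc Node}
    (hEF : ∀ p ∈ N.dom n, (E p = {none} ∧ F p = C p) ∨ E p = some '' F p)
    (hV : ∀ v ∈ V, ∀ l ∈ v, N.dom l.1 ⊆ N.dom n) :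
    ∃ u F', w = u.map (Prod.map some id) ∧ N.Run F u F' ∧
      (∀ p ∈ N.dom n, (E' p = {none} ∧ F' p = C p) ∨ E' p = some '' F' p) ∧
      ∀ l ∈ u, ∃ v ∈ V, l ∈ v := by
  induction hw generalizing F with
  | nil => exact ⟨[], F, rfl, .nil _, hEF, by simp⟩
  | @cons E E' m b w h1 h2 _ ih =>
    rcases m with _ | m
    · simp [span_out_none] at h2
    obtain ⟨hb, v, hv, hmb⟩ := mem_span_out.1 h2
    have hen : N.Enabled F m := ⟨(mem_span_nodes.1 h1.1).1, fun p hp => by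
      have hm : some m ∈ E p := h1.2 p hp
      rcases hEF p (hV v hv _ hmb hp) with ⟨he, -⟩ | he
      · rw [he] at hm; simp at hm
      · rw [he] at hm; simpa using hm⟩
    obtain ⟨u, F', rfl, r, h3, h4⟩ := ih (F := N.after F m b) fun p hp => by
      by_cases hpm : p ∈ N.dom m
      · rw [after_of_mem (N := N.span n C V) (n := some m) hpm, after_of_mem hpm]
        by_cases he : N.δ m b p = C p
        · exact .inl ⟨span_δ_of_eq he, he⟩
        · exact .inr (span_δ_of_ne he)
      · rw [after_of_notMem (N := N.span n C V) (n := some m) hpm, after_of_notMem hpm]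
        exact hEF p hp
    refine ⟨(m, b) :: u, F', rfl, .cons hen hb r, h3, fun l hl => ?_⟩
    rcases List.mem_cons.1 hl with rfl | hl
    exacts [⟨v, hv, hmb⟩, h4 l hl]

theorem lift_successful (hN : N.SoundDet) (h : N.Spans n C₀ C V) {w : List (Option Node × R)}
    (hw : (N.span n C V).Successful w) : ∃ u, w = u.map (Prod.map some id) ∧ N.Run C₀ u C ∧
      ∀ l ∈ u, ∃ v ∈ V, l ∈ v := by
  obtain ⟨u, F', rfl, r, h1, h2⟩ := lift_run (F := C₀) hw (fun p hp => .inr (by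
    rw [h.first.enabled.eq_singleton hN h.first.1 hp]
    ext k; simp [cInit, span, hp])) h.dom_subset
  refine ⟨u, rfl, ?_, h2⟩
  convert r using 1
  funext p
  by_cases hp : p ∈ N.dom n
  · have hnone : none ∈ (N.span n C V).cFin p := ⟨hp, rfl⟩
    rcases h1 p hp with ⟨-, he⟩ | he
    · exact he.symm
    · rw [he] at hnone; simp at hnone
  · obtain ⟨v, hv⟩ := h.exists_mem
    rw [(h.run v hv).eq_of_notMem (h.dom_subset v hv) hp, r.eq_of_notMem (fun l hl => ?_) hp]
    obtain ⟨v', hv', hl'⟩ := h2 l hl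
    exact h.dom_subset v' hv' l hl'

open Classical in
/-- The configuration of the spanned diagram from which the remaining part `w` of a run is
executed. -/
noncomputable def residual (N : Negotiation Proc Node R) (n : Node) (F : Config Proc Node)
    (w : List (Node × R)) : Config Proc (Option Node) := fun p =>
  if p ∈ N.dom n then if ∃ l ∈ w, p ∈ N.dom l.1 then some '' F p else {none} else ∅

theorem drop_run (h : N.Spans n C₀ C V) {v₁ v₂ : List (Node × R)} (hv : v₁ ++ v₂ ∈ V)
    {F : Config Proc Node} (hF : N.Run F v₂ C) :
    (N.span n C V).Run (residual N n F v₂) (v₂.map (Prod.map some id)) (N.span n C V).cFin := by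
  induction v₂ generalizing v₁ F with
  | nil =>
    have : residual N n F [] = (N.span n C V).cFin := by
      funext p
      by_cases hp : p ∈ N.dom n
      · ext k; simp [residual, cFin, span, hp]
      · ext k; simp [residual, cFin, span, hp]
    rw [this]
    exact .nil _
  | cons l v₂ ih =>
    obtain ⟨m, b⟩ := l
    obtain ⟨h1, h2, h3⟩ := run_cons_iff.1 hF
    have hmn : N.dom m ⊆ N.dom n := h.dom_subset _ hv (m, b) (by simp)
    refine .cons (n := some m) ⟨h.mem_nodes (l := (m, b)) hv (by simp), fun p hp => ?_⟩
      (h.mem_out (l := (m, b)) hv (by simp)) ?_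
    · have hp : p ∈ N.dom m := hp
      have : ∃ l ∈ (m, b) :: v₂, p ∈ N.dom l.1 := ⟨(m, b), by simp, hp⟩
      simp only [residual, hmn hp, this, if_true]
      exact ⟨m, h1.2 p hp, rfl⟩
    · have := ih (v₁ := v₁ ++ [(m, b)]) (by simpa using hv) h3
      convert this using 1
      funext p
      by_cases hp : p ∈ N.dom m
      · rw [after_of_mem (N := N.span n C V) (n := some m) hp]
        simp only [residual, hmn hp, if_true]
        by_cases he : N.δ m b p = C p
        · rw [id, span_δ_of_eq he, if_neg]
          rintro ⟨l, hl, hpl⟩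
          exact h.stay _ _ _ _ hv p hp he l hl hpl
        · rw [id, span_δ_of_ne he, if_pos, after_of_mem hp]
          by_contra hcon
          push Not at hcon
          refine he ?_
          rw [h3.outside hcon, after_of_mem hp]
      · rw [after_of_notMem (N := N.span n C V) (n := some m) hp]
        by_cases hpn : p ∈ N.dom n
        · simp only [residual, after_of_notMem hp, hpn, if_true]
          classical exact if_congr (by simp [hp]) rfl rfl
        · simp [residual, hpn]

theorem successful (hN : N.SoundDet) (h : N.Spans n C₀ C V) {v : List (Node × R)} (hv : v ∈ V) :
    (N.span n C V).Successful (v.map (Prod.map some id)) := by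
  have := h.drop_run (v₁ := []) hv (h.run v hv)
  unfold Successful
  convert this using 1
  funext p
  obtain ⟨b, hb⟩ := h.mem_init v hv
  by_cases hp : p ∈ N.dom n
  · have : ∃ l ∈ v, p ∈ N.dom l.1 := ⟨_, hb, hp⟩
    simp only [residual, this, hp, if_true]
    rw [h.first.enabled.eq_singleton hN h.first.1 hp]
    ext k; simp [cInit, span, hp]
  · ext k; simp [cInit, span, hp, residual]

theorem semRun_map (sem : Node × R → D → D) (u : List (Node × R)) :
    semRun (subSem sem) (u.map (Prod.map some id)) = semRun sem u := by
  induction u with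
  | nil => rfl
  | cons l u ih => rw [List.map_cons, semRun, ih]; rfl

/-- The merge over all paths of the spanned diagram, if all its successful runs belong to `V`. -/
theorem mop_eq [CompleteLattice D] (hN : N.SoundDet) (h : N.Spans n C₀ C V)
    (hV : ∀ u, (N.span n C V).Successful (u.map (Prod.map some id)) → u ∈ V)
    (sem : Node × R → D → D) :
    (N.span n C V).mop (subSem sem) = sSup (semRun sem '' V) := by
  unfold mop
  congr 1
  ext f
  constructor
  · rintro ⟨w, hw, rfl⟩
    obtain ⟨u, rfl, -⟩ := h.lift_successful hN hw
    exact ⟨u, hV u hw, (semRun_map sem u).symm⟩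
  · rintro ⟨u, hu, rfl⟩
    exact ⟨_, h.successful hN hu, (semRun_map sem u).symm⟩

end Spans

end Span

/-! ## The subdiagram of a location -/

section Loc

variable {Proc Node R D : Type*} {N : Negotiation Proc Node R} {n : Node} {a : R}
  {C₀ C : Config Proc Node}

/-- The runs of `N|_ℓ`. -/
def locRuns (N : Negotiation Proc Node R) (n : Node) (a : R) (C₀ C : Config Proc Node) :
    Set (List (Node × R)) :=
  {v | ∃ u, v = (n, a) :: u ∧ N.IsStrictSeq n u ∧ N.Run C₀ v C}

theorem subLoc_eq_span : N.subLoc n a C₀ C = N.span n C (N.locRuns n a C₀ C) := by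
  have h₁ : ∀ m, (∃ v ∈ N.locRuns n a C₀ C, ∃ b, (m, b) ∈ v) ↔ ∃ u b, N.IsStrictSeq n u ∧
      N.Run C₀ ((n, a) :: u) C ∧ (m, b) ∈ (n, a) :: u := fun m => by
    constructor
    · rintro ⟨_, ⟨u, rfl, h1, h2⟩, b, h⟩
      exact ⟨u, b, h1, h2, h⟩
    · rintro ⟨u, b, h1, h2, h⟩
      exact ⟨_, ⟨u, rfl, h1, h2⟩, b, h⟩
  have h₂ : ∀ m b, (∃ v ∈ N.locRuns n a C₀ C, (m, b) ∈ v) ↔ ∃ u, N.IsStrictSeq n u ∧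
      N.Run C₀ ((n, a) :: u) C ∧ (m, b) ∈ (n, a) :: u := fun m b => by
    constructor
    · rintro ⟨_, ⟨u, rfl, h1, h2⟩, h⟩
      exact ⟨u, h1, h2, h⟩
    · rintro ⟨u, h1, h2, h⟩
      exact ⟨_, ⟨u, rfl, h1, h2⟩, h⟩
  classical
  unfold subLoc span
  congr 1
  · exact congrArg _ (Finset.filter_congr fun m _ => (h₁ m).symm)
  · funext m
    cases m with
    | none => rfl
    | some m => exact Finset.filter_congr fun b _ => (h₂ m b).symm

theorem Run.reachableNode {E E' : Config Proc Node} {w : List (Node × R)} (h : N.Run E w E')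
    (hE : N.Reachable E) {l : Node × R} (hl : l ∈ w) : N.ReachableNode l.1 := by
  obtain ⟨w₁, w₂, rfl⟩ := List.append_of_mem hl
  obtain ⟨F, h1, h2⟩ := run_append_iff.1 h
  exact ⟨F, hE.run h1, (run_cons_iff.1 h2).1⟩

/-- All reachable nodes with domain strictly included in `X` have a single outcome, after which no
node with domain included in theirs is enabled. -/
def ReducedBelow (N : Negotiation Proc Node R) (X : Finset Proc) : Prop :=
  ∀ k, N.ReachableNode k → N.dom k ⊂ X → N.LocallyReduced k

theorem ReducedBelow.out_eq {X : Finset Proc} (h : N.ReducedBelow X) {k : Node}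
    (hk : N.ReachableNode k) (hd : N.dom k ⊂ X) {b : R} (hb : b ∈ N.out k) : N.out k = {b} := by
  obtain ⟨c, hc, -⟩ := h k hk hd
  rw [hc, Finset.mem_singleton] at hb
  rw [hc, hb]

theorem ReducedBelow.lowers (hN : N.SoundDet) {X : Finset Proc} (h : N.ReducedBelow X)
    {r : Node → ℕ} (hr : N.IsRank r) {k : Node} (hk : N.ReachableNode k) (hd : N.dom k ⊂ X) {b : R}
    (hb : b ∈ N.out k) : N.Lowers r k b := by
  obtain ⟨c, hc, hl⟩ := hr k hk (hN.ne_fin_of_mem_out hb)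
  rw [h.out_eq hk hd hb, Finset.mem_singleton] at hc
  rwa [← hc]

theorem IsStrictSeq.lowers (hN : N.SoundDet) (h : N.ReducedBelow (N.dom n)) {r : Node → ℕ}
    (hr : N.IsRank r) {E E' : Config Proc Node} {w : List (Node × R)} (hw : N.Run E w E')
    (hE : N.Reachable E) (hs : N.IsStrictSeq n w) : ∀ l ∈ w, N.Lowers r l.1 l.2 := fun l hl =>
  h.lowers hN hr (hw.reachableNode hE hl) (hs l hl) (hw.isLoc l hl).2

theorem spans_locRuns (hN : N.SoundDet) (hX : N.ReducedBelow (N.dom n)) (h₀ : N.IsFirst n C₀)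
    (h : N.IsLastLoc n a C₀ C) : N.Spans n C₀ C (N.locRuns n a C₀ C) where
  first := h₀
  run := by rintro _ ⟨u, -, -, h⟩; exact h
  dom_subset := by
    rintro _ ⟨u, rfl, h, -⟩ l hl
    rcases List.mem_cons.1 hl with rfl | hl
    exacts [subset_rfl, (h l hl).subset]
  exists_mem := by
    obtain ⟨⟨u, h1, h2⟩, -⟩ := h
    exact ⟨_, u, rfl, h1, h2⟩
  mem_init := by
    rintro _ ⟨u, rfl, -⟩
    exact ⟨a, List.mem_cons_self⟩
  stay := by
    rintro v₁ m b v₂ ⟨u, he, hs, hr⟩ p hp hδ l hl hpl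
    obtain ⟨r, hrk⟩ := hN.exists_isRank
    obtain ⟨E, h1, h2⟩ := run_append_iff.1 hr
    obtain ⟨h3, h4, h5⟩ := run_cons_iff.1 h2
    have hE := h₀.1.run h1
    have hs' : N.IsStrictSeq n v₂ := by
      intro x hx
      refine hs x ?_
      cases v₁ with
      | nil => simp only [List.nil_append, List.cons.injEq] at he; exact he.2 ▸ hx
      | cons y v₁ =>
        simp only [List.cons_append, List.cons.injEq] at he
        rw [← he.2]; simp [hx]
    have := ((h5.rank hN (hE.after h3 h4) (hs'.lowers hN hX hrk h5 (hE.after h3 h4)) p).2 l hl hpl).2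
    rw [after_of_mem hp, hδ] at this
    exact lt_irrefl _ this

theorem tail_strict {v₁ v₂ : List (Node × R)} {l : Node × R}
    (h : v₁ ++ l :: v₂ ∈ N.locRuns n a C₀ C) : N.IsStrictSeq n v₂ := by
  obtain ⟨u, he, hs, -⟩ := h
  intro x hx
  refine hs x ?_
  cases v₁ with
  | nil => simp only [List.nil_append, List.cons.injEq] at he; exact he.2 ▸ hx
  | cons y v₁ =>
    simp only [List.cons_append, List.cons.injEq] at he
    rw [← he.2]; simp [hx]

/-- The initial node of `N|_ℓ` is the target of no edge. -/
theorem some_notMem_span_δ (hN : N.SoundDet) (h : N.Spans n C₀ C (N.locRuns n a C₀ C)) {m : Node}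
    {b : R} (hb : b ∈ (N.span n C (N.locRuns n a C₀ C)).out (some m)) {p : Proc}
    (hp : p ∈ N.dom m) : some n ∉ (N.span n C (N.locRuns n a C₀ C)).δ (some m) b p := by
  obtain ⟨hb', v, hv, hmb⟩ := mem_span_out.1 hb
  obtain ⟨v₁, v₂, rfl⟩ := List.append_of_mem hmb
  by_cases he : N.δ m b p = C p
  · rw [span_δ_of_eq he]; simp
  · rw [span_δ_of_ne he]
    rintro ⟨k, hk, hkn⟩
    obtain rfl : k = n := by simpa using hkn
    obtain ⟨c, hc⟩ := h.leave hN hv hp he hk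
    exact (tail_strict hv _ hc).ne rfl

theorem mem_locRuns_of_successful (hN : N.SoundDet) (h : N.Spans n C₀ C (N.locRuns n a C₀ C))
    {u : List (Node × R)} (hu : (N.span n C (N.locRuns n a C₀ C)).Successful
      (u.map (Prod.map some id))) : u ∈ N.locRuns n a C₀ C := by
  set S := N.span n C (N.locRuns n a C₀ C) with hS
  have hloc : ∀ l : Node × R, l.2 ∈ S.out (some l.1) → l = (n, a) ∨ N.dom l.1 ⊂ N.dom n := by
    rintro ⟨m, b⟩ hb
    obtain ⟨-, v, ⟨u, rfl, hs, -⟩, hmb⟩ := mem_span_out.1 hb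
    rcases List.mem_cons.1 hmb with h | h
    exacts [.inl h, .inr (hs _ h)]
  have key : ∀ E w E', S.Run E w E' → (∀ p ∈ N.dom n, some n ∉ E p) →
      ∀ l ∈ w, l.1 ≠ some n := by
    intro E w E' hw
    induction hw with
    | nil => simp
    | @cons E E' m b w h1 h2 _ ih =>
      intro hE l hl
      rcases List.mem_cons.1 hl with rfl | hl
      · rintro rfl
        obtain ⟨p, hp⟩ := hN.wf.dom_nonempty n h.first.enabled.1
        exact hE p hp (h1.2 p hp)
      · refine ih (fun p hp => ?_) l hl
        by_cases hpm : p ∈ S.dom m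
        · rw [after_of_mem hpm]
          rcases m with _ | m
          · exact absurd h2 (by simp [hS, span_out_none])
          · exact some_notMem_span_δ hN h h2 hpm
        · rw [after_of_notMem hpm]; exact hE p hp
  obtain ⟨u', he, hr, hu'⟩ := h.lift_successful hN hu
  obtain rfl := List.map_injective_iff.2
    ((Option.some_injective _).prodMap Function.injective_id) he
  cases hr with
  | nil =>
    have h1 := run_nil_iff.1 hu
    obtain ⟨p, hp⟩ := hN.wf.dom_nonempty n h.first.enabled.1
    have h2 : some n ∈ S.cInit p := ⟨hp, rfl⟩
    rw [h1] at h2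
    exact absurd h2.2 (by simp [hS, span])
  | @cons _ _ m b w h1 h2 h3 =>
    obtain rfl := (h.first.2 m).1 h1
    obtain ⟨h4, h5, h6⟩ := run_cons_iff.1 hu
    obtain rfl : b = a := by
      rcases hloc (m, b) h5 with h7 | h7
      · exact (Prod.ext_iff.1 h7).2
      · exact absurd rfl h7.ne
    refine ⟨w, rfl, fun l hl => ?_, .cons h1 h2 h3⟩
    have hne := key _ _ _ h6 (fun p hp => by
      rw [after_of_mem (N := S) (n := some m) hp]
      exact some_notMem_span_δ hN h h5 hp) (some l.1, l.2) (List.mem_map.2 ⟨l, hl, rfl⟩)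
    obtain ⟨v, hv, hlv⟩ := hu' l (List.mem_cons_of_mem _ hl)
    rcases hloc l (h.mem_out hv hlv) with rfl | h7
    exacts [absurd rfl hne, h7]

theorem mop_subLoc [CompleteLattice D] (hN : N.SoundDet) (hX : N.ReducedBelow (N.dom n))
    (h₀ : N.IsFirst n C₀) (h : N.IsLastLoc n a C₀ C) (sem : Node × R → D → D) :
    (N.subLoc n a C₀ C).mop (subSem sem) = sSup (semRun sem '' N.locRuns n a C₀ C) := by
  have hs := spans_locRuns hN hX h₀ h
  rw [subLoc_eq_span, hs.mop_eq hN fun u hu => mem_locRuns_of_successful hN hs hu]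

theorem oneTrace_subLoc (hN : N.SoundDet) (hX : N.ReducedBelow (N.dom n)) (h₀ : N.IsFirst n C₀)
    (h : N.IsLastLoc n a C₀ C) : (N.subLoc n a C₀ C).OneTrace := by
  have hs := spans_locRuns hN hX h₀ h
  rw [subLoc_eq_span]
  obtain ⟨r, hr⟩ := hN.exists_isRank
  have hred : ∀ m b, b ∈ (N.span n C (N.locRuns n a C₀ C)).out (some m) → m ≠ n →
      N.ReachableNode m ∧ N.dom m ⊂ N.dom n := by
    intro m b hb hmn
    obtain ⟨-, v, ⟨u, rfl, hu, hrun⟩, hmb⟩ := mem_span_out.1 hb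
    refine ⟨hrun.reachableNode h₀.1 hmb, ?_⟩
    rcases List.mem_cons.1 hmb with he | he
    exacts [absurd (Prod.ext_iff.1 he).1 hmn, hu _ he]
  have hone : ∀ m b c, b ∈ (N.span n C (N.locRuns n a C₀ C)).out (some m) →
      c ∈ (N.span n C (N.locRuns n a C₀ C)).out (some m) → b = c := by
    intro m b c hb hc
    by_cases hmn : m = n
    · subst hmn
      have : ∀ b, b ∈ (N.span m C (N.locRuns m a C₀ C)).out (some m) → b = a := by
        intro b hb
        obtain ⟨-, v, ⟨u, rfl, hu, -⟩, hmb⟩ := mem_span_out.1 hb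
        rcases List.mem_cons.1 hmb with he | he
        exacts [(Prod.ext_iff.1 he).2, absurd rfl (hu _ he).ne]
      rw [this b hb, this c hc]
    · obtain ⟨h1, h2⟩ := hred m b hb hmn
      have h3 := hX.out_eq h1 h2 (mem_span_out.1 hb).1
      have := (mem_span_out.1 hc).1
      rw [h3, Finset.mem_singleton] at this
      exact this.symm
  classical
  let μ : Option Node → ℕ∞ := fun x => x.elim 0 fun m => if m = n then ⊤ else (r m + 1 : ℕ)
  have hμ : ∀ x y, (N.span n C (N.locRuns n a C₀ C)).Edge x y → μ y < μ x := by
    rintro (_ | m) y ⟨hm, b, hb, p, hp, hy⟩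
    · simp [span_out_none] at hb
    · have hb' := mem_span_out.1 hb
      have hyn : y ≠ some n := by
        rintro rfl
        exact some_notMem_span_δ hN hs hb hp hy
      rcases y with _ | k
      · simp only [μ, Option.elim]
        split_ifs
        · exact ENat.top_pos
        · exact_mod_cast Nat.succ_pos _
      · have hkn : k ≠ n := fun h => hyn (by rw [h])
        simp only [μ, Option.elim, if_neg hkn]
        split_ifs with hmn
        · exact ENat.natCast_lt_top _
        · obtain ⟨h1, h2⟩ := hred m b hb hmn
          have hk : k ∈ N.δ m b p := by
            by_cases he : N.δ m b p = C p
            · rw [span_δ_of_eq he] at hy; simp at hy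
            · rw [span_δ_of_ne he] at hy; simpa using hy
          have := hX.lowers hN hr h1 h2 hb'.1 p hp k hk
          exact_mod_cast Nat.succ_lt_succ this
  refine ⟨hs.wellFormed hN, fun x hx => ?_, ?_⟩
  · have : ∀ x y, Relation.TransGen (N.span n C (N.locRuns n a C₀ C)).Edge x y → μ y < μ x := by
      intro x y hxy
      induction hxy with
      | single h => exact hμ _ _ h
      | tail _ h ih => exact (hμ _ _ h).trans ih
    exact lt_irrefl _ (this x x hx)
  · rintro (_ | m) hm hf
    · exact absurd rfl hf
    · obtain ⟨b, hb⟩ := (hs.wellFormed hN).out_nonempty _ hm hf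
      rw [Finset.card_eq_one]
      exact ⟨b, Finset.eq_singleton_iff_unique_mem.2 ⟨hb, fun c hc => hone m c b hc hb⟩⟩

/-- A sequence of nodes with single outcomes that can be executed occurs in every run to the final
configuration, up to commutation. -/
theorem Run.pull_list (hN : N.SoundDet) {E F : Config Proc Node} {u : List (Node × R)}
    (hu : N.Run E u F) (hE : N.Reachable E) (hs : ∀ l ∈ u, N.out l.1 = {l.2})
    {w : List (Node × R)} (hw : N.Run E w N.cFin) : ∃ w', N.TraceEq w (u ++ w') := by
  induction hu generalizing w with
  | nil => exact ⟨w, .refl _⟩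
  | @cons E F m b u h1 h2 _ ih =>
    obtain ⟨c, w₁, ht, hr⟩ := hw.pull_fin hN hE h1 (hN.ne_fin_of_mem_out h2)
    obtain ⟨h3, h4, h5⟩ := run_cons_iff.1 hr
    have hm := hs (m, b) List.mem_cons_self
    simp only at hm
    rw [hm, Finset.mem_singleton] at h4
    subst h4
    obtain ⟨w', ht'⟩ := ih (hE.after h1 h2) (fun l hl => hs l (List.mem_cons_of_mem _ hl)) h5
    exact ⟨w', ht.trans (ht'.cons _)⟩

open Classical in
/-- The runs summarized by the locations of `Red_ℓ(N)`. -/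
theorem summary_redLoc [DecidableEq Node] [DecidableEq R] [CompleteLattice D] (hN : N.SoundDet)
    (hX : N.ReducedBelow (N.dom n)) (h₀ : N.IsFirst n C₀) (h : N.IsLastLoc n a C₀ C)
    (sem : Node × R → D → D) {b : R} (hb : b ∉ (N.out n).erase a) :
    N.Summary sem (N.redLoc n a b C)
      (Function.update sem (n, b) ((N.subLoc n a C₀ C).mop (subSem sem)))
      (fun l => if l = (n, b) then N.locRuns n a C₀ C else {[l]}) where
  procs_eq := rfl
  nodes_eq := rfl
  dom_eq := rfl
  init_eq := rfl
  fin_eq := rfl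
  nonempty := fun l _ => by
    split_ifs
    · exact (spans_locRuns hN hX h₀ h).exists_mem
    · exact Set.singleton_nonempty _
  run := fun l hl v hv E hE => by
    split_ifs at hv with hlb
    · subst hlb
      have hs := spans_locRuns hN hX h₀ h
      obtain ⟨E', h1, h2, h3⟩ := h₀.transfer (hs.run v hv) (hs.dom_subset v hv)
        (by obtain ⟨u, rfl, -⟩ := hv; simp) hE
      convert h1 using 1
      funext p
      by_cases hp : p ∈ N.dom n
      · rw [after_of_mem (N := N.redLoc n a b C) hp, h2 p hp]
        simp [redLoc]
      · rw [after_of_notMem (N := N.redLoc n a b C) hp, h3 p hp]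
    · obtain ⟨m, c⟩ := l
      obtain rfl : v = [(m, c)] := hv
      have hmc : c ∈ N.out m ∧ (N.redLoc n a b C).δ m c = N.δ m c := by
        obtain ⟨-, h2⟩ := hl
        by_cases hmn : m = n
        · subst hmn
          have hcb : c ≠ b := fun h => hlb (by rw [h])
          simp only [redLoc, Function.update_self, Finset.mem_insert, hcb, false_or,
            Finset.mem_erase] at h2
          exact ⟨h2.2, by simp [redLoc, hcb]⟩
        · simp only [redLoc, Function.update_of_ne hmn] at h2
          exact ⟨h2, by simp [redLoc, hmn]⟩
      refine .cons hE hmc.1 ?_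
      convert Run.nil _ using 1
      funext p
      by_cases hp : p ∈ N.dom m
      · rw [after_of_mem hp, after_of_mem (N := N.redLoc n a b C) hp, hmc.2]
      · rw [after_of_notMem hp, after_of_notMem (N := N.redLoc n a b C) hp]
  ne_nil := fun l _ v hv => by
    split_ifs at hv
    · obtain ⟨u, rfl, -⟩ := hv; simp
    · obtain rfl : v = [l] := hv; simp
  dom_subset := fun l _ v hv => by
    split_ifs at hv with hlb
    · subst hlb
      exact (spans_locRuns hN hX h₀ h).dom_subset v hv
    · obtain rfl : v = [l] := hv; simp
  sem_eq := fun l _ => by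
    by_cases hlb : l = (n, b)
    · subst hlb
      rw [Function.update_self, if_pos rfl, mop_subLoc hN hX h₀ h]
    · rw [Function.update_of_ne hlb, if_neg hlb]
      simp [semRun]
  complete := fun E hE w hw hw0 => by
    cases hw with
    | nil => exact absurd rfl hw0
    | @cons _ _ m c w h1 h2 h3 =>
      by_cases hmc : (m, c) = (n, a)
      · obtain ⟨rfl, rfl⟩ := Prod.ext_iff.1 hmc
        simp only at *
        obtain ⟨⟨u, hu, hr⟩, -⟩ := id h
        have hmem : (m, c) :: u ∈ N.locRuns m c C₀ C := ⟨u, rfl, hu, hr⟩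
        have hs := spans_locRuns hN hX h₀ h
        obtain ⟨E', h4, -⟩ := hr.congr (hs.dom_subset _ hmem) (E := E) fun p hp => by
          rw [h₀.enabled.eq_singleton hN h₀.1 hp, h1.eq_singleton hN hE hp]
        obtain ⟨-, -, h4⟩ := run_cons_iff.1 h4
        have hE' := hE.after h1 h2
        obtain ⟨w', ht⟩ := h4.pull_list hN hE' (fun l hl =>
          hX.out_eq (h4.reachableNode hE' hl) (hu l hl) (h4.isLoc l hl).2) h3
        refine ⟨(m, b), (m, c) :: u, w', ⟨h1.1, ?_⟩, h1, by rwa [if_pos rfl], ht.cons _⟩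
        simp [redLoc]
      · have hne : (m, c) ≠ (n, b) := by
          intro he
          obtain ⟨rfl, rfl⟩ := Prod.ext_iff.1 he
          simp only at *
          exact hb (Finset.mem_erase.2 ⟨fun h => hmc (by rw [h]), h2⟩)
        refine ⟨(m, c), [(m, c)], w, ⟨h1.1, ?_⟩, h1, by rw [if_neg hne]; rfl, .refl _⟩
        by_cases hmn : m = n
        · subst hmn
          simp only [redLoc, Function.update_self, Finset.mem_insert, Finset.mem_erase]
          exact .inr ⟨fun h => hmc (by rw [h]), h2⟩
        · simp only [redLoc, Function.update_of_ne hmn]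
          exact h2

end Loc

end Negotiation

namespace Negotiation

/-! ## The subdiagram of a node -/

section NodeRuns

variable {Proc Node R D : Type*} {N : Negotiation Proc Node R} {n : Node}
  {C₀ C : Config Proc Node} {X : Finset Proc}

/-- After a location of a reachable node with domain `X`, no node with domain strictly included in
`X` is enabled. -/
def LocsReduced (N : Negotiation Proc Node R) (X : Finset Proc) : Prop :=
  ∀ k, N.ReachableNode k → N.dom k = X → ∀ b ∈ N.out k, ∀ j ∈ N.nodes, N.dom j ⊂ X →
    ¬ ∀ p ∈ N.dom j, j ∈ N.δ k b p

theorem LocsReduced.enabled_or_quiet (h : N.LocsReduced X) {E : Config Proc Node}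
    (hE : N.Reachable E) {k : Node} (hk : N.Enabled E k) (hkX : N.dom k = X) {b : R}
    (hb : b ∈ N.out k) :
    (∃ j, j ≠ N.fin ∧ N.dom j = X ∧ N.Enabled (N.after E k b) j) ∨ N.Quiet X (N.after E k b) := by
  by_contra hcon
  push Not at hcon
  refine hcon.2 fun j hj hjf hjX => ?_
  rcases hjX.eq_or_ssubset with he | hs
  · exact hcon.1 j hjf he hj
  · refine h k ⟨E, hE, hk⟩ hkX b hb j hj.1 hs fun p hp => ?_
    rw [← after_of_mem (N := N) (C := E) (hkX ▸ hs.subset hp)]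
    exact hj.2 p hp

theorem Enabled.eq_of_subset (hN : N.SoundDet) {E : Config Proc Node} (hE : N.Reachable E)
    {k j : Node} (hk : N.Enabled E k) (hj : N.Enabled E j) (hd : N.dom j ⊆ N.dom k) : j = k := by
  by_contra hne
  obtain ⟨p, hp⟩ := hN.wf.dom_nonempty j hj.1
  exact Finset.disjoint_left.1 (hj.disjoint (hE.subsing hN) hk hne) hp (hd hp)

/-- The structure of the runs within `X`: all executed nodes have domain `X`, and after every
location but the last one a node with domain `X` is enabled. -/
theorem LocsReduced.run_split (hN : N.SoundDet) (h : N.LocsReduced X) {E E' : Config Proc Node}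
    {w : List (Node × R)} (hw : N.Run E w E') (hX : ∀ l ∈ w, N.dom l.1 ⊆ X) (hE : N.Reachable E)
    {k : Node} (hk : N.Enabled E k) (hkX : N.dom k = X) {w₁ w₂ : List (Node × R)} {m : Node} {b : R}
    (hs : w = w₁ ++ (m, b) :: w₂) {F : Config Proc Node} (hF : N.Run E (w₁ ++ [(m, b)]) F) :
    N.dom m = X ∧ (w₂ ≠ [] → ∃ j, j ≠ N.fin ∧ N.dom j = X ∧ N.Enabled F j) := by
  induction hw generalizing w₁ k with
  | nil => simp at hs
  | @cons E E' m' c w h1 h2 h3 ih =>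
    obtain rfl := hk.eq_of_subset hN hE h1 (hkX ▸ hX _ List.mem_cons_self)
    cases w₁ with
    | nil =>
      simp only [List.nil_append, List.cons.injEq, Prod.mk.injEq] at hs hF
      obtain ⟨⟨rfl, rfl⟩, rfl⟩ := hs
      refine ⟨hkX, fun hne => ?_⟩
      obtain rfl := run_nil_iff.1 (run_cons_iff.1 hF).2.2
      rcases h.enabled_or_quiet hE h1 hkX h2 with h4 | h4
      · exact h4
      · cases h3 with
        | nil => exact absurd rfl hne
        | @cons _ _ l d _ h5 h6 _ =>
          exact absurd (hX (l, d) (by simp)) (h4 l h5 (hN.ne_fin_of_mem_out h6))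
    | cons l w₁ =>
      simp only [List.cons_append, List.cons.injEq] at hs hF
      obtain ⟨rfl, rfl⟩ := hs
      have hX' : ∀ l ∈ w₁ ++ (m, b) :: w₂, N.dom l.1 ⊆ X :=
        fun l hl => hX l (List.mem_cons_of_mem _ hl)
      have hF' := (run_cons_iff.1 hF).2.2
      rcases h.enabled_or_quiet hE h1 hkX h2 with ⟨j, hj, hjX, hjE⟩ | h4
      · exact ih hX' (hE.after h1 h2) hjE hjX rfl hF'
      · obtain ⟨l, hl, hl'⟩ : ∃ l, N.Enabled (N.after E m' c) l ∧ l ≠ N.fin ∧ N.dom l ⊆ X := by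
          cases w₁ with
          | nil =>
            obtain ⟨h5, h6, -⟩ := run_cons_iff.1 h3
            exact ⟨m, h5, hN.ne_fin_of_mem_out h6, hX' (m, b) (by simp)⟩
          | cons l w₁ =>
            obtain ⟨h5, h6, -⟩ := run_cons_iff.1 h3
            exact ⟨l.1, h5, hN.ne_fin_of_mem_out h6, hX' l (by simp)⟩
        exact absurd hl'.2 (h4 l hl hl'.1)

theorem IsFirst.isFirst_of_agree (hN : N.SoundDet) (h₀ : N.IsFirst n C₀) {E : Config Proc Node}
    (hE : N.Reachable E) {k : Node} (hk : N.Enabled E k) (hkn : N.dom k = N.dom n)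
    (hag : ∀ p ∉ N.dom n, E p = C₀ p) : N.IsFirst k E := by
  refine ⟨hE, fun j => ⟨fun hj => ?_, fun hj => hj ▸ hk⟩⟩
  by_contra hne
  have hd := hj.disjoint (hE.subsing hN) hk hne
  rw [hkn] at hd
  have hj' := (enabled_congr fun p hp => hag p (Finset.disjoint_left.1 hd hp)).1 hj
  obtain rfl := (h₀.2 j).1 hj'
  obtain ⟨p, hp⟩ := hN.wf.dom_nonempty j hj.1
  exact Finset.disjoint_left.1 hd hp hp

/-- The runs of `N|ₙ`. -/
def nodeRuns (N : Negotiation Proc Node R) (n : Node) (C₀ C : Config Proc Node) :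
    Set (List (Node × R)) :=
  {u | N.IsSeq n u ∧ N.Run C₀ u C}

theorem subNode_eq_span : N.subNode n C₀ C = N.span n C (N.nodeRuns n C₀ C) := by
  have h₁ : ∀ m, (∃ v ∈ N.nodeRuns n C₀ C, ∃ b, (m, b) ∈ v) ↔ ∃ u b, N.IsSeq n u ∧
      N.Run C₀ u C ∧ (m, b) ∈ u := fun m => by
    constructor
    · rintro ⟨u, ⟨h1, h2⟩, b, h⟩
      exact ⟨u, b, h1, h2, h⟩
    · rintro ⟨u, b, h1, h2, h⟩
      exact ⟨_, ⟨h1, h2⟩, b, h⟩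
  have h₂ : ∀ m b, (∃ v ∈ N.nodeRuns n C₀ C, (m, b) ∈ v) ↔ ∃ u, N.IsSeq n u ∧
      N.Run C₀ u C ∧ (m, b) ∈ u := fun m b => by
    constructor
    · rintro ⟨u, ⟨h1, h2⟩, h⟩
      exact ⟨u, h1, h2, h⟩
    · rintro ⟨u, h1, h2, h⟩
      exact ⟨_, ⟨h1, h2⟩, h⟩
  classical
  unfold subNode span
  congr 1
  · exact congrArg _ (Finset.filter_congr fun m _ => (h₁ m).symm)
  · funext m
    cases m with
    | none => rfl
    | some m => exact Finset.filter_congr fun b _ => (h₂ m b).symm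

theorem nodeRuns_ne_nil (hf : n ≠ N.fin) (h₀ : N.IsFirst n C₀) (h : N.IsLastNode n C₀ C)
    {v : List (Node × R)} (hv : v ∈ N.nodeRuns n C₀ C) : v ≠ [] := by
  rintro rfl
  obtain rfl := run_nil_iff.1 hv.2
  exact h.2 n h₀.enabled hf subset_rfl

/-- A process that is not in its last node is not ready in a node with the same domain. -/
theorem notMem_last (hN : N.SoundDet) (h₀ : N.IsFirst n C₀) (h : N.IsLastNode n C₀ C)
    {E : Config Proc Node} (hE : N.Reachable E) {k : Node} (hk : N.Enabled E k) (hf : k ≠ N.fin)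
    (hkn : N.dom k = N.dom n) (hag : ∀ p ∉ N.dom n, E p = C₀ p) (p : Proc) : k ∉ C p := by
  obtain ⟨⟨u, hu, hr⟩, hq⟩ := h
  refine (h₀.isFirst_of_agree hN hE hk hkn hag).notMem_of_quiet hN hf (h₀.1.run hr)
    (fun p hp => ?_) (fun j hj hjf => hkn ▸ hq j hj hjf) p
  rw [hag p (hkn ▸ hp), hr.eq_of_notMem hu (hkn ▸ hp)]

theorem spans_nodeRuns (hN : N.SoundDet) (hX : N.LocsReduced (N.dom n)) (hf : n ≠ N.fin)
    (h₀ : N.IsFirst n C₀) (h : N.IsLastNode n C₀ C) : N.Spans n C₀ C (N.nodeRuns n C₀ C) where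
  first := h₀
  run := fun v hv => hv.2
  dom_subset := fun v hv => hv.1
  exists_mem := h.1
  mem_init := fun v hv => by
    have hne := nodeRuns_ne_nil hf h₀ h hv
    cases hv.2 with
    | nil => exact absurd rfl hne
    | @cons _ _ m b w h1 h2 h3 =>
      obtain rfl := (h₀.2 m).1 h1
      exact ⟨b, List.mem_cons_self⟩
  stay := by
    intro v₁ m b v₂ hv p hp hδ l hl hpl
    obtain ⟨E, h1, h2⟩ := run_append_iff.1 hv.2
    obtain ⟨h3, h4, h5⟩ := run_cons_iff.1 h2
    have hr : N.Run C₀ (v₁ ++ [(m, b)]) (N.after E m b) := h1.append (.cons h3 h4 (.nil _))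
    obtain ⟨hm, hj⟩ := hX.run_split hN hv.2 hv.1 h₀.1 h₀.enabled rfl rfl hr
    obtain ⟨j, hjf, hjX, hj⟩ := hj (by rintro rfl; simp at hl)
    refine notMem_last hN h₀ h (h₀.1.run hr) hj hjf hjX (fun q hq => hr.eq_of_notMem
      (fun l hl => hv.1 l (by simp only [List.mem_append, List.mem_cons] at hl ⊢; tauto))
      hq) p ?_
    rw [← hδ, ← after_of_mem (N := N) (C := E) hp]
    exact hj.2 p (hjX ▸ hm ▸ hp)

theorem mem_nodeRuns_of_successful (hN : N.SoundDet) (h : N.Spans n C₀ C (N.nodeRuns n C₀ C))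
    {u : List (Node × R)} (hu : (N.span n C (N.nodeRuns n C₀ C)).Successful
      (u.map (Prod.map some id))) : u ∈ N.nodeRuns n C₀ C := by
  obtain ⟨u', he, hr, hu'⟩ := h.lift_successful hN hu
  obtain rfl := List.map_injective_iff.2
    ((Option.some_injective _).prodMap Function.injective_id) he
  refine ⟨fun l hl => ?_, hr⟩
  obtain ⟨v, hv, hlv⟩ := hu' l hl
  exact hv.1 l hlv

theorem mop_subNode [CompleteLattice D] (hN : N.SoundDet) (hX : N.LocsReduced (N.dom n))
    (hf : n ≠ N.fin) (h₀ : N.IsFirst n C₀) (h : N.IsLastNode n C₀ C) (sem : Node × R → D → D) :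
    (N.subNode n C₀ C).mop (subSem sem) = sSup (semRun sem '' N.nodeRuns n C₀ C) := by
  have hs := spans_nodeRuns hN hX hf h₀ h
  rw [subNode_eq_span, hs.mop_eq hN fun u hu => mem_nodeRuns_of_successful hN hs hu]

theorem replication_subNode (hN : N.SoundDet) (hX : N.LocsReduced (N.dom n)) (hf : n ≠ N.fin)
    (h₀ : N.IsFirst n C₀) (h : N.IsLastNode n C₀ C) : (N.subNode n C₀ C).Replication := by
  have hs := spans_nodeRuns hN hX hf h₀ h
  rw [subNode_eq_span]
  refine ⟨hs.wellFormed hN, ?_⟩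
  rintro (_ | k) hk a ha
  · simp [span_out_none] at ha
  obtain ⟨ha', v, hv, hmem⟩ := mem_span_out.1 ha
  obtain ⟨v₁, v₂, rfl⟩ := List.append_of_mem hmem
  obtain ⟨E, h1, h2⟩ := run_append_iff.1 hv.2
  obtain ⟨h3, h4, h5⟩ := run_cons_iff.1 h2
  have hr : N.Run C₀ (v₁ ++ [(k, a)]) (N.after E k a) := h1.append (.cons h3 h4 (.nil _))
  obtain ⟨hkX, hj⟩ := hX.run_split hN hv.2 hv.1 h₀.1 h₀.enabled rfl rfl hr
  by_cases hv₂ : v₂ = []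
  · subst hv₂
    obtain rfl := run_nil_iff.1 h5
    refine ⟨none, fun p hp => ?_⟩
    have hp' : p ∈ N.dom k := hkX ▸ hp
    exact ⟨hp', span_δ_of_eq (after_of_mem hp').symm⟩
  · obtain ⟨j, hjf, hjX, hj⟩ := hj hv₂
    refine ⟨some j, fun p hp => ?_⟩
    have hp' : p ∈ N.dom k := hkX ▸ hp
    have hE := h₀.1.run hr
    have hδ : N.δ k a p = {j} := by
      rw [← after_of_mem (N := N) (C := E) hp', hj.eq_singleton hN hE (hjX ▸ hp)]
    refine ⟨hp', ?_⟩
    rw [span_δ_of_ne, hδ, Set.image_singleton]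
    intro he
    refine notMem_last hN h₀ h hE hj hjf hjX (fun q hq => hr.eq_of_notMem
      (fun l hl => hv.1 l (by simp only [List.mem_append, List.mem_cons] at hl ⊢; tauto))
      hq) p ?_
    rw [← he, hδ]
    rfl

/-- Every run to the final configuration that starts in a node with domain `X` can be reordered such
that the part within `X` comes first. -/
theorem LocsReduced.complete (hN : N.SoundDet) (hX : N.LocsReduced X) {E : Config Proc Node}
    (hE : N.Reachable E) {k : Node} (hk : N.Enabled E k) (hkX : N.dom k = X) (hf : k ≠ N.fin)
    {w : List (Node × R)} (hw : N.Run E w N.cFin) :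
    ∃ v w' F, N.TraceEq w (v ++ w') ∧ (∀ l ∈ v, N.dom l.1 ⊆ X) ∧ N.Run E v F ∧ N.Quiet X F := by
  induction hm : w.length using Nat.strong_induction_on generalizing E k w with
  | _ m ih =>
    obtain ⟨b, w₁, ht, hr⟩ := hw.pull_fin hN hE hk hf
    obtain ⟨h1, h2, h3⟩ := run_cons_iff.1 hr
    rcases hX.enabled_or_quiet hE h1 hkX h2 with ⟨j, hjf, hjX, hj⟩ | hq
    · have hlen := ht.perm.length_eq
      rw [List.length_cons] at hlen
      obtain ⟨v, w', F, h4, h5, h6, h7⟩ := ih w₁.length (by omega) (hE.after h1 h2) hj hjX hjf h3 rfl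
      refine ⟨(k, b) :: v, w', F, ht.trans (h4.cons _), fun l hl => ?_, .cons h1 h2 h6, h7⟩
      rcases List.mem_cons.1 hl with rfl | hl
      exacts [hkX.le, h5 l hl]
    · exact ⟨[(k, b)], w₁, _, ht, by simp [hkX], .cons h1 h2 (.nil _), hq⟩

end NodeRuns

section NodeReduct

variable {Proc Node R D : Type*} {N N' : Negotiation Proc Node R} {X : Finset Proc}
  {sem sem' : Node × R → D → D}

/-- `N'` arises from `N` by replacing the outcomes of every node `n ∈ S` by a single one, with
transformer and targets `tab n`. -/
structure NodeReduct (N : Negotiation Proc Node R) (sem : Node × R → D → D) (S : Set Node)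
    (tab : Node → (D → D) × Config Proc Node) (N' : Negotiation Proc Node R)
    (sem' : Node × R → D → D) : Prop where
  procs_eq : N'.procs = N.procs
  nodes_eq : N'.nodes = N.nodes
  dom_eq : N'.dom = N.dom
  init_eq : N'.init = N.init
  fin_eq : N'.fin = N.fin
  of_notMem : ∀ n ∉ S, N'.out n = N.out n ∧ N'.δ n = N.δ n ∧ ∀ a, sem' (n, a) = sem (n, a)
  of_mem : ∀ n ∈ S, ∃ b, N'.out n = {b} ∧ N'.δ n b = (tab n).2 ∧ sem' (n, b) = (tab n).1

theorem NodeReduct.refl (N : Negotiation Proc Node R) (sem : Node × R → D → D)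
    (tab : Node → (D → D) × Config Proc Node) : N.NodeReduct sem ∅ tab N sem :=
  ⟨rfl, rfl, rfl, rfl, rfl, fun _ _ => ⟨rfl, rfl, fun _ => rfl⟩, fun _ h => absurd h (by simp)⟩

theorem NodeReduct.redNode [DecidableEq Node] [DecidableEq R] {S : Set Node}
    {tab : Node → (D → D) × Config Proc Node} (h : N.NodeReduct sem S tab N' sem') (n : Node)
    (b : R) : N.NodeReduct sem (insert n S) tab (N'.redNode n b (tab n).2)
      (Function.update sem' (n, b) (tab n).1) where
  procs_eq := h.procs_eq
  nodes_eq := h.nodes_eq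
  dom_eq := h.dom_eq
  init_eq := h.init_eq
  fin_eq := h.fin_eq
  of_notMem := fun m hm => by
    rw [Set.mem_insert_iff, not_or] at hm
    obtain ⟨h1, h2, h3⟩ := h.of_notMem m hm.2
    refine ⟨by simp [Negotiation.redNode, hm.1, h1], by simp [Negotiation.redNode, hm.1, h2],
      fun a => ?_⟩
    rw [Function.update_of_ne (by simp [hm.1]), h3]
  of_mem := fun m hm => by
    by_cases hmn : m = n
    · subst hmn
      exact ⟨b, by simp [Negotiation.redNode], by simp [Negotiation.redNode], by simp⟩
    · obtain ⟨c, h1, h2, h3⟩ := h.of_mem m (hm.resolve_left hmn)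
      exact ⟨c, by simp [Negotiation.redNode, hmn, h1], by simp [Negotiation.redNode, hmn, h2],
        by rw [Function.update_of_ne (by simp [hmn]), h3]⟩

/-- The entry of the table for the node `n`: the value of `N|ₙ`, and `F(n)`. -/
def IsEntry [CompleteLattice D] (N : Negotiation Proc Node R) (sem : Node × R → D → D) (n : Node)
    (x : (D → D) × Config Proc Node) : Prop :=
  ∃ C₀ C, N.IsFirst n C₀ ∧ N.IsLastNode n C₀ C ∧ x = ((N.subNode n C₀ C).mop (subSem sem), C)

open Classical in
/-- The runs summarized by the locations of a node reduct. -/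
noncomputable def reductRuns (N : Negotiation Proc Node R) (S : Set Node)
    (tab : Node → (D → D) × Config Proc Node) (l : Node × R) : Set (List (Node × R)) :=
  if l.1 ∈ S then {v | ∃ C₀, N.IsFirst l.1 C₀ ∧ v ∈ N.nodeRuns l.1 C₀ (tab l.1).2} else {[l]}

theorem reductRuns_of_mem (hN : N.SoundDet) {S : Set Node}
    {tab : Node → (D → D) × Config Proc Node} {l : Node × R} (hl : l.1 ∈ S)
    {C₀ : Config Proc Node} (h₀ : N.IsFirst l.1 C₀) :
    N.reductRuns S tab l = N.nodeRuns l.1 C₀ (tab l.1).2 := by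
  rw [reductRuns, if_pos hl]
  ext v
  exact ⟨fun ⟨C, h, hv⟩ => h.unique hN h₀ ▸ hv, fun hv => ⟨C₀, h₀, hv⟩⟩

theorem reductRuns_of_notMem {S : Set Node} {tab : Node → (D → D) × Config Proc Node}
    {l : Node × R} (hl : l.1 ∉ S) : N.reductRuns S tab l = {[l]} := if_neg hl

theorem NodeReduct.summary [CompleteLattice D] (hN : N.SoundDet) (hX : N.LocsReduced X)
    {S : Set Node} {tab : Node → (D → D) × Config Proc Node} (hS : S ⊆ N.nodesOn X)
    (htab : ∀ n ∈ S, N.IsEntry sem n (tab n)) (h : N.NodeReduct sem S tab N' sem') :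
    N.Summary sem N' sem' (N.reductRuns S tab) where
  procs_eq := h.procs_eq
  nodes_eq := h.nodes_eq
  dom_eq := h.dom_eq
  init_eq := h.init_eq
  fin_eq := h.fin_eq
  nonempty := fun l _ => by
    by_cases hl : l.1 ∈ S
    · obtain ⟨C₀, C, h₀, hC, he⟩ := htab l.1 hl
      rw [reductRuns_of_mem hN hl h₀, he]
      exact hC.1
    · rw [reductRuns_of_notMem hl]
      exact Set.singleton_nonempty _
  run := fun l hl v hv E hE => by
    by_cases hlS : l.1 ∈ S
    · obtain ⟨C₀, C, h₀, hC, he⟩ := htab l.1 hlS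
      rw [reductRuns_of_mem hN hlS h₀, he] at hv
      obtain ⟨E', h1, h2, h3⟩ := h₀.transfer hv.2 hv.1 (nodeRuns_ne_nil (hS hlS).2.1 h₀ hC hv) hE
      obtain ⟨b, h4, h5, -⟩ := h.of_mem _ hlS
      have hlb : l.2 = b := by have := hl.2; rwa [h4, Finset.mem_singleton] at this
      convert h1 using 1
      funext p
      by_cases hp : p ∈ N.dom l.1
      · rw [after_of_mem (h.dom_eq ▸ hp), h2 p hp, hlb, h5, he]
      · rw [after_of_notMem (h.dom_eq ▸ hp), h3 p hp]
    · rw [reductRuns_of_notMem hlS] at hv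
      obtain rfl : v = [l] := hv
      obtain ⟨h1, h2, -⟩ := h.of_notMem _ hlS
      refine .cons hE (h1 ▸ hl.2) ?_
      convert Run.nil _ using 1
      unfold after
      rw [h.dom_eq, h2]
  ne_nil := fun l _ v hv => by
    by_cases hlS : l.1 ∈ S
    · obtain ⟨C₀, C, h₀, hC, he⟩ := htab l.1 hlS
      rw [reductRuns_of_mem hN hlS h₀, he] at hv
      exact nodeRuns_ne_nil (hS hlS).2.1 h₀ hC hv
    · rw [reductRuns_of_notMem hlS] at hv
      obtain rfl : v = [l] := hv
      simp
  dom_subset := fun l _ v hv => by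
    by_cases hlS : l.1 ∈ S
    · obtain ⟨C₀, C, h₀, hC, he⟩ := htab l.1 hlS
      rw [reductRuns_of_mem hN hlS h₀, he] at hv
      exact hv.1
    · rw [reductRuns_of_notMem hlS] at hv
      obtain rfl : v = [l] := hv
      simp
  sem_eq := fun l hl => by
    by_cases hlS : l.1 ∈ S
    · obtain ⟨C₀, C, h₀, hC, he⟩ := htab l.1 hlS
      obtain ⟨b, h4, -, h5⟩ := h.of_mem _ hlS
      have hlb : l.2 = b := by have := hl.2; rwa [h4, Finset.mem_singleton] at this
      rw [reductRuns_of_mem hN hlS h₀, he]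
      obtain ⟨n, c⟩ := l
      simp only at *
      rw [hlb, h5, he, mop_subNode hN ((hS hlS).2.2 ▸ hX) (hS hlS).2.1 h₀ hC]
    · rw [reductRuns_of_notMem hlS, (h.of_notMem _ hlS).2.2]
      simp [semRun]
  complete := fun E hE w hw hw0 => by
    cases hw with
    | nil => exact absurd rfl hw0
    | @cons _ _ m c w h1 h2 h3 =>
      by_cases hmS : m ∈ S
      · obtain ⟨C₀, C, h₀, hC, he⟩ := htab m hmS
        obtain ⟨hreach, hmf, hmX⟩ := hS hmS
        obtain ⟨v, w', F, h4, h5, h6, h7⟩ := hX.complete hN hE h1 hmX hmf (.cons h1 h2 h3)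
        obtain ⟨b, h8, h9, -⟩ := h.of_mem _ hmS
        refine ⟨(m, b), v, w', ⟨h.nodes_eq ▸ h1.1, by simp [h8]⟩, h1, ?_, h4⟩
        have hv : v ≠ [] := by
          rintro rfl
          obtain rfl := run_nil_iff.1 h6
          exact h7 m h1 hmf hmX.le
        cases h6 with
        | nil => exact absurd rfl hv
        | @cons _ _ k d v g1 g2 g3 =>
          obtain rfl := h1.eq_of_subset hN hE g1 (hmX ▸ h5 _ List.mem_cons_self)
          rw [reductRuns_of_mem hN hmS h₀, he]
          refine ⟨fun l hl => hmX ▸ h5 l hl, .cons h₀.enabled g2 ?_⟩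
          obtain ⟨F', r1, r2, r3⟩ := g3.congr (fun l hl => h5 l (List.mem_cons_of_mem _ hl))
            (E := N.after C₀ k d) fun p hp => by
              rw [after_of_mem (hmX ▸ hp), after_of_mem (hmX ▸ hp)]
          obtain ⟨⟨u, hu, hru⟩, hq⟩ := hC
          have hF' := (h₀.1.after h₀.enabled g2).run r1
          rwa [← Quiet.unique hN hF' (h₀.1.run hru) (h7.congr r2) (hmX ▸ hq) fun p hp => by
            rw [r3 p hp, hru.eq_of_notMem hu (hmX ▸ hp), after_of_notMem (hmX ▸ hp)]]
      · refine ⟨(m, c), [(m, c)], w, ⟨h.nodes_eq ▸ h1.1, ?_⟩, h1, ?_, .refl _⟩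
        · rw [(h.of_notMem m hmS).1]; exact h2
        · rw [reductRuns_of_notMem hmS]; rfl

end NodeReduct

end Negotiation

open Negotiation

namespace Negotiation

/-! ## Invariants of the reduction algorithm -/

section Invariant

variable {Proc Node R D : Type*} [CompleteLattice D]

/-- `N` is sound and deterministic, `sem` is a Mazurkiewicz-invariant analysis framework, and the
merge over all paths is `f`. -/
structure Valid (N : Negotiation Proc Node R) (sem : Node × R → D → D) (f : D → D) : Prop where
  soundDet : N.SoundDet
  framework : N.IsFramework sem
  invariant : N.MazurkiewiczInvariant sem
  mop_eq : N.mop sem = f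

variable {N N' : Negotiation Proc Node R} {sem sem' : Node × R → D → D} {f : D → D}
  {X : Finset Proc}

theorem Summary.valid {V : Node × R → Set (List (Node × R))} (h : N.Summary sem N' sem' V)
    (hN : N.Valid sem f) (hout : ∀ n ∈ N.nodes, n ≠ N.fin → (N'.out n).Nonempty)
    (hfin : N'.out N.fin = ∅) : N'.Valid sem' f :=
  ⟨h.soundDet hN.soundDet hN.framework hN.invariant hout hfin, h.isFramework hN.framework,
    h.mazurkiewiczInvariant hN.framework hN.invariant,
    (h.mop_eq hN.framework hN.invariant).trans hN.mop_eq⟩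

omit [CompleteLattice D] in
theorem locallyReduced_congr (h1 : N'.nodes = N.nodes) (h2 : N'.dom = N.dom) (h3 : N'.fin = N.fin)
    {k : Node} (ho : N'.out k = N.out k) (hδ : N'.δ k = N.δ k) :
    N'.LocallyReduced k ↔ N.LocallyReduced k := by
  unfold LocallyReduced
  rw [h1, h2, h3, ho, hδ]

/-- The number of non-reduced nodes. -/
noncomputable def numNonReduced (N : Negotiation Proc Node R) : ℕ := {k | N.NonReduced k}.ncard

/-- The number of non-reduced nodes with a domain other than `X`. -/
noncomputable def numNonReducedOff (N : Negotiation Proc Node R) (X : Finset Proc) : ℕ :=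
  {k | N.NonReduced k ∧ N.dom k ≠ X}.ncard

theorem finite_nonReduced (N : Negotiation Proc Node R) : {k | N.NonReduced k}.Finite :=
  N.nodes.finite_toSet.subset fun _ hk => hk.1.mem

theorem finite_nodesOn (N : Negotiation Proc Node R) (X : Finset Proc) : (N.nodesOn X).Finite :=
  N.nodes.finite_toSet.subset fun _ hk => hk.1.mem

theorem finite_locsOn (N : Negotiation Proc Node R) (X : Finset Proc) : (N.locsOn X).Finite := by
  classical
  refine (Finset.finite_toSet (N.nodes.sigma N.out)).image (fun x => (x.1, x.2)) |>.subset ?_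
  rintro ⟨n, a⟩ ⟨h1, h2⟩
  exact ⟨⟨n, a⟩, by simpa using ⟨h1.1.mem, h2⟩, rfl⟩

/-- The locations of nodes with domain `X` that are not in `todo` are reduced. -/
def DoneLocs (N : Negotiation Proc Node R) (X : Finset Proc) (todo : Set (Node × R)) : Prop :=
  ∀ l ∈ N.locsOn X, l ∉ todo → ∀ j ∈ N.nodes, N.dom j ⊂ X → ¬ ∀ p ∈ N.dom j, j ∈ N.δ l.1 l.2 p

omit [CompleteLattice D] in
theorem DoneLocs.locsReduced (hN : N.SoundDet) (h : N.DoneLocs X ∅) : N.LocsReduced X :=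
  fun k hk hkX b hb => h (k, b) ⟨⟨hk, hN.ne_fin_of_mem_out hb, hkX⟩, hb⟩ (by simp)

/-- The invariant of the first for-loop. -/
structure InForLoc (N : Negotiation Proc Node R) (sem : Node × R → D → D) (f : D → D)
    (X : Finset Proc) (todo : Set (Node × R)) : Prop extends N.Valid sem f where
  reducedBelow : N.ReducedBelow X
  todo_subset : todo ⊆ N.locsOn X
  done : N.DoneLocs X todo

/-- The invariant of the second for-loop. -/
structure InForVal (N : Negotiation Proc Node R) (sem : Node × R → D → D) (f : D → D)
    (X : Finset Proc) (todo : Set Node) (tab : Node → (D → D) × Config Proc Node) : Prop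
    extends N.Valid sem f where
  locsReduced : N.LocsReduced X
  todo_subset : todo ⊆ N.nodesOn X
  entry : ∀ n ∈ N.nodesOn X, n ∉ todo → N.IsEntry sem n (tab n)

/-- The invariant of the third for-loop, which starts with the diagram `N₁`. -/
structure InForRed (N₁ : Negotiation Proc Node R) (sem₁ : Node × R → D → D) (f : D → D)
    (X : Finset Proc) (N : Negotiation Proc Node R) (sem : Node × R → D → D) (todo : Set Node)
    (tab : Node → (D → D) × Config Proc Node) : Prop extends
    N₁.InForVal sem₁ f X ∅ tab where
  todo_subset' : todo ⊆ N₁.nodesOn X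
  reduct : N₁.NodeReduct sem₁ (N₁.nodesOn X \ todo) tab N sem

theorem nonReduced_iff (hN : N.SoundDet) {k : Node} :
    N.NonReduced k ↔ N.ReachableNode k ∧ k ≠ N.fin ∧ ¬ N.LocallyReduced k := by
  unfold NonReduced
  refine and_congr_right fun h1 => and_congr_right fun h2 => not_congr (reducedNode_iff hN h1 h2)

theorem Valid.enter (h : N.Valid sem f) {m : Node}
    (hmin : ∀ m', N.NonReduced m' → ¬ N.dom m' ⊂ N.dom m) (hm : N.ReachableNode m) :
    N.InForLoc sem f (N.dom m) (N.locsOn (N.dom m)) where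
  toValid := h
  reducedBelow := fun k hk hd => by
    by_contra hcon
    refine hmin k ((nonReduced_iff h.soundDet).2 ⟨hk, ?_, hcon⟩) hd
    rintro rfl
    exact (h.soundDet.wf.dom_fin ▸ hd).not_subset (h.soundDet.wf.dom_subset m hm.mem)
  todo_subset := subset_rfl
  done := fun l hl hl' => absurd hl hl'

section RedLoc

variable [DecidableEq Node] [DecidableEq R] {todo : Set (Node × R)} {n : Node} {a b : R}
  {C₀ C : Config Proc Node}

theorem redLoc_out_of_ne {m : Node} (h : m ≠ n) : (N.redLoc n a b C).out m = N.out m := by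
  simp [redLoc, h]

theorem redLoc_δ_of_ne {m : Node} (h : m ≠ n) : (N.redLoc n a b C).δ m = N.δ m := by
  simp [redLoc, h]

theorem redLoc_out_self : (N.redLoc n a b C).out n = insert b ((N.out n).erase a) := by
  simp [redLoc]

theorem redLoc_δ_self : (N.redLoc n a b C).δ n b = C := by
  simp [redLoc]

theorem redLoc_δ_of_ne' {c : R} (h : c ≠ b) : (N.redLoc n a b C).δ n c = N.δ n c := by
  simp [redLoc, h]

theorem InForLoc.summary (h : N.InForLoc sem f X todo) (hl : (n, a) ∈ todo) (h₀ : N.IsFirst n C₀)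
    (hC : N.IsLastLoc n a C₀ C) (hb : b ∉ (N.out n).erase a) :
    ∃ V, N.Summary sem (N.redLoc n a b C)
      (Function.update sem (n, b) ((N.subLoc n a C₀ C).mop (subSem sem))) V ∧
      ∀ l, ∀ v ∈ V l, ∀ x ∈ v, x.1 = l.1 ∨ N.dom x.1 ⊂ X := by
  have hX : N.dom n = X := (h.todo_subset hl).1.2.2
  refine ⟨_, summary_redLoc h.soundDet (hX ▸ h.reducedBelow) h₀ hC sem hb, fun l v hv x hx => ?_⟩
  split_ifs at hv with hlb
  · subst hlb
    obtain ⟨u, rfl, hu, -⟩ := hv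
    rcases List.mem_cons.1 hx with rfl | hx
    exacts [.inl rfl, .inr (hX ▸ hu x hx)]
  · obtain rfl : v = [l] := hv
    obtain rfl : x = l := by simpa using hx
    exact .inl rfl

theorem InForLoc.step (h : N.InForLoc sem f X todo) (hl : (n, a) ∈ todo) (h₀ : N.IsFirst n C₀)
    (hC : N.IsLastLoc n a C₀ C) (hb : b ∉ (N.out n).erase a) :
    (N.redLoc n a b C).InForLoc
      (Function.update sem (n, b) ((N.subLoc n a C₀ C).mop (subSem sem))) f X (todo \ {(n, a)}) ∧
    (N.redLoc n a b C).nodesOn X = N.nodesOn X ∧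
    (∀ k, (N.redLoc n a b C).ReachableNode k → N.ReachableNode k) ∧
    ∀ k, (N.redLoc n a b C).NonReduced k → N.dom k ≠ X → N.NonReduced k := by
  obtain ⟨V, hV, hVX⟩ := h.summary hl h₀ hC hb
  obtain ⟨⟨hnr, hnf, hX⟩, hna⟩ := h.todo_subset hl
  simp only at hnr hnf hX hna
  have hval := hV.valid h.toValid (fun m hm hmf => by
      by_cases hmn : m = n
      · subst hmn; rw [redLoc_out_self]; exact ⟨b, Finset.mem_insert_self _ _⟩
      · rw [redLoc_out_of_ne hmn]; exact h.soundDet.wf.out_nonempty m hm hmf)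
    (by rw [redLoc_out_of_ne (Ne.symm hnf), h.soundDet.wf.out_fin])
  have hnodes : (N.redLoc n a b C).nodesOn X = N.nodesOn X := by
    ext k
    constructor
    · rintro ⟨h1, h2, h3⟩
      exact ⟨hV.reachableNode h1, h2, h3⟩
    · rintro ⟨h1, h2, h3⟩
      refine ⟨hV.reachableNode_of h.soundDet h.framework h.invariant h1 h2 ?_, h2, h3⟩
      rintro l - v hv x hx rfl
      rcases hVX l v hv x hx with h4 | h4
      exacts [h4.symm, absurd h3 h4.ne]
  refine ⟨⟨hval, fun k hk hd => ?_, ?_, ?_⟩, hnodes, fun k => hV.reachableNode, fun k hk hkX => ?_⟩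
  · have hkn : k ≠ n := by rintro rfl; exact hd.ne hX
    rw [locallyReduced_congr (N := N) (N' := N.redLoc n a b C) rfl rfl rfl (redLoc_out_of_ne hkn) (redLoc_δ_of_ne hkn)]
    exact h.reducedBelow k (hV.reachableNode hk) hd
  · rintro ⟨m, c⟩ ⟨hmc, hne⟩
    obtain ⟨h1, h2⟩ := h.todo_subset hmc
    refine ⟨hnodes ▸ h1, ?_⟩
    simp only at h2
    by_cases hmn : m = n
    · subst hmn
      have hca : c ≠ a := by rintro rfl; exact hne rfl
      rw [redLoc_out_self]
      exact Finset.mem_insert_of_mem (Finset.mem_erase.2 ⟨hca, h2⟩)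
    · rw [redLoc_out_of_ne hmn]; exact h2
  · rintro ⟨m, c⟩ ⟨h1, h2⟩ hmc j hj hjX
    rw [hnodes] at h1
    simp only at h1 h2 ⊢
    by_cases hmn : m = n
    · subst hmn
      by_cases hcb : c = b
      · subst hcb
        rw [redLoc_δ_self]
        exact fun hall => hC.2 j ⟨hj, hall⟩ (hX ▸ hjX)
      · rw [redLoc_out_self, Finset.mem_insert, Finset.mem_erase] at h2
        rw [redLoc_δ_of_ne' hcb]
        have h2 := h2.resolve_left hcb
        exact h.done (m, c) ⟨h1, h2.2⟩ (fun hm => hmc ⟨hm, fun he => h2.1 (Prod.ext_iff.1 he).2⟩)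
          j hj hjX
    · rw [redLoc_out_of_ne hmn] at h2
      rw [redLoc_δ_of_ne hmn]
      exact h.done (m, c) ⟨h1, h2⟩ (fun hm => hmc ⟨hm, fun he => hmn (Prod.ext_iff.1 he).1⟩) j hj hjX
  · have hkn : k ≠ n := by rintro rfl; exact hkX hX
    rw [nonReduced_iff hval.soundDet,
      locallyReduced_congr (N := N) (N' := N.redLoc n a b C) rfl rfl rfl (redLoc_out_of_ne hkn) (redLoc_δ_of_ne hkn)] at hk
    exact (nonReduced_iff h.soundDet).2 ⟨hV.reachableNode hk.1, hk.2⟩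

end RedLoc

theorem InForLoc.locsDone (h : N.InForLoc sem f X ∅) (tab : Node → (D → D) × Config Proc Node) :
    N.InForVal sem f X (N.nodesOn X) tab :=
  ⟨h.toValid, h.done.locsReduced h.soundDet, subset_rfl, fun _ hn hn' => absurd hn hn'⟩

theorem InForVal.step [DecidableEq Node] {todo : Set Node}
    {tab : Node → (D → D) × Config Proc Node} (h : N.InForVal sem f X todo tab) {n : Node}
    {x : (D → D) × Config Proc Node} (hx : N.IsEntry sem n x) :
    N.InForVal sem f X (todo \ {n}) (Function.update tab n x) :=
  ⟨h.toValid, h.locsReduced, Set.sdiff_subset.trans h.todo_subset, fun m hm hm' => by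
    by_cases hmn : m = n
    · subst hmn; rwa [Function.update_self]
    · rw [Function.update_of_ne hmn]
      exact h.entry m hm fun hcon => hm' ⟨hcon, hmn⟩⟩

theorem InForVal.valuesDone {tab : Node → (D → D) × Config Proc Node}
    (h : N.InForVal sem f X ∅ tab) : InForRed N sem f X N sem (N.nodesOn X) tab :=
  ⟨h, subset_rfl, by rw [Set.sdiff_self]; exact .refl _ _ _⟩

theorem InForRed.step [DecidableEq Node] [DecidableEq R] {todo : Set Node}
    {tab : Node → (D → D) × Config Proc Node} (h : InForRed N sem f X N' sem' todo tab) {n : Node}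
    (hn : n ∈ todo) (b : R) : InForRed N sem f X (N'.redNode n b (tab n).2)
      (Function.update sem' (n, b) (tab n).1) (todo \ {n}) tab := by
  refine ⟨h.toInForVal, Set.sdiff_subset.trans h.todo_subset', ?_⟩
  have := h.reduct.redNode n b
  convert this using 1
  ext k
  simp only [Set.mem_sdiff, Set.mem_singleton_iff, Set.mem_insert_iff]
  have := @h.todo_subset' n hn
  grind

theorem InForRed.summary {todo : Set Node} {tab : Node → (D → D) × Config Proc Node}
    (h : InForRed N sem f X N' sem' todo tab) :
    N.Summary sem N' sem' (N.reductRuns (N.nodesOn X \ todo) tab) :=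
  h.reduct.summary h.soundDet h.locsReduced Set.sdiff_subset fun n hn => h.entry n hn.1 (by simp)

theorem InForRed.nodesDone {tab : Node → (D → D) × Config Proc Node}
    (h : InForRed N sem f X N' sem' ∅ tab) :
    N'.Valid sem' f ∧ (∀ k, N'.ReachableNode k → N.ReachableNode k) ∧
    ∀ k, N'.NonReduced k → N.NonReduced k ∧ N.dom k ≠ X := by
  have hV := h.summary
  have hval := hV.valid h.toValid (fun m hm hmf => by
      by_cases hmS : m ∈ N.nodesOn X \ ∅
      · obtain ⟨b, hb, -⟩ := h.reduct.of_mem m hmS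
        rw [hb]; exact Finset.singleton_nonempty b
      · rw [(h.reduct.of_notMem m hmS).1]; exact h.soundDet.wf.out_nonempty m hm hmf)
    (by rw [(h.reduct.of_notMem _ fun hf => hf.1.2.1 rfl).1, h.soundDet.wf.out_fin])
  refine ⟨hval, fun k => hV.reachableNode, fun k hk => ?_⟩
  rw [nonReduced_iff hval.soundDet, hV.fin_eq] at hk
  obtain ⟨h1, h2, h3⟩ := hk
  have hkr := hV.reachableNode h1
  have hkX : N.dom k ≠ X := by
    intro hkX
    obtain ⟨b, g1, g2, -⟩ := h.reduct.of_mem k ⟨⟨hkr, h2, hkX⟩, by simp⟩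
    obtain ⟨C₀, C, h₀, hC, he⟩ := h.entry k ⟨hkr, h2, hkX⟩ (by simp)
    refine h3 ⟨b, g1, fun j hj hjf hjd hall => ?_⟩
    rw [hV.nodes_eq] at hj
    rw [hV.fin_eq] at hjf
    rw [hV.dom_eq] at hjd hall
    rw [g2, he] at hall
    exact hC.2 j ⟨hj, hall⟩ hjf hjd
  refine ⟨(nonReduced_iff h.soundDet).2 ⟨hkr, h2, ?_⟩, hkX⟩
  have hkS : k ∉ N.nodesOn X \ ∅ := fun hcon => hkX hcon.1.2.2
  obtain ⟨g1, g2, -⟩ := h.reduct.of_notMem k hkS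
  rwa [locallyReduced_congr hV.nodes_eq hV.dom_eq hV.fin_eq g1 g2] at h3

/-- The output of the algorithm. -/
theorem Valid.output (h : N.Valid sem f) {a : R} (hr : ∀ n, ¬ N.NonReduced n)
    (ha : N.out N.init = {a}) : sem (N.init, a) = f := by
  have hN := h.soundDet
  have hen : ∀ k, N.Enabled N.cInit k → k = N.init := fun k hk => by
    obtain ⟨p, hp⟩ := hN.wf.dom_nonempty k hk.1
    exact (hk.2 p hp).2
  have hinit : N.Enabled N.cInit N.init :=
    ⟨hN.wf.init_mem, fun p hp => ⟨hN.wf.dom_init ▸ hp, rfl⟩⟩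
  have hred : N.LocallyReduced N.init := by
    by_contra hcon
    exact hr _ ((nonReduced_iff hN).2 ⟨hN.reachableNode_init, hN.wf.init_ne_fin, hcon⟩)
  obtain ⟨a', ha', hl⟩ := hred
  obtain rfl : a = a' := by rwa [ha, Finset.singleton_inj] at ha'
  have hmem : a ∈ N.out N.init := by simp [ha]
  have hfin : N.after N.cInit N.init a = N.cFin := by
    by_contra hne
    obtain ⟨k, hk, hkf⟩ := (reachable_cInit.after hinit hmem).progress hN hne
    have hkd : N.dom k ⊆ N.dom N.init := hN.wf.dom_init ▸ hN.wf.dom_subset k hk.1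
    refine hl k hk.1 hkf hkd fun p hp => ?_
    rw [← after_of_mem (N := N) (C := N.cInit) (hkd hp)]
    exact hk.2 p hp
  rw [← h.mop_eq, mop]
  have : {f | ∃ w, N.Successful w ∧ f = semRun sem w} = {sem (N.init, a)} := by
    ext g
    constructor
    · rintro ⟨w, hw, rfl⟩
      have hne : N.cInit ≠ N.cFin := fun he => by
        rw [he] at hinit
        exact hN.wf.init_ne_fin (enabled_cFin hN.wf hinit)
      rcases w with _ | ⟨⟨n, c⟩, w⟩
      · exact absurd (run_nil_iff.1 hw) hne
      · obtain ⟨h1, h2, h3⟩ := run_cons_iff.1 hw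
        obtain rfl := hen n h1
        rw [ha, Finset.mem_singleton] at h2
        subst h2
        rw [hfin] at h3
        cases h3 with
        | nil => rfl
        | cons h4 h5 _ => exact absurd (enabled_cFin hN.wf h4) (hN.ne_fin_of_mem_out h5)
    · rintro rfl
      exact ⟨[(N.init, a)], .cons hinit hmem (hfin ▸ .nil _), rfl⟩
  rw [this, sSup_singleton]

end Invariant

end Negotiation

/-! ## Termination and correctness of the algorithm -/

section Algorithm

variable {Proc Node R D : Type*} [CompleteLattice D]

/-- The invariant of the algorithm, with the value of a quantity that decreases in every step. -/
def AlgInv (f : D → D) : AlgState Proc Node R D → ℕ ×ₗ ℕ ×ₗ ℕ → Prop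
  | .head N sem, x => N.Valid sem f ∧ x = toLex (N.numNonReduced, toLex (4, 0))
  | .forLoc N sem X todo, x => N.InForLoc sem f X todo ∧
      ∃ c, N.numNonReducedOff X < c ∧ x = toLex (c, toLex (3, todo.ncard))
  | .forVal N sem X todo tab, x => N.InForVal sem f X todo tab ∧
      ∃ c, N.numNonReducedOff X < c ∧ x = toLex (c, toLex (2, todo.ncard))
  | .forRed N sem todo tab, x => ∃ N₁ sem₁ X, InForRed N₁ sem₁ f X N sem todo tab ∧
      ∃ c, N₁.numNonReducedOff X < c ∧ x = toLex (c, toLex (1, todo.ncard))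
  | .done g, _ => g = f

theorem lex_lt_snd {c i i' j j' : ℕ} (h : i < i') :
    (toLex (c, toLex (i, j)) : ℕ ×ₗ ℕ ×ₗ ℕ) < toLex (c, toLex (i', j')) := by
  simp [Prod.Lex.toLex_lt_toLex, h]

theorem lex_lt_trd {c i j j' : ℕ} (h : j < j') :
    (toLex (c, toLex (i, j)) : ℕ ×ₗ ℕ ×ₗ ℕ) < toLex (c, toLex (i, j')) := by
  simp [Prod.Lex.toLex_lt_toLex, h]

theorem lex_lt_fst {c c' i i' j j' : ℕ} (h : c < c') :
    (toLex (c, toLex (i, j)) : ℕ ×ₗ ℕ ×ₗ ℕ) < toLex (c', toLex (i', j')) := by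
  simp [Prod.Lex.toLex_lt_toLex, h]

variable [DecidableEq Node] [DecidableEq R]

theorem AlgInv.step {f : D → D} {s s' : AlgState Proc Node R D} {x : ℕ ×ₗ ℕ ×ₗ ℕ}
    (h : AlgInv f s x) (hs : AlgStep s s') :
    (∃ y < x, AlgInv f s' y) ∨ ∃ g, s' = .done g ∧ g = f := by
  cases hs with
  | @enter N sem m h1 h2 =>
    obtain ⟨hv, rfl⟩ := h
    refine .inl ⟨_, lex_lt_snd (by norm_num), hv.enter h2 h1.1, _, ?_, rfl⟩
    exact Set.ncard_lt_ncard ⟨fun k hk => hk.1, fun hcon => (hcon h1).2 rfl⟩ N.finite_nonReduced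
  | @reduceLoc N sem X todo n a b C₀ C h1 h2 h3 h4 =>
    obtain ⟨hv, c, hc, rfl⟩ := h
    obtain ⟨g1, -, -, g2⟩ := hv.step h1 h2 h3 h4
    refine .inl ⟨_, lex_lt_trd ?_, g1, c, lt_of_le_of_lt ?_ hc, rfl⟩
    · exact Set.ncard_sdiff_singleton_lt_of_mem h1 ((N.finite_locsOn X).subset hv.todo_subset)
    · exact Set.ncard_le_ncard (fun k hk => ⟨g2 k hk.1 hk.2, hk.2⟩)
        (N.finite_nonReduced.subset fun k hk => hk.1)
  | @locsDone N sem X =>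
    obtain ⟨hv, c, hc, rfl⟩ := h
    exact .inl ⟨_, lex_lt_snd (by norm_num), hv.locsDone _, c, hc, rfl⟩
  | @value N sem X todo tab n C₀ C h1 h2 h3 =>
    obtain ⟨hv, c, hc, rfl⟩ := h
    refine .inl ⟨_, lex_lt_trd ?_, hv.step ⟨C₀, C, h2, h3, rfl⟩, c, hc, rfl⟩
    exact Set.ncard_sdiff_singleton_lt_of_mem h1 ((N.finite_nodesOn X).subset hv.todo_subset)
  | @valuesDone N sem X tab =>
    obtain ⟨hv, c, hc, rfl⟩ := h
    exact .inl ⟨_, lex_lt_snd (by norm_num), N, sem, X, hv.valuesDone, c, hc, rfl⟩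
  | @reduceNode N sem todo tab n b h1 =>
    obtain ⟨N₁, sem₁, X, hv, c, hc, rfl⟩ := h
    refine .inl ⟨_, lex_lt_trd ?_, N₁, sem₁, X, hv.step h1 b, c, hc, rfl⟩
    exact Set.ncard_sdiff_singleton_lt_of_mem h1 ((N₁.finite_nodesOn X).subset hv.todo_subset')
  | @nodesDone N sem tab =>
    obtain ⟨N₁, sem₁, X, hv, c, hc, rfl⟩ := h
    obtain ⟨g1, -, g2⟩ := hv.nodesDone
    refine .inl ⟨_, lex_lt_fst (lt_of_le_of_lt ?_ hc), g1, rfl⟩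
    exact Set.ncard_le_ncard g2 (N₁.finite_nonReduced.subset fun k hk => hk.1)
  | @output N sem a h1 h2 =>
    exact .inr ⟨_, rfl, h.1.output h1 h2⟩

theorem not_algStep_done {g : D → D} {s : AlgState Proc Node R D} : ¬ AlgStep (.done g) s := by
  intro h
  cases h

theorem AlgInv.no_infinite {f : D → D} {s : ℕ → AlgState Proc Node R D} {x : ℕ ×ₗ ℕ ×ₗ ℕ}
    (h : AlgInv f (s 0) x) : ¬ ∀ i, AlgStep (s i) (s (i + 1)) := by
  induction x using WellFoundedLT.induction generalizing s with
  | _ x ih =>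
    intro hs
    rcases h.step (hs 0) with ⟨y, hy, hi⟩ | ⟨g, hg, -⟩
    · exact ih y hy (s := fun i => s (i + 1)) hi fun i => hs (i + 1)
    · have := hs 1
      rw [hg] at this
      exact not_algStep_done this

theorem AlgInv.reach {f : D → D} {s s' : AlgState Proc Node R D} (h : ∃ x, AlgInv f s x)
    (hs : Relation.ReflTransGen AlgStep s s') : ∃ x, AlgInv f s' x := by
  induction hs with
  | refl => exact h
  | tail _ hs ih =>
    obtain ⟨x, hx⟩ := ih
    rcases hx.step hs with ⟨y, -, hy⟩ | ⟨g, rfl, hg⟩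
    exacts [⟨y, hy⟩, ⟨x, hg⟩]

theorem AlgInv.progress {f : D → D} {s : AlgState Proc Node R D} {x : ℕ ×ₗ ℕ ×ₗ ℕ}
    (h : AlgInv f s x) : (∃ g, s = .done g) ∨ ∃ s', AlgStep s s' := by
  cases s with
  | done g => exact .inl ⟨g, rfl⟩
  | head N sem =>
    refine .inr ?_
    obtain ⟨hv, -⟩ := h
    by_cases hne : ∃ m, N.NonReduced m
    · obtain ⟨m, hm, hmin⟩ := N.finite_nonReduced.exists_minimalFor (fun k => N.dom k) _ hne
      exact ⟨_, .enter m hm fun m' hm' hlt => hlt.not_subset (hmin hm' hlt.subset)⟩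
    · push Not at hne
      have hinit : N.LocallyReduced N.init := by
        by_contra hcon
        exact hne _ ((nonReduced_iff hv.soundDet).2
          ⟨hv.soundDet.reachableNode_init, hv.soundDet.wf.init_ne_fin, hcon⟩)
      obtain ⟨a, ha, -⟩ := hinit
      exact ⟨_, .output a hne ha⟩
  | forLoc N sem X todo =>
    refine .inr ?_
    obtain ⟨hv, -⟩ := h
    rcases todo.eq_empty_or_nonempty with rfl | ⟨⟨n, a⟩, hna⟩
    · exact ⟨_, .locsDone⟩
    · obtain ⟨⟨h1, h2, -⟩, h3⟩ := hv.todo_subset hna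
      obtain ⟨C₀, h₀⟩ := h1.exists_isFirst hv.soundDet h2
      obtain ⟨C, hC⟩ := h₀.exists_isLastLoc hv.soundDet h3
      exact ⟨_, .reduceLoc n a a C₀ C hna h₀ hC (Finset.notMem_erase _ _)⟩
  | forVal N sem X todo tab =>
    refine .inr ?_
    obtain ⟨hv, -⟩ := h
    rcases todo.eq_empty_or_nonempty with rfl | ⟨n, hn⟩
    · exact ⟨_, .valuesDone⟩
    · obtain ⟨h1, h2, -⟩ := hv.todo_subset hn
      obtain ⟨C₀, h₀⟩ := h1.exists_isFirst hv.soundDet h2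
      obtain ⟨C, hC⟩ := h₀.exists_isLastNode hv.soundDet
      exact ⟨_, .value n C₀ C hn h₀ hC⟩
  | forRed N sem todo tab =>
    refine .inr ?_
    obtain ⟨N₁, sem₁, X, hv, -⟩ := h
    rcases todo.eq_empty_or_nonempty with rfl | ⟨n, hn⟩
    · exact ⟨_, .nodesDone⟩
    · obtain ⟨h1, h2, -⟩ := hv.todo_subset' hn
      obtain ⟨b, -⟩ := hv.soundDet.wf.out_nonempty n h1.mem h2
      exact ⟨_, .reduceNode n b hn⟩

end Algorithm

namespace Timed

/-! ## Timed computations -/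

variable {α β σ : Type*}

@[simp] theorem val_step (x : α) : (step x).val = x := rfl

@[simp] theorem time_step (x : α) : (step x).time = 1 := rfl

@[simp] theorem val_charge (k : ℕ) (x : Timed α) : (charge k x).val = x.val := rfl

@[simp] theorem time_charge (k : ℕ) (x : Timed α) : (charge k x).time = k + x.time := rfl

@[simp] theorem val_bind (x : Timed α) (f : α → Timed β) : (x.bind f).val = (f x.val).val := rfl

@[simp] theorem time_bind (x : Timed α) (f : α → Timed β) :
    (x.bind f).time = x.time + (f x.val).time := rfl

/-- Loop invariants, with amortized costs: the last argument of the invariant is the budget. -/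
theorem forIn_amortized (f : σ → α → Timed σ) (I : List α → σ → ℕ → Prop) (c : α → ℕ)
    (h : ∀ x l s b, I (x :: l) s b → ∃ b', I l (f s x).val b' ∧ (f s x).time + b' ≤ b + c x)
    (l : List α) (s : σ) (b : ℕ) (hI : I l s b) : ∃ b', I [] (forIn f l s).val b' ∧
      (forIn f l s).time + b' ≤ b + 1 + (l.map fun x => 1 + c x).sum := by
  induction l generalizing s b with
  | nil => exact ⟨b, hI, by simp [forIn]; omega⟩
  | cons x l ih =>
    obtain ⟨b₁, h1, h2⟩ := h x l s b hI
    obtain ⟨b₂, h3, h4⟩ := ih _ _ h1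
    refine ⟨b₂, h3, ?_⟩
    simp only [forIn, time_charge, time_bind, List.map_cons, List.sum_cons]
    omega

/-- Loop invariants, with costs. -/
theorem forIn_spec (f : σ → α → Timed σ) (I : List α → σ → Prop) (c : α → ℕ)
    (h : ∀ x l s, I (x :: l) s → I l (f s x).val ∧ (f s x).time ≤ c x)
    (l : List α) (s : σ) (hI : I l s) : I [] (forIn f l s).val ∧
      (forIn f l s).time ≤ 1 + (l.map fun x => 1 + c x).sum := by
  obtain ⟨b, h1, h2⟩ := forIn_amortized f (fun l s _ => I l s) c
    (fun x l s b hx => ⟨b, (h x l s hx).1, by have := (h x l s hx).2; omega⟩) l s 0 hI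
  exact ⟨h1, by omega⟩

end Timed

namespace Tables

variable {Proc Node R D : Type*} [DecidableEq Proc] [DecidableEq Node] [DecidableEq R]
  {T : Tables Proc Node R D} {N : Negotiation Proc Node R} {sem : Node × R → D → D}

/-! ## Tables -/

theorem sum_map_const {α : Type*} (l : List α) (c : ℕ) : (l.map fun _ => c).sum = l.length * c := by
  simp

theorem sum_map_le_sum {α : Type*} [DecidableEq α] {l : List α} (hl : l.Nodup) {s : Finset α}
    (hs : ∀ x ∈ l, x ∈ s) (f : α → ℕ) : (l.map f).sum ≤ ∑ x ∈ s, f x := by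
  rw [← List.sum_toFinset f hl]
  exact Finset.sum_le_sum_of_subset fun x hx => hs x (List.mem_toFinset.1 hx)

theorem Represents.length_dom (h : T.Represents N sem) {n : Node} (hn : n ∈ N.nodes) :
    (T.dom n).length = (N.dom n).card := by
  rw [← List.toFinset_card_of_nodup (h.dom_nodup n hn)]
  congr 1
  ext p
  simp [h.mem_dom n hn]

theorem Represents.length_out (h : T.Represents N sem) {n : Node} (hn : n ∈ N.nodes) :
    (T.out n).length = (N.out n).card := by
  rw [← List.toFinset_card_of_nodup (h.out_nodup n hn)]
  congr 1
  ext p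
  simp [h.mem_out n hn]

theorem Represents.length_nodes (h : T.Represents N sem) : T.nodes.length = N.nodes.card := by
  rw [← List.toFinset_card_of_nodup h.nodes_nodup]
  congr 1
  ext p
  simp [h.mem_nodes]

theorem size_eq (N : Negotiation Proc Node R) :
    N.size = ∑ n ∈ N.nodes, (N.dom n).card * (1 + (N.out n).card) :=
  Finset.sum_congr rfl fun _ _ => by ring

theorem sum_lt_size (hN : N.SoundDet) {s : Finset Node} (hs : s ⊆ N.nodes) (hf : N.fin ∉ s) :
    ∑ n ∈ s, (N.dom n).card * (1 + (N.out n).card) + 1 ≤ N.size := by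
  rw [size_eq]
  have h1 : insert N.fin s ⊆ N.nodes := Finset.insert_subset hN.wf.fin_mem hs
  refine le_trans ?_ (Finset.sum_le_sum_of_subset h1)
  rw [Finset.sum_insert hf]
  have := Finset.card_pos.2 (hN.wf.dom_nonempty _ hN.wf.fin_mem)
  have := Nat.mul_pos this (show 0 < 1 + (N.out N.fin).card by omega)
  omega

theorem sum_le_mul_size {f : Node → ℕ} {c : ℕ}
    (hf : ∀ n ∈ N.nodes, f n ≤ c * ((N.dom n).card * (1 + (N.out n).card))) :
    ∑ n ∈ N.nodes, f n ≤ c * N.size := by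
  rw [size_eq, Finset.mul_sum]
  exact Finset.sum_le_sum hf

theorem one_le_card_dom (hN : N.SoundDet) {n : Node} (hn : n ∈ N.nodes) : 1 ≤ (N.dom n).card :=
  Finset.card_pos.2 (hN.wf.dom_nonempty n hn)

theorem card_nodes_le (hN : N.SoundDet) : N.nodes.card ≤ N.size := by
  rw [Finset.card_eq_sum_ones]
  refine (sum_le_mul_size (c := 1) fun n hn => ?_).trans (one_mul _).le
  have := one_le_card_dom hN hn
  nlinarith

theorem card_dom_le {n : Node} (hn : n ∈ N.nodes) :
    (N.dom n).card * (1 + (N.out n).card) ≤ N.size := by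
  rw [size_eq]
  exact Finset.single_le_sum (f := fun n => (N.dom n).card * (1 + (N.out n).card))
    (fun _ _ => Nat.zero_le _) hn

theorem blankCost_le (hN : N.SoundDet) (h : T.Represents N sem) : T.blankCost ≤ 2 * N.size := by
  have h1 := card_nodes_le hN
  have h2 := card_dom_le hN.wf.init_mem
  have h3 := h.length_dom hN.wf.init_mem
  rw [← h.init_eq] at h3 h2
  rw [blankCost, h.length_nodes, h3]
  nlinarith

/-! ### Executing traces -/

/-- The state `s` of a play describes the places of the processes in `Y` in the configuration `E`,
and its enabled nodes with domain included in `Y` and fewer than `bound` processes. -/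
structure PlayInv (N : Negotiation Proc Node R) (bound : ℕ) (E : Config Proc Node)
    (Y : Finset Proc) (s : Play Proc Node R) : Prop where
  pos : ∀ p ∈ Y, ∀ m, m ∈ E p ↔ s.pos p = some m
  cnt : ∀ k, s.cnt k = (Y.filter fun p => s.pos p = some k).card
  nodup : s.ready.Nodup
  ready : ∀ k, k ∈ s.ready ↔ (N.Enabled E k ∧ k ≠ N.fin ∧ (N.dom k).card < bound ∧ N.dom k ⊆ Y)

theorem PlayInv.arrive (hN : N.SoundDet) (h : T.Represents N sem) {bound : ℕ}
    {E : Config Proc Node} (hE : N.Reachable E) {Y : Finset Proc} {s : Play Proc Node R}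
    (hs : PlayInv N bound E Y s) {p : Proc} (hp : p ∉ Y) {m : Node} (hm : E p = {m}) :
    PlayInv N bound E (insert p Y) (arrive T bound s p (some m)) := by
  have hmN := hE.typed hN (p := p) (k := m) (by rw [hm]; rfl)
  have hpos : ∀ q ∈ insert p Y, ∀ j, j ∈ E q ↔ Function.update s.pos p (some m) q = some j := by
    intro q hq j
    by_cases hqp : q = p
    · subst hqp; rw [hm, Function.update_self]; simp [eq_comm]
    · rw [Function.update_of_ne hqp]
      exact hs.pos q ((Finset.mem_insert.1 hq).resolve_left hqp) j
  have hcnt : ∀ k, Function.update s.cnt m (s.cnt m + 1) k =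
      ((insert p Y).filter fun q => Function.update s.pos p (some m) q = some k).card := by
    intro k
    have hY : (Y.filter fun q => Function.update s.pos p (some m) q = some k) =
        Y.filter fun q => s.pos q = some k :=
      Finset.filter_congr fun q hq => by rw [Function.update_of_ne (by rintro rfl; exact hp hq)]
    rw [Finset.filter_insert, Function.update_self, hY]
    by_cases hk : k = m
    · subst hk
      rw [Function.update_self, if_pos rfl, Finset.card_insert_of_notMem (by simp [hp]), hs.cnt]
    · rw [Function.update_of_ne hk, if_neg (by simpa using Ne.symm hk), hs.cnt]
  have hfull : s.cnt m + 1 = (T.dom m).length ↔ N.Enabled E m ∧ N.dom m ⊆ insert p Y := by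
    have h1 := hcnt m
    rw [Function.update_self] at h1
    rw [h.length_dom hmN.1, h1]
    have hsub : ((insert p Y).filter fun q => Function.update s.pos p (some m) q = some m) ⊆
        N.dom m := fun q hq => by
      obtain ⟨h2, h3⟩ := Finset.mem_filter.1 hq
      exact (hE.typed hN ((hpos q h2 m).2 h3)).2
    constructor
    · intro hc
      have he := Finset.eq_of_subset_of_card_le hsub hc.ge
      refine ⟨⟨hmN.1, fun q hq => ?_⟩, fun q hq => ?_⟩
      · rw [← he] at hq
        obtain ⟨h2, h3⟩ := Finset.mem_filter.1 hq
        exact (hpos q h2 m).2 h3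
      · rw [← he] at hq
        exact (Finset.mem_filter.1 hq).1
    · rintro ⟨h2, h3⟩
      congr 1
      refine hsub.antisymm fun q hq => Finset.mem_filter.2 ⟨h3 hq, ?_⟩
      exact (hpos q (h3 hq) m).1 (h2.2 q hq)
  have hnot : m ∉ s.ready := fun hcon => hp (((hs.ready m).1 hcon).2.2.2 hmN.2)
  have hother : ∀ k, k ≠ m → N.Enabled E k → (N.dom k ⊆ insert p Y ↔ N.dom k ⊆ Y) := by
    intro k hkm hk
    refine ⟨fun hd q hq => (Finset.mem_insert.1 (hd hq)).resolve_left ?_,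
      fun hd => hd.trans (Finset.subset_insert _ _)⟩
    rintro rfl
    have := hk.2 q hq
    rw [hm] at this
    exact hkm this
  refine ⟨hpos, hcnt, ?_, fun k => ?_⟩
  · simp only [Tables.arrive]
    split_ifs
    · exact List.nodup_cons.2 ⟨hnot, hs.nodup⟩
    · exact hs.nodup
  · simp only [Tables.arrive]
    by_cases hk : k = m
    · subst hk
      have hb : s.cnt k + 1 = (T.dom k).length → (s.cnt k + 1 < bound ↔ (N.dom k).card < bound) :=
        fun hc => by rw [hc, h.length_dom hmN.1]
      rw [h.fin_eq]
      split_ifs with hc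
      · obtain ⟨h1, h2, h3⟩ := hc
        have := hfull.1 h1
        simp only [List.mem_cons, true_or, true_iff]
        exact ⟨this.1, h3, (hb h1).1 h2, this.2⟩
      · refine iff_of_false hnot ?_
        rintro ⟨h1, h2, h3, h4⟩
        have := hfull.2 ⟨h1, h4⟩
        exact hc ⟨this, (hb this).2 h3, h2⟩
    · have h1 : k ∈ s.ready ↔ (N.Enabled E k ∧ k ≠ N.fin ∧ (N.dom k).card < bound ∧
          N.dom k ⊆ insert p Y) := by
        rw [hs.ready]
        refine and_congr_right fun he => and_congr_right fun _ => and_congr_right fun _ => ?_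
        exact (hother k hk he).symm
      split_ifs
      · rw [List.mem_cons, or_iff_right hk, h1]
      · exact h1

theorem PlayInv.fire (hN : N.SoundDet) (h : T.Represents N sem) {bound : ℕ}
    {E : Config Proc Node} (hE : N.Reachable E) {Y : Finset Proc} {s : Play Proc Node R} {k : Node}
    {a : R} (hk : k ∈ N.nodes) (ha : a ∈ N.out k)
    (hs : PlayInv N bound E Y
      { s with cnt := Function.update s.cnt k 0, trace := (k, a) :: s.trace })
    (hY : Disjoint Y (N.dom k)) (hδ : ∀ p ∈ N.dom k, E p = N.δ k a p) :
    PlayInv N bound E (Y ∪ N.dom k) (T.fire bound s k a).val ∧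
      (T.fire bound s k a).val.trace = (k, a) :: s.trace ∧
      (T.fire bound s k a).time ≤ 1 + 2 * (N.dom k).card := by
  have := Timed.forIn_spec (fun s p => Timed.step (Tables.arrive T bound s p (T.next k a p)))
    (fun l s' => l.Nodup ∧ (∀ p ∈ l, p ∈ N.dom k) ∧ s'.trace = (k, a) :: s.trace ∧
      PlayInv N bound E ((Y ∪ N.dom k) \ l.toFinset) s') (fun _ => 1)
    (fun p l s' ⟨h1, h2, h3, h4⟩ => by
      refine ⟨⟨(List.nodup_cons.1 h1).2, fun q hq => h2 q (List.mem_cons_of_mem _ hq), ?_, ?_⟩, le_rfl⟩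
      · simp only [Timed.val_step]
        cases T.next k a p <;> exact h3
      · have hp := h2 p List.mem_cons_self
        obtain ⟨m, hm⟩ := hE.exists_mem hN (hN.mem_procs hk hp)
        have hnext : T.next k a p = some m := by
          have h5 := h.next_eq k hk a ha p hp
          rw [← hδ p hp, hm] at h5
          have : m ∈ {m | T.next k a p = some m} := by rw [← h5]; rfl
          exact this
        have h6 := h4.arrive hN h hE (p := p) (by simp) hm
        simp only [Timed.val_step, hnext]
        convert h6 using 1
        have hpl := (List.nodup_cons.1 h1).1
        ext q
        simp only [Finset.mem_sdiff, Finset.mem_union, List.mem_toFinset, Finset.mem_insert,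
          List.mem_cons, not_or]
        by_cases hq : q = p
        · subst hq; simp [hp, hpl]
        · simp [hq])
    (T.dom k) { s with cnt := Function.update s.cnt k 0, trace := (k, a) :: s.trace }
    ⟨h.dom_nodup k hk, fun p hp => (h.mem_dom k hk p).1 hp, rfl, by
      convert hs using 1
      ext q
      simp only [Finset.mem_sdiff, Finset.mem_union, List.mem_toFinset, h.mem_dom k hk]
      have : q ∈ Y → q ∉ N.dom k := fun h => Finset.disjoint_left.1 hY h
      tauto⟩
  obtain ⟨⟨-, -, h3, h4⟩, h5⟩ := this
  refine ⟨by simpa [Tables.fire] using h4, h3, ?_⟩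
  rw [sum_map_const, h.length_dom hk] at h5
  unfold Tables.fire
  omega

/-- Executing an enabled location in a play. -/
theorem PlayInv.fire_ready (hN : N.SoundDet) (h : T.Represents N sem) {bound : ℕ}
    {E : Config Proc Node} (hE : N.Reachable E) {X : Finset Proc} {s : Play Proc Node R} {k : Node}
    {a : R} {rest : List Node} (hs : PlayInv N bound E X s) (hr : s.ready = k :: rest)
    (ha : a ∈ N.out k) :
    PlayInv N bound (N.after E k a) X (T.fire bound { s with ready := rest } k a).val ∧
      (T.fire bound { s with ready := rest } k a).val.trace = (k, a) :: s.trace ∧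
      (T.fire bound { s with ready := rest } k a).time ≤ 1 + 2 * (N.dom k).card := by
  obtain ⟨hk, hkf, hkb, hkX⟩ := (hs.ready k).1 (by rw [hr]; exact List.mem_cons_self)
  have hdisj : ∀ j, N.Enabled E j → j ≠ k → Disjoint (N.dom j) (N.dom k) :=
    fun j hj hjk => hj.disjoint (hE.subsing hN) hk hjk
  have := PlayInv.fire hN h (hE.after hk ha) (Y := X \ N.dom k) (s := { s with ready := rest })
    (k := k) (a := a) (bound := bound) hk.1 ha ?_ Finset.sdiff_disjoint fun p hp => after_of_mem hp
  · rwa [Finset.sdiff_union_of_subset hkX] at this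
  · have hnd := hs.nodup
    rw [hr, List.nodup_cons] at hnd
    refine ⟨fun p hp m => ?_, fun j => ?_, hnd.2, fun j => ?_⟩
    · rw [after_of_notMem (Finset.mem_sdiff.1 hp).2]
      exact hs.pos p (Finset.mem_sdiff.1 hp).1 m
    · by_cases hj : j = k
      · subst hj
        simp only [Function.update_self]
        symm
        rw [Finset.card_eq_zero, Finset.filter_eq_empty_iff]
        intro p hp hpj
        obtain ⟨h1, h2⟩ := Finset.mem_sdiff.1 hp
        exact h2 (hE.typed hN ((hs.pos p h1 j).2 hpj)).2
      · simp only [Function.update_of_ne hj, hs.cnt]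
        congr 1
        ext p
        simp only [Finset.mem_filter, Finset.mem_sdiff]
        refine ⟨fun ⟨h1, h2⟩ => ⟨⟨h1, fun h3 => hj ?_⟩, h2⟩, fun ⟨⟨h1, _⟩, h2⟩ => ⟨h1, h2⟩⟩
        exact hE.subsing hN p ((hs.pos p h1 j).2 h2) (hk.2 p h3)
    · have hmem : j ∈ rest ↔ j ∈ s.ready ∧ j ≠ k := by
        rw [hr, List.mem_cons]
        constructor
        · exact fun hj => ⟨.inr hj, by rintro rfl; exact hnd.1 hj⟩
        · rintro ⟨hj | hj, hjk⟩
          exacts [absurd hj hjk, hj]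
      simp only
      rw [hmem, hs.ready]
      constructor
      · rintro ⟨⟨h1, h2, h3, h4⟩, hjk⟩
        have hd := hdisj j h1 hjk
        exact ⟨(enabled_after_iff hd).2 h1, h2, h3, Finset.subset_sdiff.2 ⟨h4, hd⟩⟩
      · rintro ⟨h1, h2, h3, h4⟩
        obtain ⟨h5, h6⟩ := Finset.subset_sdiff.1 h4
        refine ⟨⟨(enabled_after_iff h6).1 h1, h2, h3, h5⟩, ?_⟩
        rintro rfl
        obtain ⟨p, hp⟩ := hN.wf.dom_nonempty j hk.1
        exact Finset.disjoint_left.1 h6 hp hp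

/-- Executing the first location of a play. -/
theorem PlayInv.fire_blank (hN : N.SoundDet) (h : T.Represents N sem) (bound : ℕ)
    {E : Config Proc Node} (hE : N.Reachable E) {n : Node} {a : R} (hn : N.Enabled E n)
    (ha : a ∈ N.out n) :
    PlayInv N bound (N.after E n a) (N.dom n) (T.fire bound blank n a).val ∧
      (T.fire bound blank n a).val.trace = [(n, a)] ∧
      (T.fire bound blank n a).time ≤ 1 + 2 * (N.dom n).card := by
  have := PlayInv.fire hN h (hE.after hn ha) (Y := ∅) (s := blank) (k := n) (a := a)
    (bound := bound) hn.1 ha ?_ (by simp) fun p hp => after_of_mem hp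
  · rw [Finset.empty_union] at this
    exact this
  · refine ⟨by simp, fun j => ?_, by simp [blank], fun j => ?_⟩
    · by_cases hj : j = n
      · subst hj; simp
      · simp [hj, blank]
    · simp only [blank, List.not_mem_nil, false_iff]
      rintro ⟨h1, -, -, h2⟩
      obtain ⟨p, hp⟩ := hN.wf.dom_nonempty j h1.1
      exact absurd (h2 hp) (by simp)

theorem testReduced_spec (hN : N.SoundDet) (h : T.Represents N sem) {m : Node}
    (hm : N.ReachableNode m) :
    ((T.testReduced m).val = true ↔ N.LocallyReduced m) ∧ (T.testReduced m).time ≤ 6 * N.size := by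
  have hsize : 1 ≤ N.size := Nat.le_trans (Finset.card_pos.2 ⟨m, hm.mem⟩) (card_nodes_le hN)
  obtain ⟨E, hE, hmE⟩ := hm
  have hmem := h.mem_out m hmE.1
  have hnd := h.out_nodup m hmE.1
  unfold testReduced
  split
  · next a ha =>
    have hout : N.out m = {a} := by
      ext b; rw [← hmem, ha]; simp
    have hmo : a ∈ N.out m := by simp [hout]
    obtain ⟨h1, -, h2⟩ := PlayInv.fire_blank hN h ((T.dom m).length + 1) hE hmE hmo
    constructor
    · simp only [Timed.val_charge, Timed.val_bind, Timed.val_step, List.isEmpty_iff]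
      have key : (T.fire ((T.dom m).length + 1) blank m a).val.ready = [] ↔
          ∀ k, k ∉ (T.fire ((T.dom m).length + 1) blank m a).val.ready :=
        List.eq_nil_iff_forall_not_mem
      rw [key]
      constructor
      · intro hr
        refine ⟨a, hout, fun k hk hkf hkd hall => hr k ((h1.ready k).2 ⟨⟨hk, fun p hp => ?_⟩, hkf, ?_, hkd⟩)⟩
        · rw [after_of_mem (hkd hp)]; exact hall p hp
        · rw [h.length_dom hmE.1]
          exact Nat.lt_succ_of_le (Finset.card_le_card hkd)
      · rintro ⟨b, hb, hl⟩ k hk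
        obtain rfl : a = b := by rwa [hout, Finset.singleton_inj] at hb
        obtain ⟨g1, g2, -, g3⟩ := (h1.ready k).1 hk
        refine hl k g1.1 g2 g3 fun p hp => ?_
        rw [← after_of_mem (N := N) (C := E) (g3 hp)]
        exact g1.2 p hp
    · simp only [Timed.time_charge, Timed.time_bind, Timed.time_step]
      have := blankCost_le hN h
      have h3 := card_dom_le hmE.1
      have : (N.dom m).card ≤ N.size := le_trans (by nlinarith) h3
      omega
  · next hne =>
    refine ⟨?_, by simp only [Timed.time_step]; omega⟩
    simp only [Timed.val_step, Bool.false_eq_true, false_iff]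
    rintro ⟨a, ha, -⟩
    refine hne a ?_
    have hlen := h.length_out hmE.1
    rw [ha, Finset.card_singleton, List.length_eq_one_iff] at hlen
    obtain ⟨b, hb⟩ := hlen
    have : b ∈ N.out m := by rw [← hmem, hb]; simp
    rw [ha, Finset.mem_singleton] at this
    rw [hb, this]

end Tables

namespace Negotiation

variable {Proc Node R D : Type*} {N : Negotiation Proc Node R} {n : Node} {a : R}
  {C₀ C : Config Proc Node}

/-- Two runs of nodes with a single outcome that lead to the same configuration coincide up to
commutation. -/
theorem Run.traceEq_of_quiet (hN : N.SoundDet) {E F : Config Proc Node} {P : Node → Prop}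
    {u v : List (Node × R)} (hu : N.Run E u F) (hv : N.Run E v F) (hE : N.Reachable E)
    (hs : ∀ l ∈ u, P l.1 ∧ N.out l.1 = {l.2}) (hs' : ∀ l ∈ v, P l.1)
    (hq : ∀ k, N.Enabled F k → ¬ P k) : N.TraceEq v u := by
  induction hu generalizing v with
  | nil E =>
    cases hv with
    | nil => exact .refl _
    | cons h1 _ _ => exact absurd (hs' _ List.mem_cons_self) (hq _ h1)
  | @cons E F k b u h1 h2 _ ih =>
    obtain ⟨hP, ho⟩ := hs _ List.mem_cons_self
    rcases hv.pull hN.det (hE.subsing hN) h1 with ⟨-, hk⟩ | ⟨c, v', ht, hr⟩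
    · exact absurd hP (hq _ hk)
    · obtain ⟨h4, h5, h6⟩ := run_cons_iff.1 hr
      simp only at ho
      rw [ho, Finset.mem_singleton] at h5
      subst h5
      refine ht.trans ((ih h6 (hE.after h1 h2) (fun l hl => hs l (List.mem_cons_of_mem _ hl))
        (fun l hl => hs' l ?_) hq).cons _)
      exact ht.perm.mem_iff.2 (List.mem_cons_of_mem _ hl)

theorem mop_subLoc_eq_semRun [CompleteLattice D] (hN : N.SoundDet)
    (hX : N.ReducedBelow (N.dom n)) (h₀ : N.IsFirst n C₀) (h : N.IsLastLoc n a C₀ C)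
    {sem : Node × R → D → D} (hM : N.MazurkiewiczInvariant sem) {u : List (Node × R)}
    (hu : N.IsStrictSeq n u) (hr : N.Run C₀ ((n, a) :: u) C) :
    (N.subLoc n a C₀ C).mop (subSem sem) = semRun sem ((n, a) :: u) := by
  rw [mop_subLoc hN hX h₀ h]
  refine le_antisymm (sSup_le ?_) (le_sSup ⟨_, ⟨u, rfl, hu, hr⟩, rfl⟩)
  rintro _ ⟨_, ⟨v, rfl, hv, hrv⟩, rfl⟩
  obtain ⟨h1, h2, h3⟩ := run_cons_iff.1 hr
  have hE := h₀.1.after h1 h2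
  have ht := Run.traceEq_of_quiet hN (P := fun k => N.dom k ⊂ N.dom n) h3
    (run_cons_iff.1 hrv).2.2 hE (fun l hl => ⟨hu l hl,
      hX.out_eq (h3.reachableNode hE hl) (hu l hl) (h3.isLoc l hl).2⟩) hv h.2
  rw [(ht.cons (n, a)).semRun hM hrv.isLoc]

end Negotiation

namespace Tables

variable {Proc Node R D : Type*} [DecidableEq Proc] [DecidableEq Node] [DecidableEq R]
  {T : Tables Proc Node R D} {N : Negotiation Proc Node R} {sem : Node × R → D → D}
  {n : Node} {a : R} {C₀ : Config Proc Node}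

/-- The nodes of the trace of a location are distinct and not final. -/
theorem trace_nodup (hN : N.SoundDet) (hX : N.ReducedBelow (N.dom n)) {E F : Config Proc Node}
    (hE : N.Reachable E) {u : List (Node × R)} (hu : N.IsStrictSeq n u)
    (hr : N.Run E ((n, a) :: u) F) : (((n, a) :: u).map Prod.fst).Nodup ∧
      ∀ k ∈ ((n, a) :: u).map Prod.fst, k ∈ N.nodes.erase N.fin := by
  obtain ⟨r, hrk⟩ := hN.exists_isRank
  obtain ⟨h1, h2, h3⟩ := run_cons_iff.1 hr
  have hE' := hE.after h1 h2
  refine ⟨List.nodup_cons.2 ⟨fun hmem => ?_, h3.nodup hN hE' (hu.lowers hN hX hrk h3 hE')⟩, ?_⟩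
  · obtain ⟨l, hl, he⟩ := List.mem_map.1 hmem
    exact (hu l hl).ne (congrArg _ he)
  · intro k hk
    obtain ⟨l, hl, rfl⟩ := List.mem_map.1 hk
    obtain ⟨h4, h5⟩ := hr.isLoc l hl
    exact Finset.mem_erase.2 ⟨hN.ne_fin_of_mem_out h5, h4⟩

theorem play_spec (hN : N.SoundDet) (h : T.Represents N sem) (hX : N.ReducedBelow (N.dom n))
    (h₀ : N.Reachable C₀) (hn : N.Enabled C₀ n) (ha : a ∈ N.out n) (fuel : ℕ)
    {s : Play Proc Node R} {E : Config Proc Node} {u : List (Node × R)}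
    (hu : N.IsStrictSeq n u) (hr : N.Run (N.after C₀ n a) u E)
    (hs : PlayInv N (T.dom n).length E (N.dom n) s) (ht : s.trace = ((n, a) :: u).reverse)
    (hf : N.nodes.card ≤ fuel + u.length + 1) :
    ∃ v F, N.IsStrictSeq n (u ++ v) ∧ N.Run (N.after C₀ n a) (u ++ v) F ∧
      PlayInv N (T.dom n).length F (N.dom n) (play T (T.dom n).length fuel s).val ∧
      (play T (T.dom n).length fuel s).val.trace = ((n, a) :: (u ++ v)).reverse ∧
      (play T (T.dom n).length fuel s).val.ready = [] ∧
      (play T (T.dom n).length fuel s).time ≤ 1 + (v.map fun l => 2 + 2 * (N.dom l.1).card).sum := by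
  have hlen := h.length_dom hn.1
  have hready : ∀ k rest, s.ready = k :: rest → N.Enabled E k ∧ N.dom k ⊂ N.dom n ∧
      ∃ b w, T.out k = b :: w ∧ b ∈ N.out k := by
    intro k rest hk
    obtain ⟨h1, h2, h3, h4⟩ := (hs.ready k).1 (by rw [hk]; exact List.mem_cons_self)
    refine ⟨h1, h4.ssubset_of_ne fun he => ?_, ?_⟩
    · rw [he, hlen] at h3
      exact lt_irrefl _ h3
    · obtain ⟨c, hc⟩ := hN.wf.out_nonempty k h1.1 h2
      have hmem := h.mem_out k h1.1
      cases ho : T.out k with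
      | nil => rw [← hmem, ho] at hc; simp at hc
      | cons b w => exact ⟨b, w, rfl, by rw [← hmem, ho]; simp⟩
  induction fuel generalizing s E u with
  | zero =>
    refine ⟨[], E, by simpa using hu, by simpa using hr, hs, by simpa [play] using ht, ?_, by simp [play]⟩
    simp only [play, Timed.val_step]
    cases hk : s.ready with
    | nil => rfl
    | cons k rest =>
      obtain ⟨h1, h2, b, w, -, hb⟩ := hready k rest hk
      have hu' : N.IsStrictSeq n (u ++ [(k, b)]) := fun l hl => by
        rcases List.mem_append.1 hl with hl | hl
        · exact hu l hl
        · obtain rfl : l = (k, b) := by simpa using hl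
          exact h2
      obtain ⟨h3, h4⟩ := trace_nodup hN hX h₀ hu' (.cons hn ha (hr.append (.cons h1 hb (.nil _))))
      have h5 := Finset.card_le_card (s := (((n, a) :: (u ++ [(k, b)])).map Prod.fst).toFinset)
        (t := N.nodes.erase N.fin) fun x hx => h4 x (List.mem_toFinset.1 hx)
      rw [List.toFinset_card_of_nodup h3, Finset.card_erase_of_mem hN.wf.fin_mem] at h5
      simp only [List.length_map, List.length_cons, List.length_append, List.length_nil] at h5
      omega
  | succ fuel ih =>
    cases hk : s.ready with
    | nil =>
      have hp : play T (T.dom n).length (fuel + 1) s = Timed.step s := by rw [play, hk]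
      rw [hp]
      exact ⟨[], E, by simpa using hu, by simpa using hr, hs, by simpa using ht, hk, by simp⟩
    | cons k rest =>
      obtain ⟨h1, h2, b, w, ho, hb⟩ := hready k rest hk
      have hp : play T (T.dom n).length (fuel + 1) s = Timed.charge 1
          ((T.fire (T.dom n).length { s with ready := rest } k b).bind
            (play T (T.dom n).length fuel)) := by
        rw [play, hk]; simp only [ho]
      have hE : N.Reachable E := (h₀.after hn ha).run hr
      obtain ⟨g1, g2, g3⟩ := hs.fire_ready hN h hE hk hb
      have hu' : N.IsStrictSeq n (u ++ [(k, b)]) := fun l hl => by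
        rcases List.mem_append.1 hl with hl | hl
        · exact hu l hl
        · obtain rfl : l = (k, b) := by simpa using hl
          exact h2
      obtain ⟨v, F, i1, i2, i3, i4, i5, i6⟩ := ih hu' (hr.append (.cons h1 hb (.nil _))) g1
        (by rw [g2, ht]; simp) (by simp only [List.length_append, List.length_singleton]; omega)
        (fun k' rest' hk' => by
          obtain ⟨h1, h2, h3, h4⟩ := (g1.ready k').1 (by rw [hk']; exact List.mem_cons_self)
          refine ⟨h1, h4.ssubset_of_ne fun he => ?_, ?_⟩
          · rw [he, hlen] at h3
            exact lt_irrefl _ h3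
          · obtain ⟨c, hc⟩ := hN.wf.out_nonempty k' h1.1 h2
            have hmem := h.mem_out k' h1.1
            cases ho : T.out k' with
            | nil => rw [← hmem, ho] at hc; simp at hc
            | cons b w => exact ⟨b, w, rfl, by rw [← hmem, ho]; simp⟩)
      rw [hp]
      refine ⟨(k, b) :: v, F, by simpa using i1, by simpa using i2, i3, by simpa using i4, i5, ?_⟩
      simp only [Timed.time_charge, Timed.time_bind, List.map_cons, List.sum_cons]
      omega

theorem runTrace_spec (hN : N.SoundDet) (h : T.Represents N sem) (hX : N.ReducedBelow (N.dom n))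
    (h₀ : N.IsFirst n C₀) (ha : a ∈ N.out n) :
    ∃ u C, N.IsStrictSeq n u ∧ N.Run C₀ ((n, a) :: u) C ∧ N.IsLastLoc n a C₀ C ∧
      (T.runTrace n a).val.trace = ((n, a) :: u).reverse ∧
      (∀ p ∈ N.dom n, ∀ m, m ∈ C p ↔ (T.runTrace n a).val.pos p = some m) ∧
      (T.runTrace n a).time ≤ 6 * N.size := by
  have hn := h₀.enabled
  obtain ⟨g1, g2, g3⟩ := PlayInv.fire_blank hN h (T.dom n).length h₀.1 hn ha
  obtain ⟨u, C, i1, i2, i3, i4, i5, i6⟩ := play_spec hN h hX h₀.1 hn ha T.nodes.length (u := [])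
    (by simp [IsStrictSeq]) (.nil _) g1 (by rw [g2]; rfl) (by rw [h.length_nodes]; omega)
  rw [List.nil_append] at i1 i2 i4
  have hr : N.Run C₀ ((n, a) :: u) C := .cons hn ha i2
  refine ⟨u, C, i1, hr, ⟨⟨u, i1, hr⟩, fun k hk hd => ?_⟩, i4, i3.pos, ?_⟩
  · have : k ∈ (play T (T.dom n).length T.nodes.length (T.fire (T.dom n).length blank n a).val).val.ready := by
      refine (i3.ready k).2 ⟨hk, ?_, ?_, hd.subset⟩
      · rintro rfl
        exact (hN.wf.dom_fin ▸ hd).not_subset (hN.wf.dom_subset n hn.1)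
      · rw [h.length_dom hn.1]
        exact Finset.card_lt_card hd
    rw [i5] at this
    simp at this
  · obtain ⟨h3, h4⟩ := trace_nodup hN hX h₀.1 i1 hr
    have h5 := sum_map_le_sum h3 (s := N.nodes) (fun x hx => Finset.mem_of_mem_erase (h4 x hx))
      fun k => 2 + 2 * (N.dom k).card
    have h6 : ∑ k ∈ N.nodes, (2 + 2 * (N.dom k).card) ≤ 4 * N.size :=
      sum_le_mul_size fun k hk => by
        have := one_le_card_dom hN hk
        nlinarith
    rw [List.map_map, List.map_cons, List.sum_cons] at h5
    have h7 := blankCost_le hN h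
    simp only [Function.comp_def] at h5
    simp only [runTrace, Timed.time_charge, Timed.time_bind]
    omega

/-! ### The flow-graph of a trace -/

theorem length_pathEdges (w : List (Node × R)) (v : Option Node) :
    (T.pathEdges w v).length = w.length := by
  induction w generalizing v with
  | nil => rfl
  | cons l w ih => obtain ⟨k, a⟩ := l; simp [pathEdges, ih]

theorem mem_pathEdges {w : List (Node × R)} {v : Option Node}
    {e : Option Node × (D → D) × Option Node} : e ∈ T.pathEdges w v ↔
      ∃ w₁ l w₂, w = w₁ ++ l :: w₂ ∧ e = (some l.1, T.val l.1 l.2, (w₁.getLast?.map Prod.fst).or v) := by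
  induction w generalizing v with
  | nil => simp [pathEdges]
  | cons l w ih =>
    obtain ⟨k, a⟩ := l
    rw [pathEdges, List.mem_cons, ih]
    constructor
    · rintro (rfl | ⟨w₁, l, w₂, rfl, rfl⟩)
      · exact ⟨[], (k, a), w, rfl, rfl⟩
      · refine ⟨(k, a) :: w₁, l, w₂, rfl, ?_⟩
        cases w₁ with
        | nil => rfl
        | cons x w₁ => rw [List.getLast?_cons_cons]; cases h : (x :: w₁).getLast? <;> simp at h ⊢
    · rintro ⟨w₁, l, w₂, he, rfl⟩
      cases w₁ with
      | nil =>
        simp only [List.nil_append, List.cons.injEq] at he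
        obtain ⟨rfl, rfl⟩ := he
        exact .inl rfl
      | cons x w₁ =>
        simp only [List.cons_append, List.cons.injEq] at he
        obtain ⟨rfl, rfl⟩ := he
        refine .inr ⟨w₁, l, w₂, rfl, ?_⟩
        cases w₁ with
        | nil => rfl
        | cons x w₁ => rw [List.getLast?_cons_cons]; cases h : (x :: w₁).getLast? <;> simp at h ⊢

theorem isPath_traceGraph_none {w : List (Node × R)}
    {π : List (Option Node × (D → D) × Option Node)} {v : Option Node}
    (h : (T.traceGraph n w).IsPath none π v) : π = [] := by
  cases π with
  | nil => rfl
  | cons e π =>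
    obtain ⟨h1, h2, -⟩ := h
    obtain ⟨w₁, l, w₂, -, rfl⟩ := mem_pathEdges.1 h1
    simp at h2

theorem semPath_traceGraph {w : List (Node × R)} (hw : (w.map Prod.fst).Nodup)
    {π : List (Option Node × (D → D) × Option Node)} {w₁ w₂ : List (Node × R)} {l : Node × R}
    (hs : w = w₁ ++ l :: w₂) (h : (T.traceGraph n w).IsPath (some l.1) π none) :
    FlowGraph.semPath π = semRun (fun l => T.val l.1 l.2) (w₁ ++ [l]).reverse := by
  induction π generalizing w₁ w₂ l with
  | nil => exact absurd h (by simp [FlowGraph.IsPath])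
  | cons e π ih =>
    obtain ⟨h1, h2, h3⟩ := h
    obtain ⟨u₁, l', u₂, hu, rfl⟩ := mem_pathEdges.1 h1
    have hl : l'.1 = l.1 := by simpa using h2
    have hsplit : u₁ = w₁ ∧ l' = l ∧ u₂ = w₂ := by
      have he : u₁ ++ l' :: u₂ = w₁ ++ l :: w₂ := hu ▸ hs
      rw [hu] at hw
      clear h1 h2 h3 hu hs ih
      induction u₁ generalizing w₁ with
      | nil =>
        cases w₁ with
        | nil => simpa using he
        | cons x w₁ =>
          simp only [List.nil_append, List.cons_append, List.cons.injEq] at he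
          obtain ⟨rfl, rfl⟩ := he
          simp [hl] at hw
      | cons y u₁ ih =>
        cases w₁ with
        | nil =>
          simp only [List.nil_append, List.cons_append, List.cons.injEq] at he
          obtain ⟨rfl, rfl⟩ := he
          simp [hl] at hw
        | cons x w₁ =>
          simp only [List.cons_append, List.cons.injEq] at he
          obtain ⟨rfl, he⟩ := he
          simp only [List.cons_append, List.map_cons, List.nodup_cons] at hw
          obtain ⟨rfl, h⟩ := ih hw.2 he
          exact ⟨rfl, h⟩
    obtain ⟨rfl, rfl, rfl⟩ := hsplit
    rw [FlowGraph.semPath]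
    rcases List.eq_nil_or_concat u₁ with rfl | ⟨u, x, rfl⟩
    · have := isPath_traceGraph_none (T := T) (n := n) h3
      subst this
      simp [FlowGraph.semPath, semRun]
    · have h4 := ih (w₁ := u) (l := x) (w₂ := l' :: u₂) (by simpa using hs) (by simpa using h3)
      rw [h4]
      simp [semRun, List.reverse_append]

theorem exists_path_traceGraph {w : List (Node × R)} {w₁ w₂ : List (Node × R)} {l : Node × R}
    (hs : w = w₁ ++ l :: w₂) : ∃ π, (T.traceGraph n w).IsPath (some l.1) π none := by
  induction w₁ using List.reverseRecOn generalizing l w₂ with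
  | nil => exact ⟨_ :: [], mem_pathEdges.2 ⟨[], l, w₂, hs, rfl⟩, rfl, rfl⟩
  | append_singleton w₁ x ih =>
    obtain ⟨π, hπ⟩ := ih (w₂ := l :: w₂) (l := x) (by simpa using hs)
    exact ⟨_ :: π, mem_pathEdges.2 ⟨_, l, w₂, hs, rfl⟩, rfl, by simpa using hπ⟩

theorem semRun_val (h : T.Represents N sem) {w : List (Node × R)} (hw : ∀ l ∈ w, N.IsLoc l) :
    semRun (fun l => T.val l.1 l.2) w = semRun sem w := by
  induction w with
  | nil => rfl
  | cons l w ih =>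
    obtain ⟨h1, h2⟩ := hw l List.mem_cons_self
    rw [semRun, semRun, ih fun l hl => hw l (List.mem_cons_of_mem _ hl), h.val_eq l.1 h1 l.2 h2]

theorem mop_traceGraph [CompleteLattice D] (h : T.Represents N sem) {u : List (Node × R)}
    (hu : ∀ l ∈ (n, a) :: u, N.IsLoc l) (hnd : (((n, a) :: u).map Prod.fst).Nodup) :
    (T.traceGraph n ((n, a) :: u).reverse).mop = semRun sem ((n, a) :: u) := by
  have hs : ((n, a) :: u).reverse = u.reverse ++ (n, a) :: [] := by simp
  have hnd' : (((n, a) :: u).reverse.map Prod.fst).Nodup := by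
    rw [List.map_reverse, List.nodup_reverse]; exact hnd
  have key : ∀ π, (T.traceGraph n ((n, a) :: u).reverse).IsPath (some n) π none →
      FlowGraph.semPath π = semRun sem ((n, a) :: u) := fun π hπ => by
    rw [semPath_traceGraph hnd' hs hπ, ← semRun_val h hu]
    simp
  refine le_antisymm (sSup_le ?_) (le_sSup ?_)
  · rintro _ ⟨π, hπ, rfl⟩
    exact (key π hπ).le
  · obtain ⟨π, hπ⟩ := exists_path_traceGraph (T := T) (n := n) hs
    exact ⟨π, hπ, (key π hπ).symm⟩

/-! ### The body of the first for-loop -/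

/-- `solve` computes the merge over all paths of the flow-graphs of the analysis with size at most
`m` in at most `C` steps. -/
def Solves [CompleteLattice D] (solve : FlowGraph (Option Node) D → Timed (D → D))
    (N : Negotiation Proc Node R) (sem : Node × R → D → D) (m C : ℕ) : Prop :=
  ∀ G : FlowGraph (Option Node) D, G.size ≤ m → (∀ e ∈ G.edges, Transformer N sem e.2.1) →
    (solve G).val = G.mop ∧ (solve G).time ≤ C

/-- All transformers of locations are transformers of the analysis of `N₀`. -/
def Labelled [CompleteLattice D] (N₀ : Negotiation Proc Node R) (sem₀ : Node × R → D → D)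
    (N : Negotiation Proc Node R) (sem : Node × R → D → D) : Prop :=
  ∀ l, N.IsLoc l → Transformer N₀ sem₀ (sem l)

/-- The tables have the same nodes, domains and outcomes. -/
structure SameShape (T T' : Tables Proc Node R D) : Prop where
  nodes : T'.nodes = T.nodes
  init : T'.init = T.init
  fin : T'.fin = T.fin
  dom : T'.dom = T.dom
  out : T'.out = T.out

theorem SameShape.refl (T : Tables Proc Node R D) : SameShape T T := ⟨rfl, rfl, rfl, rfl, rfl⟩

theorem SameShape.trans {T T' T'' : Tables Proc Node R D} (h : SameShape T T')
    (h' : SameShape T' T'') : SameShape T T'' :=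
  ⟨h'.nodes.trans h.nodes, h'.init.trans h.init, h'.fin.trans h.fin, h'.dom.trans h.dom,
    h'.out.trans h.out⟩

theorem setTargets_spec (T : Tables Proc Node R D) (n : Node) (a : R) (pos : Proc → Option Node) :
    SameShape T (T.setTargets n a pos).val ∧ (T.setTargets n a pos).val.val = T.val ∧
      (∀ k b, (k, b) ≠ (n, a) → (T.setTargets n a pos).val.next k b = T.next k b) ∧
      (∀ p ∈ T.dom n, (T.setTargets n a pos).val.next n a p = pos p) ∧
      (T.setTargets n a pos).time ≤ 1 + 2 * (T.dom n).length := by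
  have := Timed.forIn_spec (fun T p => Timed.step (T.setNext n a p (pos p)))
    (fun l T' => SameShape T T' ∧ T'.val = T.val ∧ (∀ k b, (k, b) ≠ (n, a) →
      T'.next k b = T.next k b) ∧ ∀ p ∈ T.dom n, p ∉ l → T'.next n a p = pos p) (fun _ => 1)
    (fun p l T' ⟨h1, h2, h3, h4⟩ => by
      refine ⟨⟨⟨h1.nodes, h1.init, h1.fin, h1.dom, h1.out⟩, h2, fun k b hkb => ?_,
        fun q hq hql => ?_⟩, le_rfl⟩
      · simp only [Timed.val_step, setNext]
        by_cases hk : k = n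
        · subst hk
          have hb : b ≠ a := fun h => hkb (by rw [h])
          rw [Function.update_self, Function.update_of_ne hb, h3 k b hkb]
        · rw [Function.update_of_ne hk, h3 k b hkb]
      · simp only [Timed.val_step, setNext, Function.update_self]
        by_cases hqp : q = p
        · subst hqp; rw [Function.update_self]
        · rw [Function.update_of_ne hqp, h4 q hq (by simp [hqp, hql])])
    (T.dom n) T ⟨.refl T, rfl, fun _ _ _ => rfl, fun p hp hp' => absurd hp hp'⟩
  obtain ⟨⟨h1, h2, h3, h4⟩, h5⟩ := this
  refine ⟨h1, h2, h3, fun p hp => h4 p hp (by simp), ?_⟩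
  rw [sum_map_const] at h5
  unfold setTargets
  omega

theorem redLoc_out_same (ha : a ∈ N.out n) (C : Config Proc Node) :
    (N.redLoc n a a C).out = N.out := by
  simp only [redLoc]
  rw [Finset.insert_erase ha, Function.update_eq_self]

theorem reduceLoc_spec [CompleteLattice D] {N₀ : Negotiation Proc Node R} {sem₀ : Node × R → D → D}
    {m K : ℕ} {solve : FlowGraph (Option Node) D → Timed (D → D)} (hsolve : Solves solve N₀ sem₀ m K)
    (hm : N.size ≤ m) (hlab : Labelled N₀ sem₀ N sem) (hN : N.SoundDet)
    (hM : N.MazurkiewiczInvariant sem) (h : T.Represents N sem)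
    (hX : N.ReducedBelow (N.dom n)) (h₀ : N.IsFirst n C₀) (ha : a ∈ N.out n) :
    ∃ C, N.IsLastLoc n a C₀ C ∧
      (reduceLoc solve T n a).val.Represents (N.redLoc n a a C)
        (Function.update sem (n, a) ((N.subLoc n a C₀ C).mop (subSem sem))) ∧
      Labelled N₀ sem₀ (N.redLoc n a a C)
        (Function.update sem (n, a) ((N.subLoc n a C₀ C).mop (subSem sem))) ∧
      SameShape T (reduceLoc solve T n a).val ∧
      (reduceLoc solve T n a).time ≤ K + 11 * N.size := by
  have hn := h₀.enabled.1
  obtain ⟨u, C, hu, hr, hC, ht, hpos, htime⟩ := runTrace_spec hN h hX h₀ ha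
  obtain ⟨hnd, hnodes⟩ := trace_nodup hN hX h₀.1 hu hr
  set G := T.traceGraph n ((n, a) :: u).reverse with hG
  have hsize : G.size ≤ N.size := by
    have h1 : G.size = 2 * ((n, a) :: u).length + 1 := by
      simp only [hG, FlowGraph.size, traceGraph, length_pathEdges, List.length_cons,
        List.length_map, List.length_reverse]
      omega
    have h2 := sum_lt_size hN (s := (((n, a) :: u).map Prod.fst).toFinset)
      (fun x hx => Finset.mem_of_mem_erase (hnodes x (List.mem_toFinset.1 hx)))
      (fun hf => Finset.notMem_erase _ _ (hnodes _ (List.mem_toFinset.1 hf)))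
    have h3 : (((n, a) :: u).map Prod.fst).toFinset.card • 2 ≤
        ∑ k ∈ (((n, a) :: u).map Prod.fst).toFinset, (N.dom k).card * (1 + (N.out k).card) := by
      refine Finset.card_nsmul_le_sum _ _ _ fun k hk => ?_
      have hk' := Finset.mem_erase.1 (hnodes k (List.mem_toFinset.1 hk))
      have h4 := one_le_card_dom hN hk'.2
      have h5 := Finset.card_pos.2 (hN.wf.out_nonempty k hk'.2 hk'.1)
      nlinarith
    rw [List.toFinset_card_of_nodup hnd, List.length_map, smul_eq_mul] at h3
    omega
  have hedge : ∀ e ∈ G.edges, Transformer N₀ sem₀ e.2.1 := by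
    intro e he
    obtain ⟨w₁, l, w₂, hs, rfl⟩ := mem_pathEdges.1 he
    have hl := hr.isLoc l (by rw [← List.mem_reverse, hs]; simp)
    rw [h.val_eq l.1 hl.1 l.2 hl.2]
    exact hlab l hl
  obtain ⟨hval, hcost⟩ := hsolve G (hsize.trans hm) hedge
  have hmop : G.mop = (N.subLoc n a C₀ C).mop (subSem sem) := by
    rw [mop_subLoc_eq_semRun hN hX h₀ hC hM hu hr, hG, mop_traceGraph h hr.isLoc hnd]
  obtain ⟨s1, s2, s3, s4, s5⟩ := T.setTargets_spec n a (T.runTrace n a).val.pos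
  have hred : (reduceLoc solve T n a).val = ((T.setTargets n a (T.runTrace n a).val.pos).val.setVal n a
      ((N.subLoc n a C₀ C).mop (subSem sem))) := by
    simp only [reduceLoc, Timed.val_bind, Timed.val_charge, Timed.val_step, ht]
    rw [← hG, hval, hmop]
  have hout := redLoc_out_same ha C
  refine ⟨C, hC, ?_, ?_, ?_, ?_⟩
  · rw [hred]
    refine ⟨s1.nodes ▸ h.nodes_nodup, fun k => ?_, s1.init.trans h.init_eq, s1.fin.trans h.fin_eq,
      fun k hk => ?_, fun k hk => ?_, fun k hk => ?_, fun k hk => ?_, fun k hk b hb p hp => ?_,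
      fun k hk b hb => ?_⟩
    · simp only [setVal, s1.nodes]; exact h.mem_nodes k
    · simp only [setVal, s1.dom]; exact h.dom_nodup k hk
    · simp only [setVal, s1.dom]; exact h.mem_dom k hk
    · simp only [setVal, s1.out]; exact h.out_nodup k hk
    · simp only [setVal, s1.out, hout]; exact h.mem_out k hk
    · rw [hout] at hb
      simp only [setVal]
      by_cases hkb : (k, b) = (n, a)
      · obtain ⟨rfl, rfl⟩ := Prod.ext_iff.1 hkb
        simp only at *
        rw [redLoc_δ_self, s4 p ((h.mem_dom k hk p).2 hp)]
        ext x
        exact hpos p hp x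
      · have : (N.redLoc n a a C).δ k b = N.δ k b := by
          by_cases hk : k = n
          · subst hk
            exact redLoc_δ_of_ne' fun h => hkb (by rw [h])
          · rw [redLoc_δ_of_ne hk]
        rw [this, s3 k b hkb]
        exact h.next_eq k hk b hb p hp
    · rw [hout] at hb
      simp only [setVal, s2]
      by_cases hkn : k = n
      · subst hkn
        by_cases hba : b = a
        · subst hba; simp
        · rw [Function.update_self, Function.update_of_ne hba, Function.update_of_ne (by simp [hba])]
          exact h.val_eq k hk b hb
      · rw [Function.update_of_ne hkn, Function.update_of_ne (by simp [hkn])]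
        exact h.val_eq k hk b hb
  · rintro l ⟨h1, h2⟩
    rw [hout] at h2
    by_cases hl : l = (n, a)
    · subst hl
      rw [Function.update_self, ← hmop]
      exact .mop G hedge
    · rw [Function.update_of_ne hl]
      exact hlab l ⟨h1, h2⟩
  · rw [hred]
    exact ⟨s1.nodes, s1.init, s1.fin, s1.dom, s1.out⟩
  · simp only [reduceLoc, Timed.time_bind, Timed.time_charge, Timed.time_step,
      Timed.val_charge, ht]
    rw [← hG]
    have h1 := card_dom_le hn
    have h2 : (N.dom n).card ≤ N.size := le_trans (by nlinarith) h1
    have h3 := one_le_card_dom hN hn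
    rw [h.length_dom hn] at s5
    omega

end Tables

namespace Tables

variable {Proc Node R D : Type*} [DecidableEq Proc] [DecidableEq Node] [DecidableEq R]
  {T : Tables Proc Node R D} {N : Negotiation Proc Node R} {sem : Node × R → D → D}
  {n : Node} {a : R} {C₀ : Config Proc Node} {X : Finset Proc}

/-! ### Exploring a replication -/

/-- The location `(k, a)` leads all its processes to `k'`, which is not final and has the same
domain. -/
def MovesTo (N : Negotiation Proc Node R) (k : Node) (a : R) (k' : Node) : Prop :=
  k' ≠ N.fin ∧ N.dom k' = N.dom k ∧ ∀ p ∈ N.dom k, N.δ k a p = {k'}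

theorem uniform_spec (hN : N.SoundDet) (h : T.Represents N sem) {k : Node} (hk : k ∈ N.nodes)
    (ha : a ∈ N.out k) : (∀ k', (T.uniform k a).val = some k' ↔ MovesTo N k a k') ∧
      (T.uniform k a).time ≤ 2 * (N.dom k).card + 1 := by
  have hmem := h.mem_dom k hk
  have hlen := h.length_dom hk
  have hnext : ∀ p ∈ N.dom k, ∀ k', T.next k a p = some k' ↔ N.δ k a p = {k'} := fun p hp k' => by
    rw [h.next_eq k hk a ha p hp, Set.eq_singleton_iff_unique_mem]
    simp only [Set.mem_ofPred_eq]
    exact ⟨fun he => ⟨he, fun x hx => Option.some_injective _ (hx.symm.trans he)⟩, fun he => he.1⟩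
  unfold uniform
  split
  · next hd =>
    obtain ⟨p, hp⟩ := hN.wf.dom_nonempty k hk
    rw [← hmem, hd] at hp
    simp at hp
  · next p ps hd =>
    have hp : p ∈ N.dom k := by rw [← hmem, hd]; simp
    have hps : ∀ q ∈ ps, q ∈ N.dom k := fun q hq => by rw [← hmem, hd]; simp [hq]
    split
    · next hnone =>
      refine ⟨fun k' => ?_, by simp⟩
      simp only [Timed.val_step, reduceCtorEq, false_iff]
      rintro ⟨-, -, hall⟩
      have := (hnext p hp k').2 (hall p hp)
      rw [hnone] at this
      simp at this
    · next k₁ hk₁ =>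
      have hk₁N := hN.wf.δ_mem k hk a ha p hp k₁ (by rw [(hnext p hp k₁).1 hk₁]; rfl)
      have huniq : ∀ k', MovesTo N k a k' → k' = k₁ := fun k' hm => by
        have := (hnext p hp k').2 (hm.2.2 p hp)
        rw [hk₁] at this
        exact (Option.some_injective _ this).symm
      split
      · next hc =>
        have hcard : (N.dom k₁).card = (N.dom k).card := by
          rw [← h.length_dom hk₁N.1, ← hlen, hc.2]
        obtain ⟨hI, ht⟩ := Timed.forIn_spec
          (fun (r : Option Node) q => Timed.step (if T.next k a q = some k₁ then r else none))
          (fun l r => ∃ l', ps = l' ++ l ∧ r = if ∀ q ∈ l', T.next k a q = some k₁ then some k₁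
            else none) (fun _ => 1)
          (fun q l r ⟨l', h1, h2⟩ => by
            refine ⟨⟨l' ++ [q], by simpa using h1, ?_⟩, le_rfl⟩
            simp only [Timed.val_step, h2]
            split_ifs <;> grind) ps (some k₁) ⟨[], rfl, by simp⟩
        obtain ⟨l', h1, h2⟩ := hI
        rw [List.append_nil] at h1
        subst h1
        constructor
        · intro k'
          rw [h2]
          constructor
          · intro hs
            split_ifs at hs with hall
            obtain rfl := Option.some_injective _ hs
            have hall' : ∀ q ∈ N.dom k, N.δ k a q = {k₁} := fun q hq => by
              rw [← hnext q hq]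
              rw [← hmem, hd, List.mem_cons] at hq
              rcases hq with rfl | hq
              exacts [hk₁, hall q hq]
            refine ⟨h.fin_eq ▸ hc.1, ?_, hall'⟩
            symm
            refine Finset.eq_of_subset_of_card_le (fun q hq => ?_) hcard.le
            exact (hN.wf.δ_mem k hk a ha q hq k₁ (by rw [hall' q hq]; rfl)).2
          · intro hm
            obtain rfl := huniq k' hm
            rw [if_pos fun q hq => (hnext q (hps q hq) _).2 (hm.2.2 q (hps q hq))]
        · rw [sum_map_const] at ht
          rw [hd, List.length_cons] at hlen
          omega
      · next hc =>
        refine ⟨fun k' => ?_, by simp⟩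
        simp only [Timed.val_step, reduceCtorEq, false_iff]
        intro hm
        obtain rfl := huniq k' hm
        exact hc ⟨h.fin_eq ▸ hm.1, by rw [h.length_dom hk₁N.1, hlen, hm.2.1]⟩

/-- The invariant of the exploration of a replication: `L` lists the nodes seen, `Q` the explored
locations, `done` is the set of explored nodes, and `extra` lists locations still to be explored. -/
structure ExploreInv (T : Tables Proc Node R D) (G : Node → Prop) (n : Node) (done : Finset Node)
    (extra : List (Node × R)) (L : List Node) (Q : List (Node × R)) (s : Explore Node R D) :
    Prop where
  verts : s.verts = L.map some ++ [none]
  edges : s.edges = Q.map fun l => (some l.1, T.val l.1 l.2, (T.uniform l.1 l.2).val)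
  seen : ∀ k, s.seen k = true ↔ k ∈ L
  nodup : L.Nodup
  nodup_locs : Q.Nodup
  nodup_stack : s.stack.Nodup
  mem_iff : ∀ k, k ∈ L ↔ k ∈ done ∨ k ∈ s.stack
  notMem_done : ∀ k ∈ s.stack, k ∉ done
  mem_init : n ∈ L
  of_mem : ∀ l ∈ Q, l.1 ∈ done ∧ l.2 ∈ T.out l.1 ∧ l ∉ extra
  mem : ∀ k ∈ done, ∀ a ∈ T.out k, (k, a) ∈ Q ∨ (k, a) ∈ extra
  closed : ∀ l ∈ Q, ∀ k', (T.uniform l.1 l.2).val = some k' → k' ∈ L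
  good : ∀ k ∈ L, G k
  exit : ∀ l, s.exit = some l → l ∈ Q ∧ (T.uniform l.1 l.2).val = none
  exit_ne : ∀ l ∈ Q, (T.uniform l.1 l.2).val = none → s.exit ≠ none

theorem ExploreInv.exploreLoc {G : Node → Prop} {done : Finset Node} {extra : List (Node × R)}
    {L : List Node} {Q : List (Node × R)} {s : Explore Node R D} {k : Node}
    (hG : ∀ k', G k → (T.uniform k a).val = some k' → G k')
    (h : ExploreInv T G n done ((k, a) :: extra) L Q s) (hk : k ∈ done) (ha : a ∈ T.out k)
    (he : (k, a) ∉ extra) :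
    ∃ L' Q', ExploreInv T G n done extra L' Q' (T.exploreLoc k s a).val := by
  have hkL : k ∈ L := (h.mem_iff k).2 (.inl hk)
  have hQ : (k, a) ∉ Q := fun hc => (h.of_mem _ hc).2.2 List.mem_cons_self
  have hnd : ((k, a) :: Q).Nodup := List.nodup_cons.2 ⟨hQ, h.nodup_locs⟩
  have hof : ∀ l ∈ (k, a) :: Q, l.1 ∈ done ∧ l.2 ∈ T.out l.1 ∧ l ∉ extra := by
    intro l hl
    rcases List.mem_cons.1 hl with rfl | hl
    · exact ⟨hk, ha, he⟩
    · obtain ⟨h1, h2, h3⟩ := h.of_mem l hl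
      exact ⟨h1, h2, fun hc => h3 (List.mem_cons_of_mem _ hc)⟩
  have hmem : ∀ k' ∈ done, ∀ b ∈ T.out k', (k', b) ∈ (k, a) :: Q ∨ (k', b) ∈ extra := by
    intro k' hk' b hb
    rcases h.mem k' hk' b hb with h1 | h1
    · exact .inl (List.mem_cons_of_mem _ h1)
    · rcases List.mem_cons.1 h1 with h1 | h1
      exacts [.inl (h1 ▸ List.mem_cons_self), .inr h1]
  unfold Tables.exploreLoc
  simp only [Timed.val_bind]
  cases hu : (T.uniform k a).val with
  | none =>
    refine ⟨L, (k, a) :: Q, h.verts, by simp [h.edges, hu], h.seen, h.nodup, hnd, h.nodup_stack,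
      h.mem_iff, h.notMem_done, h.mem_init, hof, hmem, fun l hl k' hk' => ?_, h.good,
      fun l hl => ?_, fun l hl hl' => by simp⟩
    · rcases List.mem_cons.1 hl with rfl | hl
      · rw [hu] at hk'; simp at hk'
      · exact h.closed l hl k' hk'
    · obtain rfl : (k, a) = l := by simpa using hl
      exact ⟨List.mem_cons_self, hu⟩
  | some k₁ =>
    have hexit : ∀ l, s.exit = some l → l ∈ (k, a) :: Q ∧ (T.uniform l.1 l.2).val = none :=
      fun l hl => ⟨List.mem_cons_of_mem _ (h.exit l hl).1, (h.exit l hl).2⟩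
    have hexit' : ∀ l ∈ (k, a) :: Q, (T.uniform l.1 l.2).val = none → s.exit ≠ none := by
      intro l hl hl'
      rcases List.mem_cons.1 hl with rfl | hl
      · rw [hu] at hl'; simp at hl'
      · exact h.exit_ne l hl hl'
    by_cases hs : s.seen k₁ = true
    · simp only [Timed.val_step, hs, if_true]
      refine ⟨L, (k, a) :: Q, h.verts, by simp [h.edges, hu], h.seen, h.nodup, hnd, h.nodup_stack,
        h.mem_iff, h.notMem_done, h.mem_init, hof, hmem, fun l hl k' hk' => ?_, h.good,
        hexit, hexit'⟩
      rcases List.mem_cons.1 hl with rfl | hl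
      · obtain rfl : k₁ = k' := by simpa [hu] using hk'
        exact (h.seen _).1 hs
      · exact h.closed l hl k' hk'
    · simp only [Timed.val_step, hs]
      have hk₁ : k₁ ∉ L := fun hc => hs ((h.seen _).2 hc)
      have hk₁s : k₁ ∉ s.stack := fun hc => hk₁ ((h.mem_iff _).2 (.inr hc))
      have hk₁d : k₁ ∉ done := fun hc => hk₁ ((h.mem_iff _).2 (.inl hc))
      refine ⟨k₁ :: L, (k, a) :: Q, by simp [h.verts], by simp [h.edges, hu], fun j => ?_,
        List.nodup_cons.2 ⟨hk₁, h.nodup⟩, hnd, List.nodup_cons.2 ⟨hk₁s, h.nodup_stack⟩,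
        fun j => ?_, fun j hj => ?_, List.mem_cons_of_mem _ h.mem_init, hof, hmem,
        fun l hl k' hk' => ?_, fun j hj => ?_, hexit, hexit'⟩
      · by_cases hj : j = k₁
        · subst hj; simp
        · simp [hj, h.seen]
      · simp only [Bool.false_eq_true, if_false, List.mem_cons, h.mem_iff]
        tauto
      · rcases List.mem_cons.1 hj with rfl | hj
        exacts [hk₁d, h.notMem_done j hj]
      · rcases List.mem_cons.1 hl with rfl | hl
        · obtain rfl : k₁ = k' := by simpa [hu] using hk'
          exact List.mem_cons_self
        · exact List.mem_cons_of_mem _ (h.closed l hl k' hk')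
      · rcases List.mem_cons.1 hj with rfl | hj
        exacts [hG _ (h.good k hkL) hu, h.good j hj]

/-- The cost of exploring a node. -/
def exploreCost (N : Negotiation Proc Node R) (k : Node) : ℕ :=
  2 + (N.out k).card * (2 * (N.dom k).card + 3)

theorem explore_spec (hN : N.SoundDet) (h : T.Represents N sem) {G : Node → Prop}
    (hGN : ∀ k, G k → k ∈ N.nodes)
    (hG : ∀ k a k', G k → a ∈ N.out k → MovesTo N k a k' → G k') (fuel : ℕ) {done : Finset Node}
    (hdone : done ⊆ N.nodes)
    {L : List Node} {Q : List (Node × R)} {s : Explore Node R D}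
    (hs : ExploreInv T G n done [] L Q s) (hf : N.nodes.card ≤ fuel + done.card) :
    ∃ done' L' Q', ExploreInv T G n done' [] L' Q' (T.explore fuel s).val ∧
      (T.explore fuel s).val.stack = [] ∧
      (T.explore fuel s).time ≤ 1 + ∑ k ∈ N.nodes \ done, exploreCost N k := by
  induction fuel generalizing done L Q s with
  | zero =>
    obtain rfl := Finset.eq_of_subset_of_card_le hdone (by omega)
    refine ⟨_, L, Q, hs, List.eq_nil_iff_forall_not_mem.2 fun k hk => ?_, by simp [explore]⟩
    exact hs.notMem_done k hk (hGN k (hs.good k ((hs.mem_iff k).2 (.inr hk))))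
  | succ fuel ih =>
    cases hst : s.stack with
    | nil =>
      have : T.explore (fuel + 1) s = Timed.step s := by rw [explore, hst]
      rw [this]
      exact ⟨done, L, Q, hs, hst, by simp⟩
    | cons k rest =>
      have hkst : k ∈ s.stack := by rw [hst]; simp
      have hkL := (hs.mem_iff k).2 (.inr hkst)
      have hkG := hs.good k hkL
      have hkN := hGN k hkG
      have hkd := hs.notMem_done k hkst
      have hnd := hs.nodup_stack
      rw [hst, List.nodup_cons] at hnd
      have heq : T.explore (fuel + 1) s = Timed.charge 1
          ((Timed.forIn (T.exploreLoc k) (T.out k) { s with stack := rest }).bind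
            (T.explore fuel)) := by rw [explore, hst]
      have hstart : ExploreInv T G n (insert k done) ((T.out k).map fun a => (k, a)) L Q
          { s with stack := rest } := by
        refine ⟨hs.verts, hs.edges, hs.seen, hs.nodup, hs.nodup_locs, hnd.2, fun j => ?_,
          fun j hj => ?_, hs.mem_init, fun l hl => ?_, fun j hj b hb => ?_, hs.closed, hs.good,
          hs.exit, hs.exit_ne⟩
        · rw [hs.mem_iff, hst, List.mem_cons, Finset.mem_insert]
          tauto
        · rw [Finset.mem_insert, not_or]
          exact ⟨fun he => hnd.1 (he ▸ hj), hs.notMem_done j (by rw [hst]; exact List.mem_cons_of_mem _ hj)⟩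
        · obtain ⟨h1, h2, -⟩ := hs.of_mem l hl
          refine ⟨Finset.mem_insert_of_mem h1, h2, fun hc => ?_⟩
          obtain ⟨b, -, rfl⟩ := List.mem_map.1 hc
          exact hkd h1
        · rcases Finset.mem_insert.1 hj with rfl | hj
          · exact .inr (List.mem_map.2 ⟨b, hb, rfl⟩)
          · exact (hs.mem j hj b hb).elim .inl fun h => by simp at h
      obtain ⟨⟨-, -, L', Q', hI⟩, ht⟩ := Timed.forIn_spec (T.exploreLoc k)
        (fun l s => l.Nodup ∧ (∀ b ∈ l, b ∈ T.out k) ∧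
          ∃ L Q, ExploreInv T G n (insert k done) (l.map fun a => (k, a)) L Q s)
        (fun _ => 2 * (N.dom k).card + 2)
        (fun b l s ⟨h1, h2, L, Q, h3⟩ => by
          have hb := h2 b List.mem_cons_self
          have hb' := (h.mem_out k hkN b).1 hb
          obtain ⟨hu, htu⟩ := uniform_spec hN h hkN hb'
          refine ⟨⟨(List.nodup_cons.1 h1).2, fun c hc => h2 c (List.mem_cons_of_mem _ hc), ?_⟩, ?_⟩
          · refine h3.exploreLoc (fun k' hk hk' => hG k b k' hk hb' ((hu k').1 hk'))
              (Finset.mem_insert_self _ _) hb ?_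
            simpa using (List.nodup_cons.1 h1).1
          · unfold Tables.exploreLoc
            simp only [Timed.time_bind]
            split <;> simp only [Timed.time_step] <;> omega)
        (T.out k) { s with stack := rest } ⟨h.out_nodup k hkN, fun _ hb => hb, L, Q, hstart⟩
      obtain ⟨done', L'', Q'', g1, g2, g3⟩ := ih (Finset.insert_subset hkN hdone) hI
        (by rw [Finset.card_insert_of_notMem hkd]; omega)
      rw [heq]
      refine ⟨done', L'', Q'', g1, g2, ?_⟩
      have hsum : ∑ j ∈ N.nodes \ done, exploreCost N j =
          exploreCost N k + ∑ j ∈ N.nodes \ insert k done, exploreCost N j := by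
        rw [← Finset.sum_insert (by simp)]
        congr 1
        ext j
        simp only [Finset.mem_sdiff, Finset.mem_insert]
        by_cases hj : j = k
        · subst hj; simp [hkN, hkd]
        · simp [hj]
      rw [sum_map_const, h.length_out hkN] at ht
      simp only [Timed.time_charge, Timed.time_bind]
      rw [hsum]
      have : exploreCost N k = 2 + (N.out k).card * (1 + (2 * (N.dom k).card + 2)) := by
        unfold exploreCost; ring
      omega

end Tables

namespace Tables

variable {Proc Node R D : Type*} [DecidableEq Proc] [DecidableEq Node] [DecidableEq R]
  {T : Tables Proc Node R D} {N : Negotiation Proc Node R} {sem : Node × R → D → D}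
  {n : Node} {a : R} {C₀ C : Config Proc Node} {X : Finset Proc}

/-- A location that does not move to a node with the same domain leaves the replication. -/
theorem quiet_after (hN : N.SoundDet) (hX : N.LocsReduced X) {E : Config Proc Node}
    (hE : N.Reachable E) {k : Node} (hk : N.Enabled E k) (hkX : N.dom k = X) (ha : a ∈ N.out k)
    (hm : ∀ k', ¬ MovesTo N k a k') : N.Quiet X (N.after E k a) := by
  rcases hX.enabled_or_quiet hE hk hkX ha with ⟨j, hjf, hjX, hj⟩ | hq
  · refine absurd ⟨hjf, hjX.trans hkX.symm, fun p hp => ?_⟩ (hm j)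
    rw [← after_of_mem (N := N) (C := E) hp]
    exact hj.eq_singleton hN (hE.after hk ha) (by rw [hjX, ← hkX]; exact hp)
  · exact hq

theorem MovesTo.enabled (hN : N.SoundDet) {E : Config Proc Node} {k k' : Node}
    (hk : N.Enabled E k) (ha : a ∈ N.out k) (hm : MovesTo N k a k') :
    N.Enabled (N.after E k a) k' := by
  obtain ⟨-, h2, h3⟩ := hm
  obtain ⟨p, hp⟩ := hN.wf.dom_nonempty k hk.1
  refine ⟨(hN.wf.δ_mem k hk.1 a ha p hp k' (by rw [h3 p hp]; rfl)).1, fun q hq => ?_⟩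
  rw [h2] at hq
  rw [after_of_mem hq, h3 q hq]
  rfl

/-- The node `k` is enabled after some run from `C₀` of nodes with domain included in `X`. -/
def Entered (N : Negotiation Proc Node R) (X : Finset Proc) (C₀ : Config Proc Node) (k : Node) :
    Prop :=
  N.dom k = X ∧ k ≠ N.fin ∧ ∃ w E, (∀ l ∈ w, N.dom l.1 ⊆ X) ∧ N.Run C₀ w E ∧ N.Enabled E k

theorem Entered.mem {k : Node} (h : Entered N X C₀ k) : k ∈ N.nodes := by
  obtain ⟨-, -, w, E, -, -, hE⟩ := h
  exact hE.1

theorem Entered.movesTo (hN : N.SoundDet) {k k' : Node} (h : Entered N X C₀ k)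
    (ha : a ∈ N.out k) (hm : MovesTo N k a k') : Entered N X C₀ k' := by
  obtain ⟨h1, h2, w, E, h3, h4, h5⟩ := h
  refine ⟨hm.2.1.trans h1, hm.1, w ++ [(k, a)], N.after E k a, fun l hl => ?_,
    h4.append (.cons h5 ha (.nil _)), hm.enabled hN h5 ha⟩
  rcases List.mem_append.1 hl with hl | hl
  · exact h3 l hl
  · obtain rfl : l = (k, a) := by simpa using hl
    exact h1.subset

/-- The flow-graph found by an exploration. -/
def exploreGraph (n : Node) (s : Explore Node R D) : FlowGraph (Option Node) D :=
  ⟨s.verts, s.edges, some n, none⟩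

section

variable {done : Finset Node} {L : List Node} {Q : List (Node × R)} {s : Explore Node R D}
  {G : Node → Prop}

theorem ExploreInv.isPath_none (hs : ExploreInv T G n done [] L Q s)
    {π : List (Option Node × (D → D) × Option Node)} {v : Option Node}
    (h : (exploreGraph n s).IsPath none π v) : π = [] := by
  cases π with
  | nil => rfl
  | cons e π =>
    obtain ⟨h1, h2, -⟩ := h
    simp only [exploreGraph, hs.edges, List.mem_map] at h1
    obtain ⟨l, -, rfl⟩ := h1
    simp at h2

theorem ExploreInv.mem_locs (hs : ExploreInv T G n done [] L Q s) (hst : s.stack = []) {k : Node}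
    (hk : k ∈ L) (ha : a ∈ T.out k) : (k, a) ∈ Q := by
  have := (hs.mem_iff k).1 hk
  rw [hst] at this
  exact (hs.mem k (by simpa using this) a ha).elim id fun h => by simp at h

theorem ExploreInv.run_of_path (hN : N.SoundDet) (h : T.Represents N sem) (hX : N.LocsReduced X)
    (hs : ExploreInv T G n done [] L Q s) {E F : Config Proc Node}
    (hE : N.Reachable E) (hF : N.Reachable F) (hFq : N.Quiet X F) (hag : ∀ p ∉ X, E p = F p)
    {k : Node} (hk : N.Enabled E k) (hkX : N.dom k = X)
    {π : List (Option Node × (D → D) × Option Node)}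
    (hπ : (exploreGraph n s).IsPath (some k) π none) :
    ∃ w, (∀ l ∈ w, N.dom l.1 ⊆ X) ∧ N.Run E w F ∧ FlowGraph.semPath π = semRun sem w := by
  induction π generalizing E k with
  | nil => exact absurd hπ (by simp [FlowGraph.IsPath])
  | cons e π ih =>
    obtain ⟨h1, h2, h3⟩ := hπ
    simp only [exploreGraph, hs.edges, List.mem_map] at h1
    obtain ⟨⟨k', a⟩, hl, rfl⟩ := h1
    obtain rfl : k' = k := by simpa using h2
    have ha := (h.mem_out k' hk.1 a).1 (hs.of_mem _ hl).2.1
    have hag' : ∀ p ∉ X, N.after E k' a p = F p := fun p hp => by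
      rw [after_of_notMem (by rwa [hkX]), hag p hp]
    have hu := (uniform_spec hN h hk.1 ha).1
    have hval := h.val_eq k' hk.1 a ha
    cases hu' : (T.uniform k' a).val with
    | none =>
      rw [hu'] at h3
      obtain rfl := hs.isPath_none h3
      have hq := quiet_after hN hX hE hk hkX ha fun j hj => by
        have := (hu j).2 hj
        rw [hu'] at this; simp at this
      obtain rfl := hq.unique hN (hE.after hk ha) hF hFq hag'
      refine ⟨[(k', a)], by simp [hkX], .cons hk ha (.nil _), ?_⟩
      simp [FlowGraph.semPath, semRun, hval]
    | some j =>
      have hm := (hu j).1 hu'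
      rw [hu'] at h3
      obtain ⟨w, i1, i2, i3⟩ := ih (hE.after hk ha) hag' (hm.enabled hN hk ha) (hm.2.1.trans hkX) h3
      refine ⟨(k', a) :: w, fun l hl => ?_, .cons hk ha i2, ?_⟩
      · rcases List.mem_cons.1 hl with rfl | hl
        exacts [hkX.subset, i1 l hl]
      · rw [FlowGraph.semPath, semRun, i3, hval]

theorem ExploreInv.path_of_run (hN : N.SoundDet) (h : T.Represents N sem) (hX : N.LocsReduced X)
    (hs : ExploreInv T G n done [] L Q s) (hst : s.stack = []) {E F : Config Proc Node}
    (hE : N.Reachable E) (hFq : N.Quiet X F) {k : Node} (hkL : k ∈ L)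
    (hk : N.Enabled E k) (hkX : N.dom k = X) (hkf : k ≠ N.fin) {w : List (Node × R)}
    (hw : N.Run E w F) (hwX : ∀ l ∈ w, N.dom l.1 ⊆ X) :
    ∃ π, (exploreGraph n s).IsPath (some k) π none ∧ FlowGraph.semPath π = semRun sem w := by
  induction hw generalizing k with
  | nil E => exact absurd hkX.subset (hFq k hk hkf)
  | @cons E F m b w h1 h2 h3 ih =>
    obtain rfl := hk.eq_of_subset hN hE h1 (hkX ▸ hwX _ List.mem_cons_self)
    have hQ := hs.mem_locs hst hkL ((h.mem_out m h1.1 b).2 h2)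
    have hu := (uniform_spec hN h hk.1 h2).1
    have hval := h.val_eq m hk.1 b h2
    have hedge : (some m, T.val m b, (T.uniform m b).val) ∈ (exploreGraph n s).edges := by
      simp only [exploreGraph, hs.edges]
      exact List.mem_map.2 ⟨_, hQ, rfl⟩
    cases hu' : (T.uniform m b).val with
    | none =>
      have hq := quiet_after hN hX hE hk hkX h2 fun j hj => by
        have := (hu j).2 hj
        rw [hu'] at this; simp at this
      have hnil : w = [] := by
        cases h3 with
        | nil => rfl
        | cons h4 h5 h6 =>
          exact absurd (hwX _ (List.mem_cons_of_mem _ List.mem_cons_self))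
            (hq _ h4 (hN.ne_fin_of_mem_out h5))
      subst hnil
      refine ⟨[_], ⟨hedge, rfl, hu'⟩, ?_⟩
      simp [FlowGraph.semPath, semRun, hval]
    | some j =>
      have hm := (hu j).1 hu'
      obtain ⟨π, i1, i2⟩ := ih (hE.after h1 h2) hFq (hs.closed _ hQ j hu') (hm.enabled hN hk h2)
        (hm.2.1.trans hkX) hm.1 fun l hl => hwX l (List.mem_cons_of_mem _ hl)
      refine ⟨_ :: π, ⟨hedge, rfl, by rw [hu']; exact i1⟩, ?_⟩
      rw [FlowGraph.semPath, semRun, i2, hval]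

theorem ExploreInv.exists_leaving (hs : ExploreInv T G n done [] L Q s) {k : Node}
    {π : List (Option Node × (D → D) × Option Node)}
    (hπ : (exploreGraph n s).IsPath (some k) π none) : s.exit ≠ none := by
  induction π generalizing k with
  | nil => exact absurd hπ (by simp [FlowGraph.IsPath])
  | cons e π ih =>
    obtain ⟨h1, h2, h3⟩ := hπ
    simp only [exploreGraph, hs.edges, List.mem_map] at h1
    obtain ⟨l, hl, rfl⟩ := h1
    cases hu : (T.uniform l.1 l.2).val with
    | none => exact hs.exit_ne l hl hu
    | some j => rw [hu] at h3; exact ih h3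

end

theorem exploreInv_init {G : Node → Prop} (hG : G n) : ExploreInv T G n ∅ [] [n] []
    ⟨Function.update (fun _ => false) n true, [n], [some n, none], [], none⟩ where
  verts := rfl
  edges := rfl
  seen := fun k => by
    by_cases hk : k = n
    · subst hk; simp
    · simp [hk]
  nodup := List.nodup_singleton n
  nodup_locs := List.nodup_nil
  nodup_stack := List.nodup_singleton n
  mem_iff := by simp
  notMem_done := by simp
  mem_init := by simp
  of_mem := by simp
  mem := by simp
  closed := by simp
  good := by simpa using hG
  exit := by simp
  exit_ne := by simp

theorem summarize_spec [CompleteLattice D] {N₀ : Negotiation Proc Node R} {sem₀ : Node × R → D → D}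
    {m K : ℕ} {solve : FlowGraph (Option Node) D → Timed (D → D)} (hsolve : Solves solve N₀ sem₀ m K)
    (hm : N.size ≤ m) (hlab : Labelled N₀ sem₀ N sem) (hN : N.SoundDet)
    (h : T.Represents N sem) (hX : N.LocsReduced (N.dom n)) (hf : n ≠ N.fin)
    (h₀ : N.IsFirst n C₀) (hC : N.IsLastNode n C₀ C) :
    (T.summarize solve n).val.1 = (N.subNode n C₀ C).mop (subSem sem) ∧
      (∀ p ∈ N.dom n, C p = {k | (T.summarize solve n).val.2 p = some k}) ∧
      Transformer N₀ sem₀ (T.summarize solve n).val.1 ∧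
      (T.summarize solve n).time ≤ K + 14 * N.size := by
  have hn := h₀.enabled
  have hrC : N.Reachable C := by
    obtain ⟨⟨u, -, hr⟩, -⟩ := hC
    exact h₀.1.run hr
  have hag : ∀ p ∉ N.dom n, C p = C₀ p := fun p hp => by
    obtain ⟨⟨u, hu, hr⟩, -⟩ := hC
    exact hr.eq_of_notMem hu hp
  obtain ⟨done, L, Q, hs, hst, htime⟩ := explore_spec hN h
    (G := Entered N (N.dom n) C₀) (fun k hk => hk.mem)
    (fun k a k' hk ha hm => hk.movesTo hN ha hm) T.nodes.length (Finset.empty_subset _)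
    (exploreInv_init ⟨rfl, hf, [], C₀, by simp, .nil _, hn⟩)
    (by rw [h.length_nodes]; exact Nat.le_add_right _ _)
  set s := (T.explore T.nodes.length
    ⟨Function.update (fun _ => false) n true, [n], [some n, none], [], none⟩).val with hsdef
  have hsub : ∀ k ∈ L, k ∈ N.nodes ∧ k ≠ N.fin := fun k hk => ⟨(hs.good k hk).mem, (hs.good k hk).2.1⟩
  have hQ : ∀ l ∈ Q, l.1 ∈ L ∧ l.2 ∈ N.out l.1 := fun l hl => by
    have h1 := (hs.mem_iff l.1).2 (.inl (hs.of_mem l hl).1)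
    exact ⟨h1, (h.mem_out l.1 (hsub _ h1).1 l.2).1 (hs.of_mem l hl).2.1⟩
  have hsize : (exploreGraph n s).size ≤ N.size := by
    have h1 : (exploreGraph n s).size = L.length + 1 + Q.length := by
      simp [exploreGraph, FlowGraph.size, hs.verts, hs.edges]
    have h2 := sum_lt_size hN (s := L.toFinset) (fun x hx => (hsub x (List.mem_toFinset.1 hx)).1)
      (fun hf => (hsub _ (List.mem_toFinset.1 hf)).2 rfl)
    have h3 : Q.length ≤ ∑ k ∈ L.toFinset, (N.out k).card := by
      rw [← List.toFinset_card_of_nodup hs.nodup_locs, ← Finset.card_sigma]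
      refine Finset.card_le_card_of_injOn (fun l => ⟨l.1, l.2⟩) (fun l hl => ?_) ?_
      · have := hQ l (List.mem_toFinset.1 hl)
        simpa using this
      · rintro ⟨k, a⟩ - ⟨k', a'⟩ - he
        simpa using he
    have h4 : L.length = ∑ k ∈ L.toFinset, 1 := by
      rw [Finset.sum_const, List.toFinset_card_of_nodup hs.nodup]; simp
    have h5 : ∑ k ∈ L.toFinset, 1 + ∑ k ∈ L.toFinset, (N.out k).card ≤
        ∑ k ∈ L.toFinset, (N.dom k).card * (1 + (N.out k).card) := by
      rw [← Finset.sum_add_distrib]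
      refine Finset.sum_le_sum fun k hk => ?_
      have := one_le_card_dom hN (hsub k (List.mem_toFinset.1 hk)).1
      nlinarith
    omega
  have hedge : ∀ e ∈ (exploreGraph n s).edges, Transformer N₀ sem₀ e.2.1 := by
    intro e he
    simp only [exploreGraph, hs.edges, List.mem_map] at he
    obtain ⟨l, hl, rfl⟩ := he
    obtain ⟨h1, h2⟩ := hQ l hl
    rw [h.val_eq l.1 (hsub _ h1).1 l.2 h2]
    exact hlab l ⟨(hsub _ h1).1, h2⟩
  have hmop : (exploreGraph n s).mop = (N.subNode n C₀ C).mop (subSem sem) := by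
    rw [mop_subNode hN hX hf h₀ hC]
    refine congrArg sSup (Set.ext fun g => ⟨?_, ?_⟩)
    · rintro ⟨π, hπ, rfl⟩
      obtain ⟨w, h1, h2, h3⟩ := hs.run_of_path hN h hX h₀.1 hrC hC.2 (fun p hp => (hag p hp).symm)
        hn rfl hπ
      exact ⟨w, ⟨h1, h2⟩, h3.symm⟩
    · rintro ⟨w, ⟨h1, h2⟩, rfl⟩
      obtain ⟨π, h3, h4⟩ := hs.path_of_run hN h hX hst h₀.1 hC.2 hs.mem_init hn rfl hf h2 h1
      exact ⟨π, h3, h4.symm⟩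
  obtain ⟨hval, hcost⟩ := hsolve (exploreGraph n s) (hsize.trans hm) hedge
  have hexit : s.exit ≠ none := by
    obtain ⟨u, hu, hr⟩ := hC.1
    obtain ⟨π, hπ, -⟩ := hs.path_of_run hN h hX hst h₀.1 hC.2 hs.mem_init hn rfl hf hr hu
    exact hs.exists_leaving hπ
  obtain ⟨⟨k, a⟩, hka⟩ := Option.ne_none_iff_exists'.1 hexit
  obtain ⟨hl, hu⟩ := hs.exit _ hka
  obtain ⟨hkL, ha⟩ := hQ _ hl
  obtain ⟨hkX, hkf, w, E, hwX, hw, hk⟩ := hs.good _ hkL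
  have hCE : N.after E k a = C := by
    have hE := h₀.1.run hw
    refine (quiet_after hN hX hE hk hkX ha fun j hj => ?_).unique hN (hE.after hk ha) hrC hC.2
      fun p hp => ?_
    · have := ((uniform_spec hN h hk.1 ha).1 j).2 hj
      rw [hu] at this; simp at this
    · rw [after_of_notMem (by rwa [hkX]), hag p hp, hw.eq_of_notMem hwX hp]
  have hpos := Timed.forIn_spec (fun (pos : Proc → Option Node) p =>
      Timed.step (Function.update pos p (T.next k a p)))
    (fun l pos => ∀ p ∈ T.dom n, p ∉ l → pos p = T.next k a p) (fun _ => 1)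
    (fun p l pos hI => ⟨fun q hq hql => by
      by_cases hqp : q = p
      · subst hqp; simp
      · simp only [Timed.val_step, Function.update_of_ne hqp]
        exact hI q hq (by simp [hqp, hql]), le_rfl⟩)
    (T.dom n) (fun _ => none) fun p hp hp' => absurd hp hp'
  rw [sum_map_const, h.length_dom hn.1] at hpos
  have hv : (T.summarize solve n).val = ((solve (exploreGraph n s)).val,
      (Timed.forIn (fun (pos : Proc → Option Node) p =>
        Timed.step (Function.update pos p (T.next k a p))) (T.dom n) fun _ => none).val) := by
    simp only [summarize, Timed.val_bind, Timed.val_charge]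
    rw [← hsdef, hka]
    rfl
  have ht : (T.summarize solve n).time = T.blankCost + (T.explore T.nodes.length
      ⟨Function.update (fun _ => false) n true, [n], [some n, none], [], none⟩).time +
      ((solve (exploreGraph n s)).time + ((Timed.forIn (fun (pos : Proc → Option Node) p =>
        Timed.step (Function.update pos p (T.next k a p))) (T.dom n) fun _ => none).time + 1)) := by
    simp only [summarize, Timed.time_bind, Timed.val_charge, Timed.time_charge]
    rw [← hsdef, hka]
    rfl
  refine ⟨by rw [hv, ← hmop, ← hval], fun p hp => ?_, ?_, ?_⟩
  · have hpk : p ∈ N.dom k := by rwa [hkX]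
    rw [hv, ← hCE, after_of_mem hpk, h.next_eq k hk.1 a ha p hpk]
    simp only
    rw [hpos.1 p ((h.mem_dom n hn.1 p).2 hp) (by simp)]
  · rw [hv]
    simp only [hval]
    exact .mop _ hedge
  · have h1 := blankCost_le hN h
    have h2 := card_dom_le hn.1
    have h3 : (N.dom n).card ≤ N.size := le_trans (by nlinarith) h2
    have h4 := one_le_card_dom hN hn.1
    have h5 : ∑ k ∈ N.nodes, exploreCost N k ≤ 5 * N.size := sum_le_mul_size fun k hk => by
      have := one_le_card_dom hN hk
      unfold exploreCost
      nlinarith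
    rw [Finset.sdiff_empty] at htime
    rw [ht]
    omega

end Tables

namespace Tables

variable {Proc Node R D : Type*} [DecidableEq Proc] [DecidableEq Node] [DecidableEq R]
  {T : Tables Proc Node R D} {N : Negotiation Proc Node R} {sem : Node × R → D → D}
  {n : Node} {a : R} {X : Finset Proc}

/-! ### The body of the third for-loop -/

theorem installNode_spec (h : T.Represents N sem) (hn : n ∈ N.nodes) (hne : (N.out n).Nonempty)
    (f : D → D) (pos : Proc → Option Node) {C : Config Proc Node}
    (hC : ∀ p ∈ N.dom n, C p = {k | pos p = some k}) :
    ∃ b ∈ N.out n, (T.installNode (n, f, pos)).val.Represents (N.redNode n b C)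
      (Function.update sem (n, b) f) ∧
      (T.installNode (n, f, pos)).time ≤ 2 + 2 * (N.dom n).card := by
  cases ho : T.out n with
  | nil =>
    obtain ⟨b, hb⟩ := hne
    rw [← h.mem_out n hn, ho] at hb
    simp at hb
  | cons b w =>
    have hb : b ∈ N.out n := by rw [← h.mem_out n hn, ho]; simp
    obtain ⟨s1, s2, s3, s4, s5⟩ := T.setTargets_spec n b pos
    have heq : T.installNode (n, f, pos) = (T.setTargets n b pos).bind fun T' =>
        Timed.step { (T'.setVal n b f) with out := Function.update T'.out n [b] } := by
      simp only [installNode, ho]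
    rw [heq]
    simp only [Timed.val_bind, Timed.val_step, Timed.time_bind, Timed.time_step]
    refine ⟨b, hb, ⟨s1.nodes ▸ h.nodes_nodup, fun k => ?_, s1.init.trans h.init_eq,
      s1.fin.trans h.fin_eq, fun k hk => ?_, fun k hk => ?_, fun k hk => ?_, fun k hk => ?_,
      fun k hk c hc p hp => ?_, fun k hk c hc => ?_⟩, by
        rw [h.length_dom hn] at s5; omega⟩
    · simp only [setVal, s1.nodes]; exact h.mem_nodes k
    · simp only [setVal, s1.dom]; exact h.dom_nodup k hk
    · simp only [setVal, s1.dom]; exact h.mem_dom k hk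
    · by_cases hkn : k = n
      · subst hkn; simp
      · simp only [Function.update_of_ne hkn, s1.out]; exact h.out_nodup k hk
    · by_cases hkn : k = n
      · subst hkn; simp [redNode]
      · simp only [redNode, Function.update_of_ne hkn, s1.out]; exact h.mem_out k hk
    · by_cases hkn : k = n
      · subst hkn
        obtain rfl : c = b := by simpa [redNode] using hc
        simp only [redNode, setVal, Function.update_self]
        rw [s4 p ((h.mem_dom k hk p).2 hp)]
        exact hC p hp
      · simp only [redNode, setVal, Function.update_of_ne hkn] at hc ⊢
        rw [s3 k c (by simp [hkn])]
        exact h.next_eq k hk c hc p hp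
    · by_cases hkn : k = n
      · subst hkn
        obtain rfl : c = b := by simpa [redNode] using hc
        simp [setVal]
      · simp only [redNode, setVal, Function.update_of_ne hkn] at hc ⊢
        rw [Function.update_of_ne (by simp [hkn]), s2]
        exact h.val_eq k hk c hc

theorem labelled_redNode [CompleteLattice D] {N₀ : Negotiation Proc Node R}
    {sem₀ : Node × R → D → D} (h : Labelled N₀ sem₀ N sem) {b : R} {f : D → D}
    (hf : Transformer N₀ sem₀ f) (C : Config Proc Node) :
    Labelled N₀ sem₀ (N.redNode n b C) (Function.update sem (n, b) f) := by
  rintro ⟨k, c⟩ ⟨h1, h2⟩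
  by_cases hkn : k = n
  · subst hkn
    obtain rfl : c = b := by simpa [redNode] using h2
    rwa [Function.update_self]
  · rw [Function.update_of_ne (by simp [hkn])]
    simp only [redNode, Function.update_of_ne hkn] at h2
    exact h _ ⟨h1, h2⟩

theorem card_out_redNode_le (hne : (N.out n).Nonempty) (b : R) (C : Config Proc Node) (k : Node) :
    ((N.redNode n b C).out k).card ≤ (N.out k).card := by
  by_cases hkn : k = n
  · subst hkn
    simpa [redNode] using hne.card_pos
  · simp [redNode, hkn]

/-! ### Graph search -/

/-- The invariant of the graph search: `done` is the set of the nodes explored, and `extra` is the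
set of transitions of these nodes that are still to be explored. -/
structure SearchInv (T : Tables Proc Node R D) (N : Negotiation Proc Node R) (done : Finset Node)
    (extra : Set (Node × R × Proc)) (s : (Node → Bool) × List Node) : Prop where
  seen : ∀ k, s.1 k = true ↔ k ∈ done ∨ k ∈ s.2
  nodup : s.2.Nodup
  notMem_done : ∀ k ∈ s.2, k ∉ done
  init : s.1 N.init = true
  reachable : ∀ k, s.1 k = true → N.ReachableNode k
  closed : ∀ k ∈ done, ∀ a ∈ N.out k, ∀ p ∈ N.dom k, (k, a, p) ∉ extra →
    ∀ k', T.next k a p = some k' → s.1 k' = true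

/-- Exploring one transition. -/
def searchStep (T : Tables Proc Node R D) (k : Node) (a : R) (s : (Node → Bool) × List Node)
    (p : Proc) : Timed ((Node → Bool) × List Node) :=
  match T.next k a p with
  | none => Timed.step s
  | some k' => Timed.step (if s.1 k' then s else (Function.update s.1 k' true, k' :: s.2))

theorem SearchInv.searchStep (hN : N.SoundDet) (h : T.Represents N sem) {done : Finset Node}
    {extra extra' : Set (Node × R × Proc)} {s : (Node → Bool) × List Node}
    (hs : SearchInv T N done extra s) {k : Node} {p : Proc} (hk : k ∈ done)
    (ha : a ∈ N.out k) (hp : p ∈ N.dom k) (he : extra ⊆ insert (k, a, p) extra') :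
    SearchInv T N done extra' (searchStep T k a s p).val ∧ (searchStep T k a s p).time ≤ 1 := by
  have hkr := hs.reachable k ((hs.seen k).2 (.inl hk))
  obtain ⟨k', hδ, hk', -⟩ := hkr.target hN ha hp
  have hnext : T.next k a p = some k' := by
    have h5 := h.next_eq k hkr.mem a ha p hp
    have : k' ∈ {m | T.next k a p = some m} := by rw [← h5, hδ]; rfl
    exact this
  have hcl : ∀ j ∈ done, ∀ b ∈ N.out j, ∀ q ∈ N.dom j, (j, b, q) ∉ extra' →
      ∀ j', T.next j b q = some j' → s.1 j' = true ∨ j' = k' := by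
    intro j hj b hb q hq hx j' hj'
    by_cases hjk : (j, b, q) = (k, a, p)
    · simp only [Prod.mk.injEq] at hjk
      obtain ⟨rfl, rfl, rfl⟩ := hjk
      rw [hnext] at hj'
      exact .inr (Option.some_injective _ hj').symm
    · exact .inl (hs.closed j hj b hb q hq (fun hc => (he hc).elim hjk hx) j' hj')
  unfold Tables.searchStep
  simp only [hnext]
  refine ⟨?_, le_rfl⟩
  simp only [Timed.val_step]
  by_cases hseen : s.1 k' = true
  · rw [if_pos hseen]
    refine ⟨hs.seen, hs.nodup, hs.notMem_done, hs.init, hs.reachable,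
      fun j hj b hb q hq hx j' hj' => ?_⟩
    rcases hcl j hj b hb q hq hx j' hj' with h1 | rfl
    exacts [h1, hseen]
  · rw [if_neg hseen]
    have h1 : k' ∉ done ∧ k' ∉ s.2 := by
      rw [hs.seen, not_or] at hseen
      exact hseen
    refine ⟨fun j => ?_, List.nodup_cons.2 ⟨h1.2, hs.nodup⟩, fun j hj => ?_, ?_, fun j hj => ?_,
      fun j hj b hb q hq hx j' hj' => ?_⟩
    · by_cases hj : j = k'
      · subst hj; simp
      · simp [hj, hs.seen]
    · rcases List.mem_cons.1 hj with rfl | hj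
      exacts [h1.1, hs.notMem_done j hj]
    · by_cases hi : N.init = k'
      · simp [hi]
      · simp [hi, hs.init]
    · by_cases hjk : j = k'
      · exact hjk ▸ hk'
      · exact hs.reachable j (by simpa [hjk] using hj)
    · by_cases hjk : j' = k'
      · simp [hjk]
      · have := (hcl j hj b hb q hq hx j' hj').resolve_right hjk
        simpa [hjk] using this

/-- The cost of exploring a node in the graph search. -/
def searchCost (N : Negotiation Proc Node R) (k : Node) : ℕ :=
  2 + (N.out k).card * (2 + 2 * (N.dom k).card)

theorem search_spec (hN : N.SoundDet) (h : T.Represents N sem) (fuel : ℕ) {done : Finset Node}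
    (hdone : done ⊆ N.nodes) {s : (Node → Bool) × List Node} (hs : SearchInv T N done ∅ s)
    (hf : N.nodes.card ≤ fuel + done.card) :
    ∃ done', SearchInv T N done' ∅ (T.search fuel s).val ∧ (T.search fuel s).val.2 = [] ∧
      (T.search fuel s).time ≤ 1 + ∑ k ∈ N.nodes \ done, searchCost N k := by
  induction fuel generalizing done s with
  | zero =>
    obtain rfl := Finset.eq_of_subset_of_card_le hdone (by omega)
    refine ⟨_, hs, List.eq_nil_iff_forall_not_mem.2 fun k hk => ?_, by simp [search]⟩
    exact hs.notMem_done k hk (hs.reachable k ((hs.seen k).2 (.inr hk))).mem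
  | succ fuel ih =>
    obtain ⟨seen, stack⟩ := s
    cases stack with
    | nil => exact ⟨done, hs, rfl, by simp [search]⟩
    | cons k rest =>
      have hkr := hs.reachable k ((hs.seen k).2 (.inr List.mem_cons_self))
      have hkN := hkr.mem
      have hkd := hs.notMem_done k List.mem_cons_self
      have hnd := List.nodup_cons.1 hs.nodup
      have heq : T.search (fuel + 1) (seen, k :: rest) = Timed.charge 1
          ((Timed.forIn (fun s a => Timed.forIn (searchStep T k a) (T.dom k) s) (T.out k)
            (seen, rest)).bind (T.search fuel)) := rfl
      have hstart : SearchInv T N (insert k done) {x | x.1 = k ∧ x.2.1 ∈ T.out k}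
          (seen, rest) := by
        refine ⟨fun j => ?_, hnd.2, fun j hj => ?_, hs.init, hs.reachable,
          fun j hj b hb q hq hx j' hj' => ?_⟩
        · have := hs.seen j
          simp only [List.mem_cons] at this
          rw [this, Finset.mem_insert]
          tauto
        · rw [Finset.mem_insert, not_or]
          exact ⟨fun he => hnd.1 (he ▸ hj), hs.notMem_done j (List.mem_cons_of_mem _ hj)⟩
        · by_cases hjk : j = k
          · subst hjk
            exact absurd ⟨rfl, (h.mem_out j hkN b).2 hb⟩ hx
          · exact hs.closed j ((Finset.mem_insert.1 hj).resolve_left hjk) b hb q hq (by simp) j' hj'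
      obtain ⟨⟨-, hI⟩, ht⟩ := Timed.forIn_spec
        (fun s a => Timed.forIn (searchStep T k a) (T.dom k) s)
        (fun l s => (∀ b ∈ l, b ∈ N.out k) ∧
          SearchInv T N (insert k done) {x | x.1 = k ∧ x.2.1 ∈ l} s)
        (fun _ => 1 + 2 * (N.dom k).card)
        (fun b l s ⟨h1, h2⟩ => by
          have hb := h1 b List.mem_cons_self
          obtain ⟨⟨-, g1⟩, g2⟩ := Timed.forIn_spec (searchStep T k b)
            (fun l' s => (∀ p ∈ l', p ∈ N.dom k) ∧ SearchInv T N (insert k done)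
              {x | x.1 = k ∧ (x.2.1 ∈ l ∨ x.2.1 = b ∧ x.2.2 ∈ l')} s) (fun _ => 1)
            (fun p l' s ⟨h3, h4⟩ => by
              obtain ⟨g3, g4⟩ := h4.searchStep hN h
                (extra' := {x | x.1 = k ∧ (x.2.1 ∈ l ∨ x.2.1 = b ∧ x.2.2 ∈ l')})
                (Finset.mem_insert_self k done) hb (h3 p List.mem_cons_self) (by
                  rintro ⟨j, c, q⟩ ⟨rfl, h5⟩
                  simp only [List.mem_cons] at h5
                  rcases h5 with h5 | ⟨rfl, rfl | h5⟩
                  · exact .inr ⟨rfl, .inl h5⟩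
                  · exact .inl rfl
                  · exact .inr ⟨rfl, .inr ⟨rfl, h5⟩⟩)
              exact ⟨⟨fun q hq => h3 q (List.mem_cons_of_mem _ hq), g3⟩, g4⟩)
            (T.dom k) s ⟨fun p hp => (h.mem_dom k hkN p).1 hp,
              h2.seen, h2.nodup, h2.notMem_done, h2.init, h2.reachable,
              fun j hj c hc q hq hx => h2.closed j hj c hc q hq fun hx' => hx (by
                obtain ⟨rfl, h5⟩ := hx'
                rcases List.mem_cons.1 h5 with h5 | h5
                · exact ⟨rfl, .inr ⟨h5, (h.mem_dom j hkN q).2 hq⟩⟩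
                · exact ⟨rfl, .inl h5⟩)⟩
          rw [sum_map_const, h.length_dom hkN] at g2
          refine ⟨⟨fun c hc => h1 c (List.mem_cons_of_mem _ hc), ?_⟩, by omega⟩
          convert g1 using 1
          ext x
          simp)
        (T.out k) (seen, rest) ⟨fun b hb => (h.mem_out k hkN b).1 hb, hstart⟩
      have hI' : SearchInv T N (insert k done) ∅ (Timed.forIn (fun s a => Timed.forIn
          (searchStep T k a) (T.dom k) s) (T.out k) (seen, rest)).val := by
        convert hI using 1
        ext x
        simp
      obtain ⟨done', g1, g2, g3⟩ := ih (Finset.insert_subset hkN hdone) hI'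
        (by rw [Finset.card_insert_of_notMem hkd]; omega)
      rw [heq]
      refine ⟨done', g1, g2, ?_⟩
      have hsum : ∑ j ∈ N.nodes \ done, searchCost N j =
          searchCost N k + ∑ j ∈ N.nodes \ insert k done, searchCost N j := by
        rw [← Finset.sum_insert (by simp)]
        congr 1
        ext j
        simp only [Finset.mem_sdiff, Finset.mem_insert]
        by_cases hj : j = k
        · subst hj; simp [hkN, hkd]
        · simp [hj]
      rw [sum_map_const, h.length_out hkN] at ht
      simp only [Timed.time_charge, Timed.time_bind]
      rw [hsum]
      have : searchCost N k = 2 + (N.out k).card * (1 + (1 + 2 * (N.dom k).card)) := by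
        unfold searchCost; ring
      omega

theorem reach_spec (hN : N.SoundDet) (h : T.Represents N sem) :
    (∀ k, T.reach.val k = true ↔ N.ReachableNode k) ∧ T.reach.time ≤ 7 * N.size := by
  obtain ⟨done, hs, hst, ht⟩ := search_spec hN h T.nodes.length (Finset.empty_subset _)
    (s := (Function.update (fun _ => false) T.init true, [T.init])) (by
      rw [h.init_eq]
      refine ⟨fun j => ?_, List.nodup_singleton _, by simp, by simp, fun j hj => ?_, by simp⟩
      · by_cases hj : j = N.init
        · simp [hj]
        · simp [hj]
      · by_cases hji : j = N.init
        · exact hji ▸ hN.reachableNode_init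
        · simp [hji] at hj)
    (by rw [h.length_nodes]; exact Nat.le_add_right _ _)
  set s := (T.search T.nodes.length (Function.update (fun _ => false) T.init true, [T.init])).val
    with hsdef
  have hv : T.reach.val = s.1 := rfl
  constructor
  · intro k
    rw [hv]
    refine ⟨hs.reachable k, ?_⟩
    rintro ⟨C, ⟨w, hw⟩, hk⟩
    have key : ∀ E w F, N.Run E w F → N.Reachable E → (∀ p k, k ∈ E p → s.1 k = true) →
        ∀ p k, k ∈ F p → s.1 k = true := by
      intro E w F hr
      induction hr with
      | nil => exact fun _ h => h
      | @cons E F m b w h1 h2 h3 ih =>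
        intro hE hall
        refine ih (hE.after h1 h2) fun p j hj => ?_
        by_cases hp : p ∈ N.dom m
        · rw [after_of_mem hp, h.next_eq m h1.1 b h2 p hp] at hj
          have hm := (hs.seen m).1 (hall p m (h1.2 p hp))
          rw [hst] at hm
          exact hs.closed m (by simpa using hm) b h2 p hp (by simp) j hj
        · rw [after_of_notMem hp] at hj
          exact hall p j hj
    obtain ⟨p, hp⟩ := hN.wf.dom_nonempty k hk.1
    exact key _ _ _ hw reachable_cInit (fun q j hj => hj.2 ▸ hs.init) p k (hk.2 p hp)
  · have h1 : ∑ k ∈ N.nodes, searchCost N k ≤ 4 * N.size := sum_le_mul_size fun k hk => by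
      have := one_le_card_dom hN hk
      unfold searchCost
      nlinarith
    have h2 := card_nodes_le hN
    have h3 := Finset.card_pos.2 ⟨_, hN.wf.init_mem⟩
    rw [Finset.sdiff_empty] at ht
    simp only [reach, Timed.time_bind, Timed.time_charge, Timed.time_step, h.length_nodes] at ht ⊢
    omega

/-! ### Nodes with the same domain -/

/-- Adding the node `k` to the list `ns` if its domain is marked. -/
def sameDomStep (T : Tables Proc Node R D) (reached : Node → Bool) (m : Node) (mark : Proc → Bool)
    (ns : List Node) (k : Node) : Timed (List Node) :=
  if reached k ∧ k ≠ T.fin ∧ (T.dom k).length = (T.dom m).length then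
    (Timed.forIn (fun (b : Bool) p => Timed.step (b && mark p)) (T.dom k) true).bind fun b =>
    Timed.step (if b then k :: ns else ns)
  else Timed.step ns

theorem sameDomStep_spec (h : T.Represents N sem) {reached : Node → Bool}
    (hr : ∀ k, reached k = true ↔ N.ReachableNode k) {m : Node} (hm : m ∈ N.nodes)
    {mark : Proc → Bool} (hmark : ∀ p, mark p = true ↔ p ∈ N.dom m) (ns : List Node) {k : Node}
    (hk : k ∈ N.nodes) :
    (k ∈ N.nodesOn (N.dom m) → (T.sameDomStep reached m mark ns k).val = k :: ns) ∧
      (k ∉ N.nodesOn (N.dom m) → (T.sameDomStep reached m mark ns k).val = ns) ∧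
      (T.sameDomStep reached m mark ns k).time ≤ 2 + 2 * (N.dom k).card := by
  unfold sameDomStep
  rw [h.fin_eq, h.length_dom hk, h.length_dom hm]
  split_ifs with hc
  · obtain ⟨⟨l, h1, h2⟩, h3⟩ := Timed.forIn_spec
      (fun (b : Bool) p => Timed.step (b && mark p))
      (fun l b => ∃ l', T.dom k = l' ++ l ∧ (b = true ↔ ∀ q ∈ l', mark q = true)) (fun _ => 1)
      (fun p l b ⟨l', h1, h2⟩ => ⟨⟨l' ++ [p], by simpa using h1, by
        simp only [Timed.val_step, Bool.and_eq_true, h2, List.mem_append, List.mem_singleton]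
        grind⟩, le_rfl⟩)
      (T.dom k) true ⟨[], rfl, by simp⟩
    rw [List.append_nil] at h1
    subst h1
    have hiff : (Timed.forIn (fun (b : Bool) p => Timed.step (b && mark p)) (T.dom k) true).val
        = true ↔ k ∈ N.nodesOn (N.dom m) := by
      rw [h2]
      simp only [hmark, h.mem_dom k hk]
      exact ⟨fun hall => ⟨(hr k).1 hc.1, hc.2.1, Finset.eq_of_subset_of_card_le hall hc.2.2.ge⟩,
        fun hkm => hkm.2.2.subset⟩
    simp only [Timed.val_bind, Timed.val_step, Timed.time_bind, Timed.time_step]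
    refine ⟨fun hkm => if_pos (hiff.2 hkm), fun hkm => if_neg fun hcon => hkm (hiff.1 hcon), ?_⟩
    rw [sum_map_const, h.length_dom hk] at h3
    omega
  · refine ⟨fun hkm => absurd ⟨(hr k).2 hkm.1, hkm.2.1, by rw [hkm.2.2]⟩ hc, fun _ => rfl, ?_⟩
    simp only [Timed.time_step]
    omega

theorem sameDom_spec (hN : N.SoundDet) (h : T.Represents N sem) {reached : Node → Bool}
    (hr : ∀ k, reached k = true ↔ N.ReachableNode k) {m : Node} (hm : m ∈ N.nodes) :
    (T.sameDom reached m).val.Nodup ∧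
      (∀ k, k ∈ (T.sameDom reached m).val ↔ k ∈ N.nodesOn (N.dom m)) ∧
      (T.sameDom reached m).time ≤ 11 * N.size := by
  obtain ⟨⟨l₀, h1, h2⟩, h3⟩ := Timed.forIn_spec
    (fun (mark : Proc → Bool) p => Timed.step (Function.update mark p true))
    (fun l mark => ∃ l', T.dom m = l' ++ l ∧ ∀ q, mark q = true ↔ q ∈ l') (fun _ => 1)
    (fun p l mark ⟨l', h1, h2⟩ => ⟨⟨l' ++ [p], by simpa using h1, fun q => by
      by_cases hq : q = p
      · subst hq; simp
      · simp [hq, h2]⟩, le_rfl⟩)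
    (T.dom m) (fun _ => false) ⟨[], rfl, by simp⟩
  rw [List.append_nil] at h1
  subst h1
  set mark := (Timed.forIn (fun (mark : Proc → Bool) p => Timed.step (Function.update mark p true))
    (T.dom m) fun _ => false).val with hmark
  have hmk : ∀ p, mark p = true ↔ p ∈ N.dom m := fun p => by rw [h2, h.mem_dom m hm]
  obtain ⟨⟨-, -, h4, h5⟩, h6⟩ := Timed.forIn_spec (T.sameDomStep reached m mark)
    (fun l ns => l.Nodup ∧ (∀ k ∈ l, k ∈ N.nodes) ∧ ns.Nodup ∧
      ∀ k, k ∈ ns ↔ k ∈ N.nodesOn (N.dom m) ∧ k ∉ l) (fun k => 2 + 2 * (N.dom k).card)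
    (fun k l ns ⟨g1, g2, g3, g4⟩ => by
      obtain ⟨i1, i2, i3⟩ := sameDomStep_spec h hr hm hmk ns (g2 k List.mem_cons_self)
      obtain ⟨g5, g6⟩ := List.nodup_cons.1 g1
      refine ⟨⟨g6, fun j hj => g2 j (List.mem_cons_of_mem _ hj), ?_⟩, i3⟩
      by_cases hk : k ∈ N.nodesOn (N.dom m)
      · rw [i1 hk]
        refine ⟨List.nodup_cons.2 ⟨fun hc => ((g4 k).1 hc).2 List.mem_cons_self, g3⟩, fun j => ?_⟩
        rw [List.mem_cons, g4, List.mem_cons, not_or]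
        by_cases hjk : j = k
        · subst hjk; simp [hk, g5]
        · simp [hjk]
      · rw [i2 hk]
        refine ⟨g3, fun j => ?_⟩
        rw [g4, List.mem_cons, not_or]
        by_cases hjk : j = k
        · subst hjk; simp [hk]
        · simp [hjk])
    T.nodes [] ⟨h.nodes_nodup, fun k hk => (h.mem_nodes k).1 hk, List.nodup_nil, fun k => by
      simp only [List.not_mem_nil, false_iff, not_and, not_not]
      exact fun hk => (h.mem_nodes k).2 hk.1.mem⟩
  have hv : (T.sameDom reached m).val = (Timed.forIn (T.sameDomStep reached m mark) T.nodes []).val := rfl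
  have ht : (T.sameDom reached m).time = (T.dom T.init).length +
      (Timed.forIn (fun (mark : Proc → Bool) p => Timed.step (Function.update mark p true))
        (T.dom m) fun _ => false).time +
      (Timed.forIn (T.sameDomStep reached m mark) T.nodes []).time := rfl
  rw [hv, ht]
  refine ⟨h4, fun k => (h5 k).trans (by simp), ?_⟩
  have h7 := sum_map_le_sum h.nodes_nodup (s := N.nodes) (fun k hk => (h.mem_nodes k).1 hk)
    fun k => 1 + (2 + 2 * (N.dom k).card)
  have h8 : ∑ k ∈ N.nodes, (1 + (2 + 2 * (N.dom k).card)) ≤ 5 * N.size := sum_le_mul_size fun k hk => by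
    have := one_le_card_dom hN hk
    nlinarith
  have h9 := card_dom_le hN.wf.init_mem
  have h10 : (N.dom N.init).card ≤ N.size := le_trans (by nlinarith) h9
  have h11 := card_dom_le hm
  have h12 : (N.dom m).card ≤ N.size := le_trans (by nlinarith) h11
  have h13 := one_le_card_dom hN hm
  rw [sum_map_const, h.length_dom hm] at h3
  rw [h.init_eq, h.length_dom hN.wf.init_mem]
  omega

end Tables

namespace Tables

variable {Proc Node R D : Type*} [DecidableEq Proc] [DecidableEq Node] [DecidableEq R]
  [CompleteLattice D] {T T' : Tables Proc Node R D} {N N' N₀ : Negotiation Proc Node R}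
  {sem sem' sem₀ : Node × R → D → D} {n : Node} {a : R} {X : Finset Proc} {f : D → D} {K : ℕ}
  {solve : FlowGraph (Option Node) D → Timed (D → D)}

theorem size_le_size (h1 : N'.nodes = N.nodes) (h2 : N'.dom = N.dom)
    (h3 : ∀ k, (N'.out k).card ≤ (N.out k).card) : N'.size ≤ N.size := by
  unfold size
  rw [h1, h2]
  exact Finset.sum_le_sum fun k _ => Nat.add_le_add_left (Nat.mul_le_mul_right _ (h3 k)) _

/-! ### The for-loops -/

/-- The invariant of the first for-loop, which starts with the tables `T` of `N`. -/
structure LocLoop (N₀ : Negotiation Proc Node R) (sem₀ : Node × R → D → D) (f : D → D)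
    (T : Tables Proc Node R D) (N : Negotiation Proc Node R) (sem : Node × R → D → D)
    (X : Finset Proc) (todo : Set (Node × R)) (T' : Tables Proc Node R D)
    (N' : Negotiation Proc Node R) (sem' : Node × R → D → D) : Prop where
  represents : T'.Represents N' sem'
  inv : N'.InForLoc sem' f X todo
  labelled : Labelled N₀ sem₀ N' sem'
  shape : SameShape T T'
  nodes_eq : N'.nodes = N.nodes
  dom_eq : N'.dom = N.dom
  out_eq : N'.out = N.out
  nodesOn_eq : N'.nodesOn X = N.nodesOn X
  nonReduced : ∀ k, N'.NonReduced k → N.dom k ≠ X → N.NonReduced k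
  steps : Relation.ReflTransGen AlgStep (.head N sem) (.forLoc N' sem' X todo)

theorem LocLoop.size_eq {todo : Set (Node × R)}
    (h : LocLoop N₀ sem₀ f T N sem X todo T' N' sem') : N'.size = N.size := by
  unfold size
  rw [h.nodes_eq, h.dom_eq, h.out_eq]

theorem LocLoop.step (hsolve : Solves solve N₀ sem₀ N₀.size K) (hsize : N.size ≤ N₀.size)
    {todo todo' : Set (Node × R)} (h : LocLoop N₀ sem₀ f T N sem X todo T' N' sem')
    (hl : (n, a) ∈ todo) (ht : todo' = todo \ {(n, a)}) :
    (∃ N'' sem'', LocLoop N₀ sem₀ f T N sem X todo' (reduceLoc solve T' n a).val N'' sem'') ∧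
      (reduceLoc solve T' n a).time ≤ K + 11 * N.size := by
  subst ht
  have hN := h.inv.soundDet
  obtain ⟨⟨h1, h2, h3⟩, h4⟩ := h.inv.todo_subset hl
  simp only at h1 h2 h3 h4
  obtain ⟨C₀, h₀⟩ := h1.exists_isFirst hN h2
  obtain ⟨C, hC, g1, g2, g3, g4⟩ := reduceLoc_spec hsolve (h.size_eq.le.trans hsize) h.labelled hN
    h.inv.invariant h.represents (h3 ▸ h.inv.reducedBelow) h₀ h4
  have hb := Finset.notMem_erase a (N'.out n)
  obtain ⟨i1, i2, -, i3⟩ := h.inv.step hl h₀ hC hb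
  refine ⟨⟨_, _, g1, i1, g2, h.shape.trans g3, h.nodes_eq, h.dom_eq,
    (redLoc_out_same h4 C).trans h.out_eq, i2.trans h.nodesOn_eq, fun k hk hkX => ?_,
    h.steps.tail (.reduceLoc n a a C₀ C hl h₀ hC hb)⟩, by rw [h.size_eq] at g4; exact g4⟩
  exact h.nonReduced k (i3 k hk (by rwa [h.dom_eq])) hkX

theorem locLoop_spec (hsolve : Solves solve N₀ sem₀ N₀.size K) (hsize : N.size ≤ N₀.size)
    (h : T.Represents N sem) (hv : N.Valid sem f) (hlab : Labelled N₀ sem₀ N sem) {m : Node}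
    (hm : N.NonReduced m) (hmin : ∀ m', N.NonReduced m' → ¬ N.dom m' ⊂ N.dom m) {ns : List Node}
    (hnd : ns.Nodup) (hns : ∀ k, k ∈ ns ↔ k ∈ N.nodesOn (N.dom m)) :
    (∃ N' sem', LocLoop N₀ sem₀ f T N sem (N.dom m) ∅ (Timed.forIn (fun T n =>
      Timed.forIn (fun T a => reduceLoc solve T n a) (T.out n) T) ns T).val N' sem') ∧
      (Timed.forIn (fun T n =>
        Timed.forIn (fun T a => reduceLoc solve T n a) (T.out n) T) ns T).time ≤
      1 + (ns.map fun k => 1 + (1 + (N.out k).card * (1 + (K + 11 * N.size)))).sum := by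
  have hmem : ∀ k ∈ ns, ∀ b, b ∈ T.out k ↔ b ∈ N.out k := fun k hk b =>
    h.mem_out k ((hns k).1 hk).1.mem b
  have := Timed.forIn_spec
    (fun T n => Timed.forIn (fun T a => reduceLoc solve T n a) (T.out n) T)
    (fun l T' => l.Nodup ∧ (∀ k ∈ l, k ∈ ns) ∧ ∃ N' sem', LocLoop N₀ sem₀ f T N sem (N.dom m)
      {x | x.1 ∈ l ∧ x.2 ∈ T.out x.1} T' N' sem')
    (fun k => 1 + (N.out k).card * (1 + (K + 11 * N.size)))
    (fun n l T' ⟨h1, h2, N', sem', h3⟩ => by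
      obtain ⟨h4, h5⟩ := List.nodup_cons.1 h1
      have hnN := ((hns n).1 (h2 n List.mem_cons_self)).1.mem
      have hinner := Timed.forIn_spec (fun T a => reduceLoc solve T n a)
        (fun l' T' => l'.Nodup ∧ ∃ N' sem', LocLoop N₀ sem₀ f T N sem (N.dom m)
          {x | (x.1 ∈ l ∧ x.2 ∈ T.out x.1) ∨ (x.1 = n ∧ x.2 ∈ l')} T' N' sem')
        (fun _ => K + 11 * N.size)
        (fun b l' T' ⟨g1, N', sem', g2⟩ => by
          obtain ⟨g3, g4⟩ := List.nodup_cons.1 g1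
          obtain ⟨g5, g6⟩ := g2.step hsolve hsize (n := n) (a := b)
            (todo' := {x | (x.1 ∈ l ∧ x.2 ∈ T.out x.1) ∨ (x.1 = n ∧ x.2 ∈ l')})
            (.inr ⟨rfl, List.mem_cons_self⟩) (by
              ext ⟨k, c⟩
              simp only [Set.mem_ofPred_eq, Set.mem_sdiff, Set.mem_singleton_iff, Prod.mk.injEq,
                List.mem_cons]
              constructor
              · rintro (⟨i1, i2⟩ | ⟨rfl, i2⟩)
                · exact ⟨.inl ⟨i1, i2⟩, fun i3 => h4 (i3.1 ▸ i1)⟩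
                · exact ⟨.inr ⟨rfl, .inr i2⟩, fun i3 => g3 (i3.2 ▸ i2)⟩
              · rintro ⟨i1 | ⟨rfl, rfl | i1⟩, i2⟩
                · exact .inl i1
                · exact absurd ⟨rfl, rfl⟩ i2
                · exact .inr ⟨rfl, i1⟩)
          exact ⟨⟨g4, g5⟩, g6⟩)
        (T'.out n) T' ⟨by rw [h3.shape.out]; exact h.out_nodup n hnN, N', sem', by
          convert h3 using 1
          ext ⟨k, c⟩
          simp only [Set.mem_ofPred_eq, List.mem_cons, h3.shape.out]
          constructor
          · rintro (⟨i1, i2⟩ | ⟨rfl, i2⟩)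
            exacts [⟨.inr i1, i2⟩, ⟨.inl rfl, i2⟩]
          · rintro ⟨rfl | i1, i2⟩
            exacts [.inr ⟨rfl, i2⟩, .inl ⟨i1, i2⟩]⟩
      obtain ⟨⟨-, N'', sem'', g1⟩, g2⟩ := hinner
      refine ⟨⟨h5, fun k hk => h2 k (List.mem_cons_of_mem _ hk), N'', sem'', ?_⟩, ?_⟩
      · convert g1 using 1
        ext x
        simp
      · rw [sum_map_const, h3.shape.out, h.length_out hnN] at g2
        simpa only [h3.shape.out] using g2)
    ns T ⟨hnd, fun _ hk => hk, N, sem, by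
      have he : {x : Node × R | x.1 ∈ ns ∧ x.2 ∈ T.out x.1} = N.locsOn (N.dom m) := by
        ext x
        constructor
        · rintro ⟨h1, h2⟩
          exact ⟨(hns _).1 h1, (hmem _ h1 _).1 h2⟩
        · rintro ⟨h1, h2⟩
          have h1 := (hns _).2 h1
          exact ⟨h1, (hmem _ h1 _).2 h2⟩
      rw [he]
      exact ⟨h, hv.enter hmin hm.1, hlab, .refl T, rfl, rfl, rfl, rfl, fun k hk _ => hk,
        .single (.enter m hm hmin)⟩⟩
  obtain ⟨⟨-, -, N', sem', h1⟩, h2⟩ := this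
  refine ⟨⟨N', sem', ?_⟩, h2⟩
  convert h1 using 1
  ext x
  simp

/-- `x` lists the values and successors in the table `tab`. -/
def IsRow (N₀ : Negotiation Proc Node R) (sem₀ : Node × R → D → D) (N : Negotiation Proc Node R)
    (tab : Node → (D → D) × Config Proc Node) (x : Node × (D → D) × (Proc → Option Node)) : Prop :=
  x.2.1 = (tab x.1).1 ∧ (∀ p ∈ N.dom x.1, (tab x.1).2 p = {k | x.2.2 p = some k}) ∧
    Transformer N₀ sem₀ x.2.1

theorem valLoop_spec (hsolve : Solves solve N₀ sem₀ N₀.size K) (hsize : N.size ≤ N₀.size)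
    (h : T.Represents N sem) (hlab : Labelled N₀ sem₀ N sem) (hv : N.InForLoc sem f X ∅)
    {ns : List Node} (hnd : ns.Nodup) (hns : ∀ k, k ∈ ns ↔ k ∈ N.nodesOn X) :
    (∃ tab, N.InForVal sem f X ∅ tab ∧ Relation.ReflTransGen AlgStep (.forLoc N sem X ∅)
        (.forVal N sem X ∅ tab) ∧
      ((Timed.forIn (fun l n => (summarize solve T n).bind fun x => Timed.step ((n, x) :: l))
        ns []).val.map Prod.fst = ns.reverse) ∧
      ∀ x ∈ (Timed.forIn (fun l n => (summarize solve T n).bind fun x => Timed.step ((n, x) :: l))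
        ns []).val, IsRow N₀ sem₀ N tab x) ∧
      (Timed.forIn (fun l n => (summarize solve T n).bind fun x => Timed.step ((n, x) :: l))
        ns []).time ≤ 1 + (ns.map fun _ => 1 + (K + 14 * N.size + 1)).sum := by
  have hN := hv.soundDet
  have hset : {k | k ∈ ns} = N.nodesOn X := Set.ext hns
  have := Timed.forIn_spec
    (fun l n => (summarize solve T n).bind fun x => Timed.step ((n, x) :: l))
    (fun l r => ∃ l' tab, ns = l' ++ l ∧ r.map Prod.fst = l'.reverse ∧
      N.InForVal sem f X {k | k ∈ l} tab ∧ Relation.ReflTransGen AlgStep (.forLoc N sem X ∅)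
        (.forVal N sem X {k | k ∈ l} tab) ∧ ∀ x ∈ r, IsRow N₀ sem₀ N tab x)
    (fun _ => K + 14 * N.size + 1)
    (fun n l r ⟨l', tab, h1, h2, h3, h4, h5⟩ => by
      obtain ⟨g1, g2, g3⟩ := (hns n).1 (by rw [h1]; simp)
      obtain ⟨C₀, h₀⟩ := g1.exists_isFirst hN g2
      obtain ⟨C, hC⟩ := h₀.exists_isLastNode hN
      obtain ⟨i1, i2, i3, i4⟩ := summarize_spec hsolve hsize hlab hN h (g3 ▸ h3.locsReduced) g2 h₀ hC
      have hnl : n ∉ l' ∧ n ∉ l := by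
        rw [h1] at hnd
        have := List.nodup_append.1 hnd
        exact ⟨fun hc => this.2.2 n hc n List.mem_cons_self rfl, (List.nodup_cons.1 this.2.1).1⟩
      have he : {k | k ∈ l} = {k | k ∈ n :: l} \ {n} := by
        ext k
        simp only [Set.mem_ofPred_eq, Set.mem_sdiff, Set.mem_singleton_iff, List.mem_cons]
        constructor
        · exact fun hk => ⟨.inr hk, fun hc => hnl.2 (hc ▸ hk)⟩
        · rintro ⟨rfl | hk, hne⟩
          exacts [absurd rfl hne, hk]
      refine ⟨⟨l' ++ [n], Function.update tab n ((N.subNode n C₀ C).mop (subSem sem), C),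
        by simpa using h1, by simp [h2], ?_, ?_, ?_⟩, ?_⟩
      · rw [he]
        exact h3.step ⟨C₀, C, h₀, hC, rfl⟩
      · rw [he]
        exact h4.tail (.value n C₀ C List.mem_cons_self h₀ hC)
      · intro x hx
        simp only [Timed.val_bind, Timed.val_step, List.mem_cons] at hx
        rcases hx with rfl | hx
        · unfold IsRow
          simp only [Function.update_self]
          exact ⟨i1, i2, i3⟩
        · have hxn : x.1 ≠ n := fun hc => hnl.1 (by
            rw [← List.mem_reverse, ← h2, ← hc]
            exact List.mem_map_of_mem hx)
          unfold IsRow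
          rw [Function.update_of_ne hxn]
          exact h5 x hx
      · simp only [Timed.time_bind, Timed.time_step]
        omega)
    ns [] ⟨[], fun _ => (id, fun _ => ∅), rfl, rfl, hset ▸ hv.locsDone _, by
      rw [hset]; exact .single .locsDone, by simp⟩
  obtain ⟨⟨l', tab, h1, h2, h3, h4, h5⟩, h6⟩ := this
  rw [List.append_nil] at h1
  subst h1
  have he : {k : Node | k ∈ ([] : List Node)} = ∅ := by simp
  rw [he] at h3 h4
  exact ⟨⟨tab, h3, h4, h2, h5⟩, h6⟩

theorem redLoop_spec (h : T.Represents N sem) (hlab : Labelled N₀ sem₀ N sem)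
    {tab : Node → (D → D) × Config Proc Node} (hv : N.InForVal sem f X ∅ tab)
    {r : List (Node × (D → D) × (Proc → Option Node))} (hnd : (r.map Prod.fst).Nodup)
    (hr : ∀ k, k ∈ r.map Prod.fst ↔ k ∈ N.nodesOn X) (hrow : ∀ x ∈ r, IsRow N₀ sem₀ N tab x) :
    (∃ N' sem', (Timed.forIn (fun T x => installNode T x) r T).val.Represents N' sem' ∧
      InForRed N sem f X N' sem' ∅ tab ∧ Labelled N₀ sem₀ N' sem' ∧
      (∀ k, (N'.out k).card ≤ (N.out k).card) ∧
      Relation.ReflTransGen AlgStep (.forVal N sem X ∅ tab) (.forRed N' sem' ∅ tab)) ∧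
      (Timed.forIn (fun T x => installNode T x) r T).time ≤
        1 + (r.map fun x => 1 + (2 + 2 * (N.dom x.1).card)).sum := by
  have hset : {k | k ∈ r.map Prod.fst} = N.nodesOn X := Set.ext hr
  have := Timed.forIn_spec (fun T x => installNode T x)
    (fun l T' => (l.map Prod.fst).Nodup ∧ (∀ x ∈ l, x ∈ r) ∧ ∃ N' sem', T'.Represents N' sem' ∧
      InForRed N sem f X N' sem' {k | k ∈ l.map Prod.fst} tab ∧ Labelled N₀ sem₀ N' sem' ∧
      (∀ k, (N'.out k).card ≤ (N.out k).card) ∧ Relation.ReflTransGen AlgStep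
        (.forVal N sem X ∅ tab) (.forRed N' sem' {k | k ∈ l.map Prod.fst} tab))
    (fun x => 2 + 2 * (N.dom x.1).card)
    (fun x l T' ⟨h1, h2, N', sem', h3, h4, h5, h6, h7⟩ => by
      obtain ⟨n, g, pos⟩ := x
      rw [List.map_cons, List.nodup_cons] at h1
      obtain ⟨i1, i2, i3⟩ := hrow _ (h2 _ List.mem_cons_self)
      simp only at i1 i2 i3 h1
      have hn : n ∈ {k | k ∈ ((n, g, pos) :: l).map Prod.fst} := by simp
      have hnX := h4.todo_subset' hn
      have hout : N'.out n = N.out n := (h4.reduct.of_notMem n fun hc => hc.2 hn).1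
      have hne : (N'.out n).Nonempty := by
        rw [hout]
        exact hv.soundDet.wf.out_nonempty n hnX.1.mem hnX.2.1
      obtain ⟨b, hb, g1, g2⟩ := installNode_spec h3 (by rw [h4.reduct.nodes_eq]; exact hnX.1.mem)
        hne g pos (C := (tab n).2) (by rw [h4.reduct.dom_eq]; exact i2)
      have he : {k | k ∈ l.map Prod.fst} = {k | k ∈ ((n, g, pos) :: l).map Prod.fst} \ {n} := by
        ext k
        simp only [Set.mem_ofPred_eq, Set.mem_sdiff, Set.mem_singleton_iff, List.map_cons,
          List.mem_cons]
        constructor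
        · exact fun hk => ⟨.inr hk, fun hc => h1.1 (hc ▸ hk)⟩
        · rintro ⟨rfl | hk, hne⟩
          exacts [absurd rfl hne, hk]
      rw [h4.reduct.dom_eq] at g2
      refine ⟨⟨h1.2, fun x hx => h2 x (List.mem_cons_of_mem _ hx), _, _, g1, ?_,
        labelled_redNode h5 i3 _, fun k => (card_out_redNode_le hne _ _ k).trans (h6 k), ?_⟩, g2⟩
      · rw [he, i1]
        exact h4.step hn b
      · rw [he, i1]
        exact h7.tail (.reduceNode n b hn))
    r T ⟨hnd, fun _ hx => hx, N, sem, h, hset ▸ hv.valuesDone, hlab, fun _ => le_rfl, by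
      rw [hset]; exact .single .valuesDone⟩
  obtain ⟨⟨-, -, N', sem', h1, h2, h3, h4, h5⟩, h6⟩ := this
  have he : {k : Node | k ∈ ([] : List (Node × (D → D) × (Proc → Option Node))).map Prod.fst} = ∅ := by
    simp
  rw [he] at h2 h5
  exact ⟨⟨N', sem', h1, h2, h3, h4, h5⟩, h6⟩

end Tables

namespace Tables

variable {Proc Node R D : Type*} [DecidableEq Proc] [DecidableEq Node] [DecidableEq R]
  [CompleteLattice D] {T T' : Tables Proc Node R D} {N N' N₀ : Negotiation Proc Node R}
  {sem sem' sem₀ : Node × R → D → D} {f : D → D} {K : ℕ}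
  {solve : FlowGraph (Option Node) D → Timed (D → D)}

/-! ### The while loop -/

/-- The invariant of the while loop, started with `N₀`. -/
structure HeadInv (N₀ : Negotiation Proc Node R) (sem₀ : Node × R → D → D) (f : D → D)
    (T : Tables Proc Node R D) (N : Negotiation Proc Node R) (sem : Node × R → D → D) : Prop where
  represents : T.Represents N sem
  valid : N.Valid sem f
  labelled : Labelled N₀ sem₀ N sem
  nodes_eq : N.nodes = N₀.nodes
  dom_eq : N.dom = N₀.dom
  card_out_le : ∀ k, (N.out k).card ≤ (N₀.out k).card
  steps : Relation.ReflTransGen AlgStep (.head N₀ sem₀) (.head N sem)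

theorem HeadInv.size_le (h : HeadInv N₀ sem₀ f T N sem) : N.size ≤ N₀.size :=
  size_le_size h.nodes_eq h.dom_eq h.card_out_le

theorem one_le_size (hN : N.SoundDet) : 1 ≤ N.size :=
  Nat.le_trans (Finset.card_pos.2 ⟨_, hN.wf.init_mem⟩) (card_nodes_le hN)

open Classical in
/-- The nodes that have the domain of a non-reduced node. -/
noncomputable def pending (N : Negotiation Proc Node R) : Finset Node :=
  N.nodes.filter fun k => ∃ j, N.NonReduced j ∧ N.dom j = N.dom k

/-- The number of nodes and locations that are still to be treated. -/
noncomputable def potential (N : Negotiation Proc Node R) : ℕ :=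
  ∑ k ∈ pending N, (1 + (N.out k).card)

theorem potential_le (hN : N.SoundDet) : potential N ≤ N.size := by
  classical
  rw [size_eq]
  refine (Finset.sum_le_sum fun k hk => ?_).trans
    (Finset.sum_le_sum_of_subset (Finset.filter_subset _ _))
  have := one_le_card_dom hN (Finset.mem_filter.1 hk).1
  nlinarith

theorem whileBody_spec (hsolve : Solves solve N₀ sem₀ N₀.size K)
    (h : HeadInv N₀ sem₀ f T N sem) {reached : Node → Bool}
    (hr : ∀ k, reached k = true ↔ N.ReachableNode k) {m : Node} (hm : N.NonReduced m)
    (hmin : ∀ m', N.NonReduced m' → ¬ N.dom m' ⊂ N.dom m) :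
    ∃ N' sem', HeadInv N₀ sem₀ f (whileBody solve reached T m).val N' sem' ∧
      (∀ k, N'.NonReduced k → N.NonReduced k ∧ N.dom k ≠ N.dom m) ∧
      (whileBody solve reached T m).time + (K + 23 * N₀.size) * potential N' ≤
        (K + 23 * N₀.size) * potential N + 14 * N₀.size := by
  classical
  have hN := h.valid.soundDet
  have hsize := h.size_le
  obtain ⟨a1, a2, a3⟩ := sameDom_spec hN h.represents hr hm.1.mem
  set ns := (T.sameDom reached m).val with hns
  obtain ⟨⟨N₁, sem₁, b1⟩, b2⟩ := locLoop_spec hsolve hsize h.represents h.valid h.labelled hm hmin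
    a1 a2
  set T₁ := (Timed.forIn (fun T n => Timed.forIn (fun T a => reduceLoc solve T n a) (T.out n) T)
    ns T).val with hT₁
  obtain ⟨⟨tab, c1, c2, c3, c4⟩, c5⟩ := valLoop_spec hsolve (b1.size_eq.le.trans hsize)
    b1.represents b1.labelled b1.inv a1 (by rw [b1.nodesOn_eq]; exact a2)
  set r := (Timed.forIn (fun l n => (summarize solve T₁ n).bind fun x => Timed.step ((n, x) :: l))
    ns []).val with hrdef
  obtain ⟨⟨N', sem', d1, d2, d3, d4, d5⟩, d6⟩ := redLoop_spec b1.represents b1.labelled c1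
    (r := r) (by rw [c3]; exact List.nodup_reverse.2 a1)
    (fun k => by rw [c3, List.mem_reverse, a2, b1.nodesOn_eq]) c4
  have hval : (whileBody solve reached T m).val =
      (Timed.forIn (fun T x => installNode T x) r T₁).val := rfl
  have htime : (whileBody solve reached T m).time = (T.sameDom reached m).time +
      ((Timed.forIn (fun T n => Timed.forIn (fun T a => reduceLoc solve T n a) (T.out n) T)
        ns T).time + ((Timed.forIn (fun l n => (summarize solve T₁ n).bind fun x =>
          Timed.step ((n, x) :: l)) ns []).time +
        (Timed.forIn (fun T x => installNode T x) r T₁).time)) := rfl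
  obtain ⟨e1, -, e2⟩ := d2.nodesDone
  have hnodes : N'.nodes = N.nodes := d2.reduct.nodes_eq.trans b1.nodes_eq
  have hdom : N'.dom = N.dom := d2.reduct.dom_eq.trans b1.dom_eq
  have hout : ∀ k, (N'.out k).card ≤ (N.out k).card := fun k => (d4 k).trans (by rw [b1.out_eq])
  have hnr : ∀ k, N'.NonReduced k → N.NonReduced k ∧ N.dom k ≠ N.dom m := fun k hk => by
    obtain ⟨g1, g2⟩ := e2 k hk
    rw [b1.dom_eq] at g2
    exact ⟨b1.nonReduced k g1 g2, g2⟩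
  refine ⟨N', sem', ⟨hval ▸ d1, e1, d3, hnodes.trans h.nodes_eq, hdom.trans h.dom_eq,
    fun k => (hout k).trans (h.card_out_le k), ((h.steps.trans b1.steps).trans
      (c2.trans d5)).tail .nodesDone⟩, hnr, ?_⟩
  have hpot : potential N' + ∑ k ∈ ns.toFinset, (1 + (N.out k).card) ≤ potential N := by
    have h1 : potential N' ≤ ∑ k ∈ pending N', (1 + (N.out k).card) :=
      Finset.sum_le_sum fun k _ => Nat.add_le_add_left (hout k) 1
    have h2 : Disjoint (pending N') ns.toFinset := by
      rw [Finset.disjoint_left]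
      intro k hk hkns
      obtain ⟨-, j, hj, hjk⟩ := Finset.mem_filter.1 hk
      rw [hdom] at hjk
      have := ((a2 k).1 (List.mem_toFinset.1 hkns)).2.2
      exact (hnr j hj).2 (hjk.trans this)
    have h3 : pending N' ∪ ns.toFinset ⊆ pending N := by
      intro k hk
      rcases Finset.mem_union.1 hk with hk | hk
      · obtain ⟨g1, j, hj, hjk⟩ := Finset.mem_filter.1 hk
        exact Finset.mem_filter.2 ⟨hnodes ▸ g1, j, (hnr j hj).1, by rwa [hdom] at hjk⟩
      · have := (a2 k).1 (List.mem_toFinset.1 hk)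
        exact Finset.mem_filter.2 ⟨this.1.mem, m, hm, this.2.2.symm⟩
    have h4 := Finset.sum_le_sum_of_subset (f := fun k => 1 + (N.out k).card) h3
    rw [Finset.sum_union h2] at h4
    exact le_trans (Nat.add_le_add_right h1 _) h4
  have hsum : (ns.map fun k => 1 + (1 + (N.out k).card * (1 + (K + 11 * N.size)))).sum +
      ((ns.map fun _ => 1 + (K + 14 * N₁.size + 1)).sum +
      (r.map fun x => 1 + (2 + 2 * (N₁.dom x.1).card)).sum) ≤
      (K + 23 * N₀.size) * ∑ k ∈ ns.toFinset, (1 + (N.out k).card) := by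
    have h1 : (r.map fun x => 1 + (2 + 2 * (N₁.dom x.1).card)).sum =
        (ns.map fun k => 1 + (2 + 2 * (N₁.dom k).card)).sum := by
      have : (r.map fun x => 1 + (2 + 2 * (N₁.dom x.1).card)) =
          (r.map Prod.fst).map fun k => 1 + (2 + 2 * (N₁.dom k).card) := by simp
      rw [this, c3, List.map_reverse, List.sum_reverse]
    rw [h1, ← List.sum_toFinset _ a1, ← List.sum_toFinset _ a1, ← List.sum_toFinset _ a1,
      ← Finset.sum_add_distrib, ← Finset.sum_add_distrib, Finset.mul_sum]
    refine Finset.sum_le_sum fun k hk => ?_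
    have hkN := ((a2 k).1 (List.mem_toFinset.1 hk)).1.mem
    have h2 := card_dom_le hkN
    have h3 : (N.dom k).card ≤ N.size := le_trans (by nlinarith) h2
    have h4 := one_le_size hN
    rw [b1.dom_eq, b1.size_eq]
    have h5 : (N.out k).card * (1 + (K + 11 * N.size)) ≤ (N.out k).card * (K + 23 * N₀.size) :=
      Nat.mul_le_mul_left _ (by omega)
    have h6 : (K + 23 * N₀.size) * (1 + (N.out k).card) =
      (K + 23 * N₀.size) + (N.out k).card * (K + 23 * N₀.size) := by ring
    omega
  have hmul := Nat.mul_le_mul_left (K + 23 * N₀.size) hpot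
  rw [Nat.mul_add] at hmul
  have h1 := one_le_size hN
  rw [htime]
  omega

theorem visit_spec (hsolve : Solves solve N₀ sem₀ N₀.size K) (h : HeadInv N₀ sem₀ f T N sem)
    {m : Node} (hm : m ∈ N.nodes)
    (hmin : ∀ m', N.NonReduced m' → ¬ N.dom m' ⊂ N.dom m) :
    ∃ N' sem', HeadInv N₀ sem₀ f (visit solve T m).val N' sem' ∧
      (∀ k, N'.NonReduced k → N.NonReduced k ∧ k ≠ m) ∧
      (visit solve T m).time + (K + 23 * N₀.size) * potential N' ≤
        (K + 23 * N₀.size) * potential N + 27 * N₀.size := by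
  have hN := h.valid.soundDet
  obtain ⟨h1, h2⟩ := reach_spec hN h.represents
  have hsize := h.size_le
  have hpos := one_le_size hN
  unfold visit
  simp only [Timed.val_bind, Timed.time_bind]
  split_ifs with hc
  · rw [h1, h.represents.fin_eq] at hc
    obtain ⟨h3, h4⟩ := testReduced_spec hN h.represents hc.1
    simp only [Timed.val_bind, Timed.time_bind]
    split_ifs with hb
    · refine ⟨N, sem, h, fun k hk => ⟨hk, ?_⟩, ?_⟩
      · rintro rfl
        exact ((nonReduced_iff hN).1 hk).2.2 (h3.1 hb)
      · simp only [Timed.time_step]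
        omega
    · have hmr : N.NonReduced m := (nonReduced_iff hN).2 ⟨hc.1, hc.2, fun hl => hb (h3.2 hl)⟩
      obtain ⟨N', sem', g1, g2, g3⟩ := whileBody_spec hsolve h h1 hmr hmin
      refine ⟨N', sem', g1, fun k hk => ⟨(g2 k hk).1, ?_⟩, by omega⟩
      rintro rfl
      exact (g2 k hk).2 rfl
  · refine ⟨N, sem, h, fun k hk => ⟨hk, ?_⟩, ?_⟩
    · rintro rfl
      exact hc ⟨(h1 k).2 hk.1, by rw [h.represents.fin_eq]; exact hk.2.1⟩
    · simp only [Timed.time_step]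
      omega

theorem visitLoop_spec (hsolve : Solves solve N₀ sem₀ N₀.size K)
    (h : HeadInv N₀ sem₀ f T N sem) {c : ℕ}
    (hc : ∀ k, N.NonReduced k → c ≤ (N.dom k).card) :
    ∃ N' sem', HeadInv N₀ sem₀ f (Timed.forIn (fun T m => if (T.dom m).length = c
        then visit solve T m else Timed.step T) T.nodes T).val N' sem' ∧
      (∀ k, N'.NonReduced k → N.NonReduced k ∧ c < (N.dom k).card) ∧
      (Timed.forIn (fun T m => if (T.dom m).length = c then visit solve T m else Timed.step T)
        T.nodes T).time + (K + 23 * N₀.size) * potential N' ≤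
        (K + 23 * N₀.size) * potential N + 1 +
          ∑ k ∈ N₀.nodes, (2 + if (N₀.dom k).card = c then 27 * N₀.size else 0) := by
  have := Timed.forIn_amortized
    (fun T m => if (T.dom m).length = c then visit solve T m else Timed.step T)
    (fun l T b => ∃ N' sem', HeadInv N₀ sem₀ f T N' sem' ∧ (∀ k ∈ l, k ∈ N₀.nodes) ∧
      (∀ k, N'.NonReduced k → N.NonReduced k ∧ ((N₀.dom k).card = c → k ∈ l)) ∧
      b = (K + 23 * N₀.size) * potential N')
    (fun k => 1 + if (N₀.dom k).card = c then 27 * N₀.size else 0)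
    (fun m l T b ⟨N', sem', h1, h2, h3, h4⟩ => by
      have hm := h2 m List.mem_cons_self
      have hm' : m ∈ N'.nodes := by rw [h1.nodes_eq]; exact hm
      have hlen := h1.represents.length_dom hm'
      rw [h1.dom_eq] at hlen
      have hl := fun k hk => h2 k (List.mem_cons_of_mem m hk)
      simp only [hlen]
      split_ifs with hmc
      · obtain ⟨N'', sem'', g1, g2, g3⟩ := visit_spec hsolve h1 hm' fun k hk hlt => by
          have h5 := hc k (h3 k hk).1
          have h6 := Finset.card_lt_card hlt
          rw [h1.dom_eq, hmc] at h6
          rw [h.dom_eq] at h5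
          omega
        refine ⟨_, ⟨N'', sem'', g1, hl, fun k hk => ?_, rfl⟩, by omega⟩
        obtain ⟨i1, i2⟩ := g2 k hk
        exact ⟨(h3 k i1).1, fun hkc => (List.mem_cons.1 ((h3 k i1).2 hkc)).resolve_left i2⟩
      · refine ⟨b, ⟨N', sem', h1, hl, fun k hk => ⟨(h3 k hk).1, fun hkc => ?_⟩, h4⟩, ?_⟩
        · refine (List.mem_cons.1 ((h3 k hk).2 hkc)).resolve_left ?_
          rintro rfl
          exact hmc hkc
        · simp only [Timed.time_step]
          omega)
    T.nodes T ((K + 23 * N₀.size) * potential N)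
    ⟨N, sem, h, fun k hk => by rw [← h.nodes_eq]; exact (h.represents.mem_nodes k).1 hk,
      fun k hk => ⟨hk, fun _ => (h.represents.mem_nodes k).2 hk.1.mem⟩, rfl⟩
  obtain ⟨b, ⟨N', sem', h1, -, h2, rfl⟩, h3⟩ := this
  refine ⟨N', sem', h1, fun k hk => ⟨(h2 k hk).1, ?_⟩, ?_⟩
  · have h4 := hc k (h2 k hk).1
    refine lt_of_le_of_ne h4 fun he => ?_
    rw [h.dom_eq] at he
    simpa using (h2 k hk).2 he.symm
  · refine h3.trans (Nat.add_le_add_left ?_ _)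
    refine (sum_map_le_sum h.represents.nodes_nodup (fun k hk => ?_) _).trans
      (Finset.sum_le_sum fun k _ => by omega)
    rw [← h.nodes_eq]
    exact (h.represents.mem_nodes k).1 hk

theorem reduceAll_spec (hsolve : Solves solve N sem N.size K) (hv : N.Valid sem f)
    (h : T.Represents N sem) :
    ∃ N' sem', HeadInv N sem f (reduceAll solve T).val N' sem' ∧ (∀ k, ¬ N'.NonReduced k) ∧
      (reduceAll solve T).time ≤ K * N.size + 59 * (N.size * N.size) := by
  have hN := hv.soundDet
  have hlen := h.length_dom hN.wf.init_mem
  rw [← h.init_eq] at hlen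
  set P := (T.dom T.init).length with hP
  have hcard : ∀ k ∈ N.nodes, (N.dom k).card ≤ P := fun k hk => by
    rw [hlen, h.init_eq, hN.wf.dom_init]
    exact Finset.card_le_card (hN.wf.dom_subset k hk)
  have hstart : HeadInv N sem f T N sem :=
    ⟨h, hv, fun l hl => .loc l hl, rfl, rfl, fun _ => le_rfl, .refl⟩
  have := Timed.forIn_amortized
    (fun T c => Timed.forIn (fun T m => if (T.dom m).length = c then visit solve T m
      else Timed.step T) T.nodes T)
    (fun l T b => ∃ N' sem', HeadInv N sem f T N' sem' ∧ l.Pairwise (· < ·) ∧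
      (∀ k, N'.NonReduced k → (N.dom k).card ∈ l) ∧ b = (K + 23 * N.size) * potential N')
    (fun c => 1 + ∑ k ∈ N.nodes, (2 + if (N.dom k).card = c then 27 * N.size else 0))
    (fun c l T b ⟨N', sem', h1, h2, h3, h4⟩ => by
      obtain ⟨h5, h6⟩ := List.pairwise_cons.1 h2
      obtain ⟨N'', sem'', g1, g2, g3⟩ := visitLoop_spec hsolve h1 (c := c) fun k hk => by
        rw [h1.dom_eq]
        rcases List.mem_cons.1 (h3 k hk) with h7 | h7
        exacts [h7.ge, (h5 _ h7).le]
      refine ⟨_, ⟨N'', sem'', g1, h6, fun k hk => ?_, rfl⟩, by omega⟩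
      obtain ⟨i1, i2⟩ := g2 k hk
      rw [h1.dom_eq] at i2
      exact (List.mem_cons.1 (h3 k i1)).resolve_left i2.ne')
    (List.range (P + 1)) T ((K + 23 * N.size) * potential N)
    ⟨N, sem, hstart, List.pairwise_lt_range, fun k hk =>
      List.mem_range.2 (Nat.lt_succ_of_le (hcard k hk.1.mem)), rfl⟩
  obtain ⟨b, ⟨N', sem', h1, -, h2, -⟩, h3⟩ := this
  refine ⟨N', sem', h1, fun k hk => by simpa using h2 k hk, ?_⟩
  have e1 := potential_le hN
  have e2 := one_le_size hN
  have e3 := card_nodes_le hN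
  have e4 : P ≤ N.size := by
    have h4 := card_dom_le hN.wf.init_mem
    rw [hlen, h.init_eq]
    exact le_trans (by nlinarith) h4
  have e5 : ((List.range (P + 1)).map fun c => 1 + (1 + ∑ k ∈ N.nodes,
      (2 + if (N.dom k).card = c then 27 * N.size else 0))).sum =
      (P + 1) * (2 + N.nodes.card * 2) + N.nodes.card * (27 * N.size) := by
    rw [← List.sum_toFinset _ List.nodup_range, List.toFinset_range]
    simp only [Finset.sum_add_distrib, Finset.sum_const, Finset.card_range, smul_eq_mul]
    rw [Finset.sum_comm, Finset.sum_congr rfl fun k hk => (Finset.sum_ite_eq (Finset.range (P + 1))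
      (N.dom k).card fun _ => 27 * N.size).trans (if_pos (Finset.mem_range.2
        (Nat.lt_succ_of_le (hcard k hk))))]
    rw [Finset.sum_const, smul_eq_mul]
    ring
  rw [e5] at h3
  have e6 : (K + 23 * N.size) * potential N ≤ (K + 23 * N.size) * N.size := Nat.mul_le_mul_left _ e1
  have e7 : (P + 1) * (2 + N.nodes.card * 2) ≤ (2 * N.size) * (4 * N.size) :=
    Nat.mul_le_mul (by omega) (by omega)
  have e8 : N.nodes.card * (27 * N.size) ≤ N.size * (27 * N.size) := Nat.mul_le_mul_right _ e3
  have e9 : 1 ≤ N.size * N.size := Nat.mul_le_mul e2 e2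
  unfold reduceAll
  nlinarith

theorem run_spec (hsolve : Solves solve N sem N.size K) (hv : N.Valid sem f)
    (h : T.Represents N sem) : (run solve T).time ≤ 60 * (N.size * (K + N.size)) ∧
      ∃ f N' sem', (run solve T).val.2 = some f ∧ (run solve T).val.1.Represents N' sem' ∧
        Relation.ReflTransGen AlgStep (.head N sem) (.head N' sem') ∧
        AlgStep (.head N' sem') (.done f) := by
  obtain ⟨N', sem', h1, h2, h3⟩ := reduceAll_spec hsolve hv h
  have hN := h1.valid.soundDet
  have hi := hN.wf.init_mem
  have hred : N'.LocallyReduced N'.init := by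
    by_contra hcon
    exact h2 _ ((nonReduced_iff hN).2 ⟨hN.reachableNode_init, hN.wf.init_ne_fin, hcon⟩)
  obtain ⟨a, ha, -⟩ := hred
  have hout : (reduceAll solve T).val.out (reduceAll solve T).val.init = [a] := by
    rw [h1.represents.init_eq]
    have hlen := h1.represents.length_out hi
    rw [ha, Finset.card_singleton, List.length_eq_one_iff] at hlen
    obtain ⟨b, hb⟩ := hlen
    have := h1.represents.mem_out _ hi b
    rw [hb, ha] at this
    rw [hb, show b = a by simpa using this]
  constructor
  · have e2 := one_le_size hv.soundDet
    have e9 : 1 ≤ N.size * N.size := Nat.mul_le_mul e2 e2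
    simp only [run, Timed.time_bind, Timed.time_step]
    nlinarith
  · refine ⟨sem' (N'.init, a), N', sem', ?_, h1.represents, h1.steps, .output a h2 ha⟩
    simp only [run, Timed.val_bind, Timed.val_step, hout, List.head?_cons, Option.map_some]
    rw [h1.represents.init_eq, h1.represents.val_eq _ hi a (by simp [ha])]

end Tables

theorem mainTheorem1 :
    ∃ K : ℕ, ∀ (Proc : Type*) (Node : Type*) (R : Type*) (D : Type*)
      [DecidableEq Proc] [DecidableEq Node] [DecidableEq R] [CompleteLattice D]
      (N : Negotiation Proc Node R) (sem : Node × R → D → D),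
      N.WellFormed → N.Deterministic → N.Sound →
      N.IsFramework sem → N.MazurkiewiczInvariant sem →
      -- the algorithm stops, whatever choices it makes
      (¬ ∃ s : ℕ → AlgState Proc Node R D, s 0 = .head N sem ∧ ∀ i, AlgStep (s i) (s (i + 1))) ∧
      -- it never gets stuck before it outputs a result
      (∀ s, Relation.ReflTransGen AlgStep (.head N sem) s →
        (∃ f, s = .done f) ∨ ∃ s', AlgStep s s') ∧
      -- its output is the abstract semantics
      (∀ f, Relation.ReflTransGen AlgStep (.head N sem) (.done f) →
        f = N.semInf sem ∧ f = N.semSup sem) ∧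
      -- the subnegotiations evaluated in the first for-loop are one-trace negotiations
      (∀ N' sem' X todo n a C₀ C,
        Relation.ReflTransGen AlgStep (.head N sem) (.forLoc N' sem' X todo) →
        (n, a) ∈ todo → N'.IsFirst n C₀ → N'.IsLastLoc n a C₀ C →
        (N'.subLoc n a C₀ C).OneTrace) ∧
      -- the subnegotiations evaluated in the second for-loop are replications
      (∀ N' sem' X todo tab n C₀ C,
        Relation.ReflTransGen AlgStep (.head N sem) (.forVal N' sem' X todo tab) →
        n ∈ todo → N'.IsFirst n C₀ → N'.IsLastNode n C₀ C →
        (N'.subNode n C₀ C).Replication) ∧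
      -- running time: `solve` is any procedure for the analysis of flow-graphs, with cost at most
      -- `C` on flow-graphs of size at most the size of `N`
      (∀ (T : Tables Proc Node R D) (solve : FlowGraph (Option Node) D → Timed (D → D)) (C : ℕ),
        T.Represents N sem →
        (∀ G : FlowGraph (Option Node) D, G.size ≤ N.size →
          (∀ e ∈ G.edges, Transformer N sem e.2.1) →
          (solve G).val = G.mop ∧ (solve G).time ≤ C) →
        (Tables.run solve T).time ≤ K * (N.size * (C + N.size)) ∧
        ∃ f N' sem', (Tables.run solve T).val.2 = some f ∧
          (Tables.run solve T).val.1.Represents N' sem' ∧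
          Relation.ReflTransGen AlgStep (.head N sem) (.head N' sem') ∧
          AlgStep (.head N' sem') (.done f)) := by
  refine ⟨60, ?_⟩
  intro Proc Node R D _ _ _ _ N sem h1 h2 h3 h4 h5
  have hv : N.Valid sem (N.mop sem) := ⟨⟨h1, h2, h3⟩, h4, h5, rfl⟩
  have hI : ∃ x, AlgInv (N.mop sem) (.head N sem) x := ⟨_, hv, rfl⟩
  refine ⟨?_, fun s hs => ?_, fun f hf => ?_, ?_, ?_, fun T solve C hT hsolve => ?_⟩
  · rintro ⟨s, hs, hstep⟩
    obtain ⟨x, hx⟩ := hI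
    exact AlgInv.no_infinite (hs ▸ hx) hstep
  · obtain ⟨x, hx⟩ := AlgInv.reach hI hs
    exact hx.progress
  · obtain ⟨x, hx⟩ := AlgInv.reach hI hf
    obtain rfl : f = N.mop sem := hx
    exact ⟨(semInf_eq_mop hv.soundDet h5).symm, (semSup_eq_mop hv.soundDet h5).symm⟩
  · intro N' sem' X todo n a C₀ C hs hl h₀ hC
    obtain ⟨x, hx, -⟩ := AlgInv.reach hI hs
    have hX := (hx.todo_subset hl).1.2.2
    exact oneTrace_subLoc hx.soundDet (hX ▸ hx.reducedBelow) h₀ hC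
  · intro N' sem' X todo tab n C₀ C hs hn h₀ hC
    obtain ⟨x, hx, -⟩ := AlgInv.reach hI hs
    obtain ⟨-, hf, hX⟩ := hx.todo_subset hn
    exact replication_subNode hx.soundDet (hX ▸ hx.locsReduced) hf h₀ hC
  · exact Tables.run_spec hsolve hv hT
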